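/- All graphs are finite and simple. For a graph $G$ and $S\subseteq V(G)$ let $\kappa_G(S)$ be the maximum number $t$ of pairwise edge-disjoint trees $T_1,\dots,T_t$ in $G$, each containing $S$, with $V(T_i)\cap V(T_j)=S$ for $i\ne j$. The generalized $3$-connectivity is $\kappa_3(G)=\min\{\kappa_G(S): S\subseteq V(G),\ |S|=3\}$ (defined when $|V(G)|\ge 3$). A graph is $m$-connected if it has more than $m$ vertices and stays connected whenever fewer than $m$ vertices are deleted. Let $n,r,a\ge 1$ be integers, and let $G_1,\dots,G_n$ be graphs such that: 1. $G_1$ has $a$ vertices. 2. For $2\le k\le n$ the vertex set of $G_k$ is partitioned into $p_k$ classes, and the subgraphs $G_{k-1}^1,\dots,G_{k-1}^{p_k}$ of $G_k$ induced by the classes are each isomorphic to $G_{k-1}$ (the copies of $G_{k-1}$ in $G_k$). 3. For $2\le k\le n$ every vertex of $G_k$ has exactly two neighbours outside its own copy (its outside neighbours), and these two lie in different copies. 4. For $2\le k\le n$ the number of edges of $G_k$ between $G_{k-1}^i$ and $G_{k-1}^j$ is the same for all $i\neq j$ (it then equals $\frac{2ap_2p_3\cdots p_{k-1}}{p_k-1}$).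 5. For $2\le k\le n$ with $r+2(k-2)\ge 4$ one has $\frac{2ap_2p_3\cdots p_{k-1}}{p_k-1}\ge r+2(k-2)+2$. 6. For $1\le k\le n$ the graph $G_k$ is $(r+2(k-1))$-regular and $(r+2(k-1))$-connected. **Theorem 1.** Suppose that $\kappa_3(G_1)=r-1$ and, if $n\ge 2$, that any two vertices of $G_n$ lying in different copies of $G_{n-1}$ have at most one common outside neighbour. Then $$\kappa_3(G_n)=r+2n-3,$$ which is the degree of $G_n$ minus one. -/

import Mathlib

namespace SimpleGraph

/-- `G` is `m`-connected: it has more than `m` vertices, and it stays connected whenever fewer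
than `m` vertices are deleted. -/
def IsVertexConnected {V : Type*} (G : SimpleGraph V) (m : ℕ) : Prop :=
  (m : ℕ∞) < ENat.card V ∧
    ∀ X : Finset V, X.card < m → (G.induce ((X : Set V)ᶜ)).Connected

/-- `T 0, …, T (t - 1)` are internally disjoint trees of `G` connecting `S`: subgraphs of `G` that
are trees containing all vertices of `S`, pairwise without a common edge and pairwise without a
common vertex outside `S`. -/
structure IsInternallyDisjointTrees {V : Type*} (G : SimpleGraph V) (S : Finset V) {t : ℕ}
    (T : Fin t → G.Subgraph) : Prop where
  isTree : ∀ i, (T i).coe.IsTree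
  subset_verts : ∀ i, (S : Set V) ⊆ (T i).verts
  edge_disjoint : ∀ i j, i ≠ j → Disjoint (T i).edgeSet (T j).edgeSet
  verts_inter : ∀ i j, i ≠ j → (T i).verts ∩ (T j).verts = (S : Set V)

/-- `κ_G(S)`: the maximum number of internally disjoint trees of `G` connecting `S`. -/
noncomputable def setConnectivity {V : Type*} (G : SimpleGraph V) (S : Finset V) : ℕ∞ :=
  ⨆ (t : ℕ) (_ : ∃ T : Fin t → G.Subgraph, G.IsInternallyDisjointTrees S T), (t : ℕ∞)

/-- The generalized `k`-connectivity `κ_k(G)`: the minimum of `κ_G(S)` over all sets `S` of `k`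
vertices. (It is `⊤` when `G` has fewer than `k` vertices.) -/
noncomputable def genConnectivity {V : Type*} (k : ℕ) (G : SimpleGraph V) : ℕ∞ :=
  ⨅ (S : Finset V) (_ : S.card = k), G.setConnectivity S

/-- The outside neighbours of `u`, where `copy` tells in which copy a vertex lies. -/
def outsideNeighbors {V : Type*} (G : SimpleGraph V) (copy : V → ℕ) (u : V) : Set V :=
  {w | G.Adj u w ∧ copy w ≠ copy u}

/-- The edges between copy `i` and copy `j` (each listed once, from `i` to `j`, when `i ≠ j`). -/
def crossEdges {V : Type*} (G : SimpleGraph V) (copy : V → ℕ) (i j : ℕ) : Set (V × V) :=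
  {e | G.Adj e.1 e.2 ∧ copy e.1 = i ∧ copy e.2 = j}

/-- `G 1, …, G n` is a recursive construction of an `n`-th regular graph `G n` with parameters
`r`, `a` and `p 2, …, p n`. For `2 ≤ k ≤ n` the graph `G k` consists of `p k` copies of `G (k - 1)`,
numbered `1, …, p k`, and `copy k v` is the number of the copy that contains the vertex `v`.
(Nothing is required of `V k`, `G k` for `k = 0` or `k > n`, nor of `copy k`, `p k` for `k < 2`
or `k > n`.) -/
structure IsRecursivelyRegular (n r a : ℕ) (p : ℕ → ℕ) (V : ℕ → Type*)
    [∀ k, Fintype (V k)] (G : ∀ k, SimpleGraph (V k)) [∀ k, DecidableRel (G k).Adj]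
    (copy : ∀ k, V k → ℕ) : Prop where
  card_one : Fintype.card (V 1) = a
  regular : ∀ k, 1 ≤ k → k ≤ n → (G k).IsRegularOfDegree (r + 2 * (k - 1))
  connected : ∀ k, 1 ≤ k → k ≤ n → (G k).IsVertexConnected (r + 2 * (k - 1))
  copy_mem : ∀ k, 2 ≤ k → k ≤ n → ∀ v, copy k v ∈ Finset.Icc 1 (p k)
  copy_iso : ∀ k, 2 ≤ k → k ≤ n → ∀ i ∈ Finset.Icc 1 (p k),
    Nonempty ((G k).induce {v | copy k v = i} ≃g G (k - 1))
  two_outside : ∀ k, 2 ≤ k → k ≤ n → ∀ u, ((G k).outsideNeighbors (copy k) u).ncard = 2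
  outside_different : ∀ k, 2 ≤ k → k ≤ n → ∀ u,
    Set.InjOn (copy k) ((G k).outsideNeighbors (copy k) u)
  same_cross : ∀ k, 2 ≤ k → k ≤ n → ∃ c : ℕ,
    ∀ i ∈ Finset.Icc 1 (p k), ∀ j ∈ Finset.Icc 1 (p k), i ≠ j →
      ((G k).crossEdges (copy k) i j).ncard = c
  many_cross : ∀ k, 2 ≤ k → k ≤ n → 4 ≤ r + 2 * (k - 2) →
    (r : ℚ) + 2 * ((k : ℚ) - 2) + 2 ≤
      (2 * (a : ℚ) * ∏ i ∈ Finset.Icc 2 (k - 1), (p i : ℚ)) / ((p k : ℚ) - 1)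

end SimpleGraph

/-!
The upper bound holds for every `d`-regular graph. Take adjacent vertices `x`, `y` and a third
vertex `z`. Each of `t` internally disjoint trees on `{x, y, z}` uses an edge at `x` and an edge
at `y`; if `t = d`, it uses exactly one of each, and the tree that contains the edge `xy` cannot
reach `z` (`HasConnectors.lt_degree`).

For the lower bound, trees are replaced by *connectors* (`Connectors`): connected subgraphs that
contain the given three vertices and are otherwise disjoint. They may be larger than necessary,
which makes them easy to assemble; spanning trees turn them into trees
(`HasConnectors.le_setConnectivity`). Let `h` be the degree of `G (k - 1)`, so that `h - 1`
connectors exist for any three vertices of `G (k - 1)` by induction, and `h + 1` are needed in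
`G k`. The main tool is the fan version of Menger's theorem in the form `exists_fan`: walks from
`z`, disjoint apart from `z`, end at different *labels*, where one label stands for a whole link
between `x` and `y` and two further labels stand for `x` and `y` themselves. A walk ending at a
link makes the link a connector of `{x, y, z}`. A walk to `x` or to `y` can be added to any link
(`exists_wild_connectors`), and the two together form a connector by themselves
(`hasConnectors_of_all_labels`).

For `h ≥ 4` the bound on the number of edges between two copies, with the common value computed
by double counting, shows that any two copies are joined by a matching of at least `h + 2`
edges; thus unions of copies are highly connected (`CopyGraph.reach_or`). There are three cases.

* If `x`, `y`, `z` lie in the same copy, the `h - 1` connectors inside this copy are completed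
  by two disjoint connected sets outside it, each adjacent to all of `x`, `y`, `z`
  (`CopyGraph.exists_outer_pair`). These are unions of copies, unless the outside neighbours of
  `x`, `y`, `z` occupy three copies in a triangular pattern; then one of these copies has to be
  divided (`KConn.exists_disjoint_joinedIn`).
* If `x`, `y` lie in one copy and `z` in another, that copy is partitioned into `h` links
  between `x` and `y`, and `z` sends walks through the other copies to all labels
  (`CopyGraph.hasConnectors_two_one`).
* If `x`, `y`, `z` lie in different copies, the copies of `x` and `y` are partitioned into sets
  hanging from `x` and from `y`, which the edges between the two copies join to links. If `x`
  and `y` have neighbours in the copies of each other, these give an additional link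
  (`CopyGraph.hasConnectors_of_mutual`); otherwise, after renaming, `y` has no neighbour in the
  copy of `x`, and `z` reaches all labels (`CopyGraph.hasConnectors_of_not_adj_copy`).

If `h < 4` and `k ≥ 2`, then `G k` has degree `4` or `5`, since `κ₃ (G 1) = r - 1` excludes
`r = 1`: a connected graph has `κ₃ ≥ 1`. For `d = 4, 5` every `d`-connected graph has `d - 1`
connectors for any three vertices
(`KConn.hasConnectors`): starting from `d` disjoint links between `x` and `y`, two walks from
`z` that end at the same link break it into a walk to `x` and a walk to `y`, which can be kept
while the remaining walks are chosen anew (`Config.extend`); for such small `d` this stops after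
at most two rounds.
-/

/-! ### Menger's theorem for relations -/

namespace Relation

variable {U : Type*}

/-- `ReachIn R F a b`: one can go from `a` to `b` along `R`-steps that stay inside `F`. For `a = b`
this holds even if `a ∉ F`. -/
def ReachIn (R : U → U → Prop) (F : Set U) : U → U → Prop :=
  ReflTransGen (fun u v => R u v ∧ u ∈ F ∧ v ∈ F)

theorem ReachIn.mono {R R' : U → U → Prop} {F F' : Set U} {a b : U} (h : ReachIn R F a b)
    (hR : ∀ u v, u ∈ F → v ∈ F → R u v → R' u v) (hF : F ⊆ F') : ReachIn R' F' a b :=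
  ReflTransGen.mono (fun u v huv => ⟨hR u v huv.2.1 huv.2.2 huv.1, hF huv.2.1, hF huv.2.2⟩) _ _ h

theorem ReachIn.mem {R : U → U → Prop} {F : Set U} {a b : U} (h : ReachIn R F a b) (ha : a ∈ F) :
    b ∈ F := by
  cases h with
  | refl => exact ha
  | tail _ h => exact h.2.2

theorem ReachIn.swap {R : U → U → Prop} {F : Set U} {a b : U} (h : ReachIn R F a b) :
    ReachIn (Function.swap R) F b a := by
  induction h with
  | refl => exact .refl
  | tail _ h ih => exact .head ⟨h.1, h.2.2, h.2.1⟩ ih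

theorem ReachIn.trans {R : U → U → Prop} {F : Set U} {a b c : U} (h : ReachIn R F a b)
    (h' : ReachIn R F b c) : ReachIn R F a c := ReflTransGen.trans h h'

/-- A walk that leaves `R` minus the arrow from `u` to `v` has to pass through `u` before. -/
theorem ReachIn.hit_or_avoid {R : U → U → Prop} {u v : U} {Z T : Set U} (hu : u ∈ T) {a b : U}
    (ha : a ∉ Z) (hab : ReachIn R Zᶜ a b) :
    (∃ s ∈ T, s ∉ Z ∧ ReachIn (fun s t => R s t ∧ ¬ (s = u ∧ t = v)) Zᶜ a s) ∨
      (a ∉ T ∧ b ∉ T ∧ ReachIn (fun s t => R s t ∧ ¬ (s = u ∧ t = v)) Zᶜ a b ∧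
        ReachIn (fun s t => R s t ∧ ¬ (s = u ∧ t = v)) Tᶜ a b) := by
  induction hab with
  | refl =>
    by_cases h : a ∈ T
    · exact Or.inl ⟨a, h, ha, .refl⟩
    · exact Or.inr ⟨h, h, .refl, .refl⟩
  | @tail w w' _ hw ih =>
    rcases ih with h | ⟨h1, h2, h3, h4⟩
    · exact Or.inl h
    · have hne : w ≠ u := fun e => h2 (e ▸ hu)
      have h5 : ReachIn (fun s t => R s t ∧ ¬ (s = u ∧ t = v)) Zᶜ a w' :=
        h3.tail ⟨⟨hw.1, fun e => hne e.1⟩, hw.2⟩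
      by_cases h : w' ∈ T
      · exact Or.inl ⟨w', h, hw.2.2, h5⟩
      · exact Or.inr ⟨h1, h, h5, h4.tail ⟨⟨hw.1, fun e => hne e.1⟩, h2, h⟩⟩

/-- A walk inside `F` that ends in `s`, the only vertex of `X` in `F`, can be cut down to
vertices that are reached from `A` without touching `X`, and `s` itself. -/
theorem ReachIn.truncate {R : U → U → Prop} {F X A : Set U} {a s : U} (haA : a ∈ A) (haF : a ∈ F)
    (hX : ∀ w ∈ F, w ∈ X → w = s) (h : ReachIn R F a s) :
    let F' := {w | w ∈ F ∧ (w = s ∨ ∃ a ∈ A, a ∉ X ∧ ReachIn R Xᶜ a w)}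
    a ∈ F' ∧ s ∈ F' ∧ ReachIn R F' a s ∧ (s ∉ X → ∃ a ∈ A, a ∉ X ∧ ReachIn R Xᶜ a s) := by
  intro F'
  have key : ∀ w, ReachIn R F a w → ReachIn R F' a s ∨
      ((∃ a ∈ A, a ∉ X ∧ ReachIn R Xᶜ a w) ∧ w ∈ F' ∧ w ∉ X ∧ ReachIn R F' a w) := by
    intro w hw
    induction hw with
    | refl =>
      by_cases has : a = s
      · subst has; exact Or.inl .refl
      · have haX : a ∉ X := fun hh => has (hX a haF hh)
        exact Or.inr ⟨⟨a, haA, haX, .refl⟩, ⟨haF, Or.inr ⟨a, haA, haX, .refl⟩⟩, haX, .refl⟩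
    | @tail w w' _ hww ih =>
      rcases ih with ih | ⟨⟨a', h1, h2, h3⟩, h4, h5, h6⟩
      · exact Or.inl ih
      · by_cases has : w' = s
        · subst has
          exact Or.inl (h6.tail ⟨hww.1, h4, ⟨hww.2.2, Or.inl rfl⟩⟩)
        · have hwX : w' ∉ X := fun hh => has (hX w' hww.2.2 hh)
          have hr : ∃ a ∈ A, a ∉ X ∧ ReachIn R Xᶜ a w' := ⟨a', h1, h2, h3.tail ⟨hww.1, h5, hwX⟩⟩
          exact Or.inr ⟨hr, ⟨hww.2.2, Or.inr hr⟩, hwX, h6.tail ⟨hww.1, h4, hww.2.2, Or.inr hr⟩⟩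
  refine ⟨⟨haF, ?_⟩, ⟨h.mem haF, Or.inl rfl⟩, ?_, ?_⟩
  · by_cases has : a = s
    · exact Or.inl has
    · have haX : a ∉ X := fun hh => has (hX a haF hh)
      exact Or.inr ⟨a, haA, haX, .refl⟩
  · rcases key s h with h' | h'
    · exact h'
    · exact h'.2.2.2
  · intro hs
    have hFX : F ⊆ Xᶜ := fun w hw hwX => hs (hX w hw hwX ▸ hwX)
    exact ⟨a, haA, hFX haF, h.mono (fun _ _ _ _ h => h) hFX⟩

/-- **Menger's theorem** for a relation `R` on a finite type: if fewer than `k` elements never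
separate `A` from `B`, then there are `k` pairwise disjoint sets, each of which contains an
`R`-walk from `A` to `B`. -/
theorem menger [Finite U] (R : U → U → Prop) (A B : Set U) (k : ℕ)
    (h : ∀ X : Finset U, X.card < k → ∃ a ∈ A, ∃ b ∈ B, a ∉ X ∧ ReachIn R (X : Set U)ᶜ a b) :
    ∃ F : Fin k → Set U, (∀ i j, i ≠ j → Disjoint (F i) (F j)) ∧
      ∀ i, ∃ a ∈ A, ∃ b ∈ B, a ∈ F i ∧ b ∈ F i ∧ ReachIn R (F i) a b := by
  classical
  -- Göring's induction on the number of arrows that are not loops.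
  induction hn : {e : U × U | R e.1 e.2 ∧ e.1 ≠ e.2}.ncard using Nat.strong_induction_on
    generalizing R A B with
  | _ n ih =>
  by_cases hloop : ∀ u v, R u v → u = v
  · have hst : ∀ (F : Set U) a b, ReachIn R F a b → a = b := by
      intro F a b hab
      induction hab with
      | refl => rfl
      | tail _ h1 h2 => exact h2.trans (hloop _ _ h1.1)
    have hcard : k ≤ (A ∩ B).toFinite.toFinset.card := by
      by_contra hlt
      obtain ⟨a, ha, b, hb, haX, hab⟩ := h _ (not_le.1 hlt)
      obtain rfl := hst _ _ _ hab
      exact haX (by simp [ha, hb])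
    obtain ⟨T, hT, hTk⟩ := Finset.exists_subset_card_eq hcard
    let e := T.equivFinOfCardEq hTk
    refine ⟨fun i => {(e.symm i : U)}, ?_, ?_⟩
    · intro i j hij
      rw [Set.disjoint_singleton]
      intro hh
      exact hij (e.symm.injective (Subtype.ext hh))
    · intro i
      have := hT (e.symm i).2
      simp only [Set.Finite.mem_toFinset] at this
      exact ⟨_, this.1, _, this.2, rfl, rfl, .refl⟩
  · push Not at hloop
    obtain ⟨u, v, huv, hne⟩ := hloop
    set R' : U → U → Prop := fun s t => R s t ∧ ¬ (s = u ∧ t = v) with hR'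
    have hlt : {e : U × U | R' e.1 e.2 ∧ e.1 ≠ e.2}.ncard < n := by
      rw [← hn]
      apply Set.ncard_lt_ncard _ (Set.toFinite _)
      refine ⟨fun e he => ⟨he.1.1, he.2⟩, fun hh => ?_⟩
      exact (hh (show (u, v) ∈ _ from ⟨huv, hne⟩)).1.2 ⟨rfl, rfl⟩
    by_cases hsep : ∀ X : Finset U, X.card < k →
        ∃ a ∈ A, ∃ b ∈ B, a ∉ X ∧ ReachIn R' (X : Set U)ᶜ a b
    · obtain ⟨F, hF, hF'⟩ := ih _ hlt R' A B hsep rfl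
      refine ⟨F, hF, fun i => ?_⟩
      obtain ⟨a, ha, b, hb, haF, hbF, hab⟩ := hF' i
      exact ⟨a, ha, b, hb, haF, hbF, hab.mono (fun _ _ _ _ h => h.1) subset_rfl⟩
    push Not at hsep
    obtain ⟨X, hXk, hX⟩ := hsep
    -- a separator of `R` obtained from `X` by adding an end of the deleted arrow
    have huX : u ∉ X ∧ (insert u X).card = k := by
      have h1 : k ≤ (insert u X).card := by
        by_contra hlt'
        obtain ⟨a, ha, b, hb, haX, hab⟩ := h _ (not_le.1 hlt')
        have := ReachIn.hit_or_avoid (u := u) (v := v) (T := ((insert u X : Finset U) : Set U))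
          (by simp) (by simpa using haX) hab
        rcases this with ⟨s, hs, hs', _⟩ | ⟨_, _, h3, _⟩
        · exact hs' hs
        · exact hX a ha b hb (fun hh => haX (Finset.mem_insert_of_mem hh))
            (h3.mono (fun _ _ _ _ h => h) (by
              intro w hw hw'
              exact hw (Finset.mem_insert_of_mem hw')))
      have h2 := Finset.card_insert_le u X
      refine ⟨fun hu => ?_, by omega⟩
      rw [Finset.insert_eq_of_mem hu] at h1
      omega
    have hvX : v ∉ X ∧ (insert v X).card = k := by
      have h1 : k ≤ (insert v X).card := by
        by_contra hlt'
        obtain ⟨a, ha, b, hb, haX, hab⟩ := h _ (not_le.1 hlt')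
        have hbX : b ∉ insert v X := by
          have := hab.mem (by simpa using haX)
          simpa using this
        have := ReachIn.hit_or_avoid (u := v) (v := u) (T := ((insert v X : Finset U) : Set U))
          (by simp) (by simpa using hbX) hab.swap
        rcases this with ⟨s, hs, hs', _⟩ | ⟨_, _, h3, _⟩
        · exact hs' hs
        · exact hX a ha b hb (fun hh => haX (Finset.mem_insert_of_mem hh))
            (h3.swap.mono (fun s t _ _ h => ⟨h.1, fun e => h.2 ⟨e.2, e.1⟩⟩) (by
              intro w hw hw'
              exact hw (Finset.mem_insert_of_mem hw')))
      have h2 := Finset.card_insert_le v X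
      refine ⟨fun hu => ?_, by omega⟩
      rw [Finset.insert_eq_of_mem hu] at h1
      omega
    -- `k` disjoint walks from `A` to `X ∪ {u}`
    obtain ⟨F, hF, hF'⟩ := ih _ hlt R' A ((insert u X : Finset U) : Set U) (by
      intro Z hZ
      obtain ⟨a, ha, b, hb, haZ, hab⟩ := h Z hZ
      have := ReachIn.hit_or_avoid (u := u) (v := v) (T := ((insert u X : Finset U) : Set U))
          (by simp) (by simpa using haZ) hab
      rcases this with ⟨s, hs, hs', h3⟩ | ⟨h3, _, _, h4⟩
      · exact ⟨a, ha, s, hs, haZ, h3⟩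
      · exact absurd (h4.mono (fun _ _ _ _ h => h) (by
              intro w hw hw'
              exact hw (Finset.mem_insert_of_mem hw')))
            (hX a ha b hb (fun hh => h3 (Finset.mem_insert_of_mem hh)))) rfl
    have hlt' : {e : U × U | Function.swap R' e.1 e.2 ∧ e.1 ≠ e.2}.ncard < n := by
      refine lt_of_le_of_lt ?_ hlt
      refine Set.ncard_le_ncard_of_injOn Prod.swap ?_ Prod.swap_injective.injOn (Set.toFinite _)
      exact fun e he => ⟨he.1, he.2.symm⟩
    -- `k` disjoint walks from `X ∪ {v}` to `B`
    obtain ⟨G, hG, hG'⟩ := ih _ hlt' (Function.swap R') B ((insert v X : Finset U) : Set U) (by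
      intro Z hZ
      obtain ⟨a, ha, b, hb, haZ, hab⟩ := h Z hZ
      have hbZ : b ∉ (Z : Set U) := hab.mem (by simpa using haZ)
      have := ReachIn.hit_or_avoid (u := v) (v := u) (T := ((insert v X : Finset U) : Set U))
          (by simp) hbZ hab.swap
      rcases this with ⟨s, hs, hs', h3⟩ | ⟨_, h3, _, h4⟩
      · exact ⟨b, hb, s, hs, hbZ,
          h3.mono (fun s t _ _ h => ⟨h.1, fun e => h.2 ⟨e.2, e.1⟩⟩) subset_rfl⟩
      · exact absurd (h4.swap.mono (fun s t _ _ h => ⟨h.1, fun e => h.2 ⟨e.2, e.1⟩⟩) (by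
              intro w hw hw'
              exact hw (Finset.mem_insert_of_mem hw')))
            (hX a ha b hb (fun hh => h3 (Finset.mem_insert_of_mem hh)))) rfl
    choose a haA s hs haF hsF has using hF'
    choose b hbB t ht hbG htG hbt using hG'
    have hdisj : ∀ {W : Fin k → Set U}, (∀ i j, i ≠ j → Disjoint (W i) (W j)) →
        ∀ i j w, w ∈ W i → w ∈ W j → i = j := fun hW i j w h1 h2 => by
      by_contra hij
      exact (Set.disjoint_left.1 (hW i j hij)) h1 h2
    have hsinj : Function.Injective s := fun i j hij => hdisj hF i j (s i) (hsF i) (hij ▸ hsF j)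
    have htinj : Function.Injective t := fun i j hij => hdisj hG i j (t i) (htG i) (hij ▸ htG j)
    have hsurj : ∀ {W : Finset U} {f : Fin k → U}, W.card = k → Function.Injective f →
        (∀ i, f i ∈ W) → ∀ w ∈ W, ∃ i, f i = w := by
      intro W f hW hf hfW w hw
      have : Finset.univ.image f = W := Finset.eq_of_subset_of_card_le
        (fun x hx => by obtain ⟨i, -, rfl⟩ := Finset.mem_image.1 hx; exact hfW i)
        (by rw [Finset.card_image_of_injective _ hf]; simp [hW])
      rw [← this] at hw
      obtain ⟨i, -, hi⟩ := Finset.mem_image.1 hw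
      exact ⟨i, hi⟩
    have hss := hsurj huX.2 hsinj hs
    have htt := hsurj hvX.2 htinj ht
    have hFX : ∀ i, ∀ w ∈ F i, w ∈ (X : Set U) → w = s i := by
      intro i w hw hwX
      obtain ⟨j, rfl⟩ := hss w (Finset.mem_insert_of_mem hwX)
      rw [hdisj hF i j _ hw (hsF j)]
    have hGX : ∀ i, ∀ w ∈ G i, w ∈ (X : Set U) → w = t i := by
      intro i w hw hwX
      obtain ⟨j, rfl⟩ := htt w (Finset.mem_insert_of_mem hwX)
      rw [hdisj hG i j _ hw (htG j)]
    have hFt := fun i => ReachIn.truncate (haA i) (haF i) (hFX i) (has i)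
    have hGt := fun i => ReachIn.truncate (hbB i) (hbG i) (hGX i) (hbt i)
    have hAB : ∀ w, (∃ a ∈ A, a ∉ (X : Set U) ∧ ReachIn R' (X : Set U)ᶜ a w) →
        (∃ b ∈ B, b ∉ (X : Set U) ∧ ReachIn (Function.swap R') (X : Set U)ᶜ b w) → False := by
      rintro w ⟨a, ha, haX, haw⟩ ⟨b, hb, -, hbw⟩
      exact hX a ha b hb haX (haw.trans hbw.swap)
    have hτ : ∀ i, ∃ j, t j = if s i = u then v else s i := by
      intro i
      apply htt
      split_ifs with hi
      · simp
      · have := hs i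
        simp only [Finset.coe_insert, Set.mem_insert_iff, hi, false_or, Finset.mem_coe] at this
        exact Finset.mem_insert_of_mem this
    choose τ hτ using hτ
    have hsX : ∀ i, s i ≠ u → s i ∈ (X : Set U) := fun i hi => by
      have := hs i
      simpa [hi] using this
    have htX : ∀ i, t i ≠ v → t i ∈ (X : Set U) := fun i hi => by
      have := ht i
      simpa [hi] using this
    have hst : ∀ i j, s i = t (τ j) → i = j := by
      intro i j hij
      rw [hτ] at hij
      split_ifs at hij with hj
      · exfalso
        by_cases hi : s i = u
        · exact hne (hi.symm.trans hij)
        · exact hvX.1 (by simpa [hij] using hsX i hi)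
      · exact hsinj hij
    have hτinj : Function.Injective τ := by
      intro i j hij
      have h1 := hτ i
      rw [hij, hτ j] at h1
      split_ifs at h1 with h2 h3 h3
      · exact hsinj (h3.trans h2.symm)
      · exfalso; apply hvX.1; have := hsX i h3; rwa [← h1] at this
      · exfalso; apply hvX.1; have := hsX j h2; rwa [h1] at this
      · exact hsinj h1.symm
    have hcross : ∀ i j w, (w ∈ F i ∧ (w = s i ∨ ∃ a ∈ A, a ∉ (X : Set U) ∧
          ReachIn R' (X : Set U)ᶜ a w)) →
        (w ∈ G (τ j) ∧ (w = t (τ j) ∨ ∃ b ∈ B, b ∉ (X : Set U) ∧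
          ReachIn (Function.swap R') (X : Set U)ᶜ b w)) → i = j := by
      rintro i j w ⟨h1, h2⟩ ⟨h3, h4⟩
      rcases h2 with h2 | h2 <;> rcases h4 with h4 | h4
      · exact hst i j (h2.symm.trans h4)
      · by_cases hw : w ∈ (X : Set U)
        · exact hst i j (h2.symm.trans (hGX _ w h3 hw))
        · exact (hAB w (h2 ▸ (hFt i).2.2.2 (h2 ▸ hw)) h4).elim
      · by_cases hw : w ∈ (X : Set U)
        · exact hst i j ((hFX _ w h1 hw).symm.trans h4)
        · exact (hAB w h2 (h4 ▸ (hGt _).2.2.2 (h4 ▸ hw))).elim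
      · exact (hAB w h2 h4).elim
    refine ⟨fun i => {w | w ∈ F i ∧ (w = s i ∨ ∃ a ∈ A, a ∉ (X : Set U) ∧
        ReachIn R' (X : Set U)ᶜ a w)} ∪ {w | w ∈ G (τ i) ∧ (w = t (τ i) ∨ ∃ b ∈ B,
        b ∉ (X : Set U) ∧ ReachIn (Function.swap R') (X : Set U)ᶜ b w)}, ?_, ?_⟩
    · intro i j hij
      rw [Set.disjoint_left]
      rintro w (hw | hw) (hw' | hw')
      · exact hij (hdisj hF i j w hw.1 hw'.1)
      · exact hij (hcross i j w hw hw')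
      · exact hij (hcross j i w hw' hw).symm
      · exact hij (hτinj (hdisj hG _ _ w hw.1 hw'.1))
    · intro i
      refine ⟨a i, haA i, b (τ i), hbB _, Or.inl (hFt i).1, Or.inr (hGt _).1, ?_⟩
      have h1 := (hFt i).2.2.1
      have h2 := (hGt (τ i)).2.2.1.swap
      refine ((h1.mono (fun _ _ _ _ h => h.1) Set.subset_union_left).trans ?_).trans
        (h2.mono (fun _ _ _ _ h => h.1) Set.subset_union_right)
      by_cases hi : s i = u
      · refine ReflTransGen.single ⟨?_, Or.inl (hFt i).2.1, Or.inr (hGt _).2.1⟩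
        rw [hτ, if_pos hi, hi]
        exact huv
      · have := hτ i
        rw [if_neg hi] at this
        rw [this]
        exact .refl

end Relation

/-! ### Fans -/

namespace Relation

/-- **Fan version of Menger's theorem.** Let `z` be a vertex and let `touch v l` say that a walk
which arrives in `v` may end there with the label `l`. If no choice of fewer than `m` vertices and
labels cuts `z` off from the remaining labels, then `m` different labels can be reached from `z`
by walks that are disjoint apart from `z`. -/
theorem exists_fan {V L : Type*} [Finite V] [Finite L] (R : V → V → Prop) (touch : V → L → Prop)
    (Ω : Set V) (hΩ : ∀ u v, R u v → v ∈ Ω) (z : V) (m : ℕ)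
    (h : ∀ (X : Finset V) (Y : Finset L), z ∉ X → X.card + Y.card < m →
      ∃ v l, l ∉ Y ∧ ReachIn R (X : Set V)ᶜ z v ∧ touch v l) :
    ∃ (l : Fin m → L) (F : Fin m → Set V), Function.Injective l ∧
      (∀ i j, i ≠ j → Disjoint (F i) (F j)) ∧
      ∀ i, F i ⊆ Ω ∧ z ∉ F i ∧ ∃ v, touch v (l i) ∧ v ∈ insert z (F i) ∧
        ReachIn R (insert z (F i)) z v := by
  classical
  let R' : V ⊕ L → V ⊕ L → Prop := fun a b => match a, b with
    | .inl u, .inl v => R u v ∧ u ≠ z ∧ v ≠ z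
    | .inl u, .inr l => touch u l ∧ u ≠ z
    | .inr _, _ => False
  let A : Set (V ⊕ L) := fun a => match a with
    | .inl u => R z u ∧ u ≠ z
    | .inr l => touch z l
  obtain ⟨F', hF', hF⟩ := menger R' A (Set.range Sum.inr) m (by
    intro X' hX'
    have hcard := Finset.card_toLeft_add_card_toRight (u := X')
    obtain ⟨v, l, hl, hzv, hvl⟩ := h (X'.toLeft.erase z) X'.toRight (by simp) (by
      have := Finset.card_erase_le (s := X'.toLeft) (a := z)
      omega)
    have hl' : Sum.inr l ∉ X' := by simpa using hl
    have key : v = z ∨ (v ≠ z ∧ Sum.inl v ∉ X' ∧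
        ∃ a, R z a ∧ a ≠ z ∧ Sum.inl a ∉ X' ∧
          ReachIn R' (X' : Set (V ⊕ L))ᶜ (.inl a) (.inl v)) := by
      clear hvl
      induction hzv with
      | refl => exact Or.inl rfl
      | @tail w w' _ hw ih =>
        by_cases hw' : w' = z
        · exact Or.inl hw'
        right
        have hX : Sum.inl w' ∉ X' := by
          have := hw.2.2
          simpa [hw'] using this
        refine ⟨hw', hX, ?_⟩
        rcases ih with rfl | ⟨h1, h2, a, h3, h4, h5, h6⟩
        · exact ⟨w', hw.1, hw', hX, .refl⟩
        · exact ⟨a, h3, h4, h5, h6.tail ⟨⟨hw.1, h1, hw'⟩, h2, hX⟩⟩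
    rcases key with rfl | ⟨h1, h2, a, h3, h4, h5, h6⟩
    · exact ⟨.inr l, hvl, .inr l, ⟨l, rfl⟩, hl', .refl⟩
    · exact ⟨.inl a, ⟨h3, h4⟩, .inr l, ⟨l, rfl⟩, h5, h6.tail ⟨⟨hvl, h1⟩, h2, hl'⟩⟩)
  choose a ha b hb haF hbF hab using hF
  choose l hl using hb
  refine ⟨l, fun i => {v | v ∈ Ω ∧ v ≠ z ∧ Sum.inl v ∈ F' i}, ?_, ?_, ?_⟩
  · intro i j hij
    by_contra hne
    refine Set.disjoint_left.1 (hF' i j hne) (hbF i) ?_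
    rw [← hl i, hij, hl j]
    exact hbF j
  · intro i j hij
    rw [Set.disjoint_left]
    exact fun v h1 h2 => Set.disjoint_left.1 (hF' i j hij) h1.2.2 h2.2.2
  · intro i
    refine ⟨fun v hv => hv.1, fun hz => hz.2.1 rfl, ?_⟩
    set F := {v | v ∈ Ω ∧ v ≠ z ∧ Sum.inl v ∈ F' i}
    have key : ∀ w, ReachIn R' (F' i) (a i) w →
        (∀ v, w = .inl v → v ∈ F ∧ ReachIn R (insert z F) z v) ∧
        (∀ l, w = .inr l → ∃ v, touch v l ∧ v ∈ insert z F ∧ ReachIn R (insert z F) z v) := by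
      intro w hw
      induction hw with
      | refl =>
        constructor
        · intro v hv
          have h1 : R z v ∧ v ≠ z := by
            have := ha i
            rw [hv] at this
            exact this
          have h2 : v ∈ F := ⟨hΩ _ _ h1.1, h1.2, hv ▸ haF i⟩
          exact ⟨h2, .single ⟨h1.1, Or.inl rfl, Or.inr h2⟩⟩
        · intro l hl
          have h1 : touch z l := by
            have := ha i
            rw [hl] at this
            exact this
          exact ⟨z, h1, Or.inl rfl, .refl⟩
      | @tail w w' _ hw ih =>
        obtain ⟨h1, h2, h3⟩ := hw
        match w, w', h1 with
        | .inl u, .inl v, h1 =>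
          obtain ⟨h4, h5⟩ := ih.1 u rfl
          refine ⟨?_, by simp⟩
          rintro v' ⟨⟩
          have h6 : v ∈ F := ⟨hΩ _ _ h1.1, h1.2.2, h3⟩
          exact ⟨h6, h5.tail ⟨h1.1, Or.inr h4, Or.inr h6⟩⟩
        | .inl u, .inr l, h1 =>
          obtain ⟨h4, h5⟩ := ih.1 u rfl
          refine ⟨by simp, ?_⟩
          rintro l' ⟨⟩
          exact ⟨u, h1.1, Or.inr h4, h5⟩
        | .inr _, _, h1 => exact h1.elim
    exact (key _ (hab i)).2 (l i) (hl i).symm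

end Relation

namespace SimpleGraph

variable {V : Type*} {G : SimpleGraph V}

/-- The graph of all edges of `G` inside `F`, on the vertices of `G`. -/
def within (G : SimpleGraph V) (F : Set V) : SimpleGraph V where
  Adj u v := G.Adj u v ∧ u ∈ F ∧ v ∈ F
  symm := ⟨fun _ _ h => ⟨h.1.symm, h.2.2, h.2.1⟩⟩
  loopless := ⟨fun _ h => G.loopless.irrefl _ h.1⟩

theorem within_mono {F F' : Set V} (h : F ⊆ F') : G.within F ≤ G.within F' :=
  fun _ _ huv => ⟨huv.1, h huv.2.1, h huv.2.2⟩

theorem Adj.reachable_within {F : Set V} {u v : V} (h : G.Adj u v) (hu : u ∈ F) (hv : v ∈ F) :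
    (G.within F).Reachable u v := Adj.reachable (G := G.within F) ⟨h, hu, hv⟩

theorem reachIn_iff_within {F : Set V} {u v : V} :
    Relation.ReachIn G.Adj F u v ↔ (G.within F).Reachable u v := by
  rw [reachable_iff_reflTransGen]
  exact Iff.rfl

/-- A set that contains `u` and is closed under taking neighbours contains every vertex that is
reachable from `u`. -/
theorem Reachable.mem_of_closed {u v : V} (h : G.Reachable u v) {C : Set V} (hu : u ∈ C)
    (hC : ∀ a b, a ∈ C → G.Adj a b → b ∈ C) : v ∈ C := by
  rw [reachable_iff_reflTransGen] at h
  induction h with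
  | refl => exact hu
  | tail _ hab ih => exact hC _ _ ih hab

/-- Fans in a graph: `z` sends `m` walks, disjoint apart from `z`, through the region `Ω` to
different labels. -/
theorem exists_fan [Finite V] {L : Type*} [Finite L] (G : SimpleGraph V) (touch : V → L → Prop)
    (Ω : Set V) (z : V) (m : ℕ)
    (h : ∀ (X : Finset V) (Y : Finset L), z ∉ X → X.card + Y.card < m →
      ∃ v l, l ∉ Y ∧ (G.within (insert z Ω \ X)).Reachable z v ∧ touch v l) :
    ∃ (l : Fin m → L) (F : Fin m → Set V), Function.Injective l ∧
      (∀ i j, i ≠ j → Disjoint (F i) (F j)) ∧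
      ∀ i, F i ⊆ Ω ∧ z ∉ F i ∧ ∃ v, touch v (l i) ∧ v ∈ insert z (F i) ∧
        (G.within (insert z (F i))).Reachable z v := by
  obtain ⟨l, F, h1, h2, h3⟩ := Relation.exists_fan
    (fun u w => G.Adj u w ∧ u ∈ insert z Ω ∧ w ∈ insert z Ω) touch (insert z Ω)
    (fun _ _ h => h.2.2) z m (by
    intro X Y hz hXY
    obtain ⟨v, l, h1, h2, h3⟩ := h X Y hz hXY
    refine ⟨v, l, h1, ?_, h3⟩
    rw [← reachIn_iff_within] at h2
    exact h2.mono (fun u w hu hw h => ⟨h, hu.1, hw.1⟩) (fun w hw => hw.2))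
  refine ⟨l, F, h1, h2, fun i => ?_⟩
  obtain ⟨h4, h5, v, h6, h7, h8⟩ := h3 i
  refine ⟨fun w hw => ?_, h5, v, h6, h7, ?_⟩
  · rcases h4 hw with rfl | hh
    · exact absurd hw h5
    · exact hh
  · rw [← reachIn_iff_within]
    exact h8.mono (fun u w _ _ h => h.1) subset_rfl

/-! ### Connectors: disjoint connected subgraphs joining a set -/

/-- The edges of `G` inside `W ∪ S`, where an edge between two vertices of `S` is only allowed if
it belongs to `E`. -/
def through (G : SimpleGraph V) (S W : Set V) (E : Set (Sym2 V)) : SimpleGraph V where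
  Adj u v := G.Adj u v ∧ u ∈ W ∪ S ∧ v ∈ W ∪ S ∧ (u ∈ S → v ∈ S → s(u, v) ∈ E)
  symm := ⟨fun _ _ h => ⟨h.1.symm, h.2.2.1, h.2.1, fun h1 h2 => Sym2.eq_swap ▸ h.2.2.2 h2 h1⟩⟩
  loopless := ⟨fun _ h => G.loopless.irrefl _ h.1⟩

theorem through_mono {S W W' : Set V} {E E' : Set (Sym2 V)} (hW : W ⊆ W') (hE : E ⊆ E') :
    G.through S W E ≤ G.through S W' E' :=
  fun _ _ h => ⟨h.1, Set.union_subset_union_left S hW h.2.1,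
    Set.union_subset_union_left S hW h.2.2.1, fun h1 h2 => hE (h.2.2.2 h1 h2)⟩

/-- `W i`, `E i` describe connected subgraphs of `G` that contain `S` and are disjoint outside `S`:
the `i`-th one uses the vertices `S ∪ W i`, and of the edges inside `S` only those in `E i`. Unlike
trees, connectors may contain superfluous vertices and edges. -/
structure Connectors {ι : Type*} (G : SimpleGraph V) (S : Set V) (W : ι → Set V)
    (E : ι → Set (Sym2 V)) : Prop where
  disjoint_left : ∀ i, Disjoint (W i) S
  disjoint : ∀ i j, i ≠ j → Disjoint (W i) (W j)
  disjoint_edge : ∀ i j, i ≠ j → Disjoint (E i) (E j)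
  joined : ∀ i, ∀ u ∈ S, ∀ v ∈ S, (G.through S (W i) (E i)).Reachable u v

/-- There are `t` connectors of `S`. -/
def HasConnectors (G : SimpleGraph V) (S : Set V) (t : ℕ) : Prop :=
  ∃ (W : Fin t → Set V) (E : Fin t → Set (Sym2 V)), G.Connectors S W E

theorem Connectors.comp {ι κ : Type*} {S : Set V} {W : ι → Set V}
    {E : ι → Set (Sym2 V)} (h : G.Connectors S W E) (f : κ ↪ ι) :
    G.Connectors S (W ∘ f) (E ∘ f) :=
  ⟨fun _ => h.1 _, fun _ _ hij => h.2 _ _ (f.injective.ne hij),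
    fun _ _ hij => h.3 _ _ (f.injective.ne hij), fun _ => h.4 _⟩

theorem Connectors.hasConnectors {ι : Type*} [Fintype ι] {S : Set V} {W : ι → Set V}
    {E : ι → Set (Sym2 V)} (h : G.Connectors S W E) {t : ℕ} (ht : t ≤ Fintype.card ι) :
    G.HasConnectors S t := by
  have : Nonempty (Fin t ↪ ι) := Function.Embedding.nonempty_of_card_le (by simpa using ht)
  exact ⟨_, _, h.comp this.some⟩

theorem HasConnectors.mono {S : Set V} {s t : ℕ} (h : G.HasConnectors S t) (hst : s ≤ t) :
    G.HasConnectors S s := by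
  obtain ⟨W, E, hW⟩ := h
  exact hW.hasConnectors (by simpa using hst)

/-- A graph on a set `C` of vertices of `G`, all of whose edges are edges of `G`, as a subgraph. -/
def subgraphOf {C : Set V} (T : SimpleGraph C) (hT : ∀ u v : C, T.Adj u v → G.Adj u v) :
    G.Subgraph where
  verts := C
  Adj u v := ∃ (hu : u ∈ C) (hv : v ∈ C), T.Adj ⟨u, hu⟩ ⟨v, hv⟩
  adj_sub := by rintro u v ⟨hu, hv, huv⟩; exact hT _ _ huv
  edge_vert := by rintro u v ⟨hu, -, -⟩; exact hu
  symm := ⟨by rintro u v ⟨hu, hv, huv⟩; exact ⟨hv, hu, huv.symm⟩⟩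

theorem coe_subgraphOf {C : Set V} (T : SimpleGraph C) (hT : ∀ u v : C, T.Adj u v → G.Adj u v) :
    (subgraphOf T hT).coe = T := by
  refine SimpleGraph.ext (funext fun u => funext fun v => propext ⟨?_, ?_⟩)
  · rintro ⟨_, _, h⟩
    exact h
  · exact fun h => ⟨u.2, v.2, h⟩

/-- Spanning trees of the components of connectors are internally disjoint trees. -/
theorem HasConnectors.le_setConnectivity [Finite V] {S : Finset V} (hS : S.Nonempty) {t : ℕ}
    (h : G.HasConnectors (S : Set V) t) : (t : ℕ∞) ≤ G.setConnectivity S := by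
  obtain ⟨W, E, h⟩ := h
  obtain ⟨s, hs⟩ := hS
  let K : Fin t → SimpleGraph V := fun i => G.through S (W i) (E i)
  have hK : ∀ i v, (K i).Reachable s v → v ∉ S → v ∈ W i := by
    intro i v hv hvS
    have : v ∈ W i ∪ (S : Set V) :=
      hv.mem_of_closed (C := W i ∪ (S : Set V)) (Or.inr hs) (fun _ _ _ hab => hab.2.2.1)
    exact this.resolve_right hvS
  have htree : ∀ i, ∃ T : G.Subgraph, T.coe.IsTree ∧ T.verts = {v | (K i).Reachable s v} ∧
      ∀ u v, T.Adj u v → (K i).Adj u v := by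
    intro i
    let C : Set V := {v | (K i).Reachable s v}
    have hC : ((K i).induce C).Connected := by
      rw [connected_iff_exists_forall_reachable]
      refine ⟨⟨s, Reachable.refl _⟩, ?_⟩
      rintro ⟨v, hv⟩
      have hv' := hv
      change (K i).Reachable s v at hv'
      rw [reachable_iff_reflTransGen] at hv'
      induction hv' with
      | refl => rfl
      | @tail b c hb hbc ih =>
        have hb' : (K i).Reachable s b := (reachable_iff_reflTransGen _ _).2 hb
        exact (ih hb').trans (Adj.reachable (G := (K i).induce C) (u := ⟨b, hb'⟩)
          (v := ⟨c, hv⟩) hbc)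
    obtain ⟨T, hT, hTree⟩ := hC.exists_isTree_le
    have hTG : ∀ u v, T.Adj u v → G.Adj u v := fun u v huv => (hT huv).1
    refine ⟨subgraphOf T hTG, ?_, rfl, ?_⟩
    · rwa [coe_subgraphOf]
    · rintro u v ⟨hu, hv, huv⟩
      exact hT huv
  choose T hT hTv hTadj using htree
  have hinter : ∀ i j, i ≠ j → (T i).verts ∩ (T j).verts = (S : Set V) := by
    intro i j hij
    ext v
    rw [hTv, hTv]
    constructor
    · rintro ⟨h1, h2⟩
      by_contra hv
      exact Set.disjoint_left.1 (h.disjoint i j hij) (hK i v h1 hv) (hK j v h2 hv)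
    · intro hv
      exact ⟨h.joined i s hs v hv, h.joined j s hs v hv⟩
  unfold setConnectivity
  refine le_iSup₂_of_le t ⟨T, ⟨hT, ?_, ?_, hinter⟩⟩ le_rfl
  · intro i v hv
    rw [hTv]
    exact h.joined i s hs v hv
  · intro i j hij
    rw [Set.disjoint_left]
    refine Sym2.ind fun u v h1 h2 => ?_
    rw [Subgraph.mem_edgeSet] at h1 h2
    have hu : u ∈ (S : Set V) := by
      rw [← hinter i j hij]; exact ⟨(T i).edge_vert h1, (T j).edge_vert h2⟩
    have hv : v ∈ (S : Set V) := by
      rw [← hinter i j hij]; exact ⟨(T i).edge_vert h1.symm, (T j).edge_vert h2.symm⟩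
    exact Set.disjoint_left.1 (h.disjoint_edge i j hij)
      ((hTadj i _ _ h1).2.2.2 hu hv) ((hTadj j _ _ h2).2.2.2 hu hv)

theorem IsInternallyDisjointTrees.hasConnectors {S : Finset V} {t : ℕ} {T : Fin t → G.Subgraph}
    (h : G.IsInternallyDisjointTrees S T) : G.HasConnectors (S : Set V) t := by
  refine ⟨fun i => (T i).verts \ S, fun i => (T i).edgeSet, ⟨?_, ?_, h.edge_disjoint, ?_⟩⟩
  · exact fun i => Set.disjoint_sdiff_left
  · intro i j hij
    rw [Set.disjoint_left]
    rintro v ⟨h1, h2⟩ ⟨h3, _⟩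
    exact h2 (h.verts_inter i j hij ▸ ⟨h1, h3⟩)
  · intro i u hu v hv
    have := (h.isTree i).connected.preconnected ⟨u, h.subset_verts i hu⟩ ⟨v, h.subset_verts i hv⟩
    refine this.map (G' := G.through S ((T i).verts \ S) (T i).edgeSet) ⟨Subtype.val, ?_⟩
    rintro ⟨a, ha⟩ ⟨b, hb⟩ hab
    have hab' : (T i).Adj a b := hab
    refine ⟨hab'.adj_sub, ?_, ?_, fun _ _ => hab'⟩
    · by_cases hS : a ∈ (S : Set V)
      · exact Or.inr hS
      · exact Or.inl ⟨ha, hS⟩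
    · by_cases hS : b ∈ (S : Set V)
      · exact Or.inr hS
      · exact Or.inl ⟨hb, hS⟩

theorem hasConnectors_of_le {S : Finset V} {t : ℕ} (h : (t : ℕ∞) ≤ G.setConnectivity S) :
    G.HasConnectors (S : Set V) t := by
  by_contra hno
  cases t with
  | zero => exact hno ⟨Fin.elim0, Fin.elim0, ⟨fun i => i.elim0, fun i => i.elim0, fun i => i.elim0,
      fun i => i.elim0⟩⟩
  | succ t =>
    have : G.setConnectivity S ≤ (t : ℕ∞) := by
      refine iSup₂_le fun s hs => ?_
      obtain ⟨T, hT⟩ := hs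
      by_contra hlt
      have hlt' : t < s := by simpa using hlt
      exact hno (hT.hasConnectors.mono hlt')
    have h2 := h.trans this
    have : t + 1 ≤ t := by exact_mod_cast h2
    omega

/-! ### Connectivity of a set of vertices -/

/-- The subgraph of `G` induced by `M` is `h`-connected. -/
def KConn (G : SimpleGraph V) (M : Set V) (h : ℕ) : Prop :=
  h < M.ncard ∧ ∀ X : Finset V, X.card < h → ∀ u ∈ M \ X, ∀ v ∈ M \ X,
    (G.within (M \ X)).Reachable u v

theorem KConn.exists_notMem {M : Set V} {h : ℕ} (hM : G.KConn M h) {X : Finset V}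
    (hX : X.card ≤ h) : ∃ v ∈ M, v ∉ X := by
  by_contra hno
  push Not at hno
  have h1 : M.ncard ≤ (X : Set V).ncard := Set.ncard_le_ncard hno X.finite_toSet
  rw [Set.ncard_coe_finset] at h1
  have := hM.1
  omega

theorem KConn.exists_adj {M : Set V} {h : ℕ} (hM : G.KConn M h) {X : Finset V}
    (hX : X.card < h) {x : V} (hx : x ∈ M) (hxX : x ∉ X) :
    ∃ v ∈ M, v ∉ X ∧ v ≠ x ∧ G.Adj x v := by
  classical
  obtain ⟨u, hu, huX⟩ := hM.exists_notMem (X := insert x X)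
    (by have := Finset.card_insert_le x X; omega)
  simp only [Finset.mem_insert, not_or] at huX
  by_contra hno
  push Not at hno
  have := (hM.2 X hX x ⟨hx, hxX⟩ u ⟨hu, huX.2⟩).mem_of_closed (C := {x}) rfl (by
    rintro a b rfl hab
    by_contra hb
    exact hno b hab.2.2.1 hab.2.2.2 hb hab.1)
  exact huX.1 this

/-- Every vertex of `W` is joined to `x` inside `W ∪ {x}`. -/
def Hangs (G : SimpleGraph V) (x : V) (W : Set V) : Prop :=
  ∀ w ∈ W, (G.within (insert x W)).Reachable x w

theorem hangs_component (G : SimpleGraph V) (x : V) (F : Set V) :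
    G.Hangs x {w | w ∈ F ∧ (G.within (insert x F)).Reachable x w} := by
  set C := {w | w ∈ F ∧ (G.within (insert x F)).Reachable x w}
  rintro w ⟨-, hw⟩
  have := hw.mem_of_closed
    (C := {v | (G.within (insert x F)).Reachable x v ∧ (G.within (insert x C)).Reachable x v})
    ⟨.refl _, .refl _⟩ (by
      rintro a b ⟨h1, h2⟩ hab
      have h3 : (G.within (insert x F)).Reachable x b := h1.trans hab.reachable
      refine ⟨h3, h2.trans (hab.1.reachable_within ?_ ?_)⟩
      · rcases hab.2.1 with h | h
        · exact Or.inl h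
        · exact Or.inr ⟨h, h1⟩
      · rcases hab.2.2 with h | h
        · exact Or.inl h
        · exact Or.inr ⟨h, h3⟩)
  exact this.2

theorem Hangs.insert_of_adj {x : V} {W : Set V} (hW : G.Hangs x W) {u v : V} (hu : u ∈ W)
    (huv : G.Adj u v) : G.Hangs x (insert v W) := by
  have hsub : insert x W ⊆ insert x (insert v W) := Set.insert_subset_insert (Set.subset_insert _ _)
  have h1 := fun w hw => (hW w hw).mono (within_mono hsub)
  rintro w (rfl | hw)
  · exact (h1 u hu).trans (huv.reachable_within (hsub (Or.inr hu)) (Or.inr (Or.inl rfl)))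
  · exact h1 w hw

theorem within_insert_le_through {S W W' : Set V} {E : Set (Sym2 V)} {x : V} (hx : x ∈ S)
    (hW : Disjoint W S) (hWW : W ⊆ W') : G.within (insert x W) ≤ G.through S W' E := by
  intro u v huv
  have hmem : ∀ w ∈ insert x W, w ∈ W' ∪ S := by
    rintro w (rfl | hw)
    · exact Or.inr hx
    · exact Or.inl (hWW hw)
  refine ⟨huv.1, hmem u huv.2.1, hmem v huv.2.2, fun hu hv => ?_⟩
  have h1 : u = x := huv.2.1.resolve_right fun h => Set.disjoint_left.1 hW h hu
  have h2 : v = x := huv.2.2.resolve_right fun h => Set.disjoint_left.1 hW h hv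
  exact absurd (h1.trans h2.symm) huv.1.ne

/-- Disjoint sets inside a connected region `Z` can be enlarged, one neighbouring vertex at a time,
until they cover `Z`. -/
theorem exists_cover [Finite V] {ι : Type*} (Z : Set V) (P : ι → Set V)
    (hP : ∀ i j, i ≠ j → Disjoint (P i) (P j)) (hPZ : ∀ i, P i ⊆ Z) (hne : ∃ i, (P i).Nonempty)
    (hZ : ∀ u ∈ Z, ∀ v ∈ Z, (G.within Z).Reachable u v) (Q : ι → Set V → Prop)
    (hQ : ∀ i, Q i (P i))
    (hstep : ∀ i W u v, Q i W → W ⊆ Z → u ∈ W → v ∈ Z → G.Adj u v → Q i (insert v W)) :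
    ∃ P' : ι → Set V, (∀ i, P i ⊆ P' i) ∧ (∀ i j, i ≠ j → Disjoint (P' i) (P' j)) ∧
      (∀ i, P' i ⊆ Z) ∧ (∀ v ∈ Z, ∃ i, v ∈ P' i) ∧ ∀ i, Q i (P' i) := by
  classical
  induction hn : (Z \ ⋃ i, P i).ncard using Nat.strong_induction_on generalizing P with
  | _ n ih =>
  by_cases hcov : ∀ v ∈ Z, ∃ i, v ∈ P i
  · exact ⟨P, fun i => subset_rfl, hP, hPZ, hcov, hQ⟩
  push Not at hcov
  obtain ⟨v, hv, hvP⟩ := hcov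
  obtain ⟨i₀, u₀, hu₀⟩ := hne
  obtain ⟨i, u, w, hu, hw, hwP, huw⟩ : ∃ i u w, u ∈ P i ∧ w ∈ Z ∧ (∀ j, w ∉ P j) ∧ G.Adj u w := by
    by_contra hno
    push Not at hno
    have := (hZ u₀ (hPZ _ hu₀) v hv).mem_of_closed (C := {w | ∃ i, w ∈ P i}) ⟨i₀, hu₀⟩ (by
      rintro a b ⟨i, ha⟩ hab
      by_contra hb
      exact hno i a b ha hab.2.2 (fun j hj => hb ⟨j, hj⟩) hab.1)
    obtain ⟨j, hj⟩ := this
    exact hvP j hj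
  have hsub : ∀ j, P j ⊆ Function.update P i (insert w (P i)) j := by
    intro j
    by_cases hj : j = i
    · subst hj; simp
    · simp [hj]
  have hmem : ∀ j a, a ∈ Function.update P i (insert w (P i)) j → a ∈ P j ∨ (a = w ∧ j = i) := by
    intro j a ha
    by_cases hj : j = i
    · subst hj
      simp only [Function.update_self] at ha
      rcases ha with h | h
      · exact Or.inr ⟨h, rfl⟩
      · exact Or.inl h
    · simp only [ne_eq, hj, not_false_eq_true, Function.update_of_ne] at ha
      exact Or.inl ha
  obtain ⟨P', h1, h2⟩ := ih (Z \ ⋃ j, Function.update P i (insert w (P i)) j).ncard (by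
      rw [← hn]
      refine Set.ncard_lt_ncard ⟨?_, fun hh => ?_⟩ (Set.toFinite _)
      · exact Set.sdiff_subset_sdiff_right (Set.iUnion_mono hsub)
      · have : w ∈ Z \ ⋃ j, P j := ⟨hw, by simpa using hwP⟩
        exact (hh this).2 (Set.mem_iUnion.2 ⟨i, by simp⟩))
    (Function.update P i (insert w (P i)))
    (by
      intro j k hjk
      rw [Set.disjoint_left]
      intro a ha hb
      rcases hmem j a ha with h | ⟨rfl, rfl⟩ <;> rcases hmem k a hb with h' | ⟨h', rfl⟩
      · exact Set.disjoint_left.1 (hP j k hjk) h h'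
      · exact hwP j (h' ▸ h)
      · exact hwP k h'
      · exact hjk rfl)
    (by
      intro j a ha
      rcases hmem j a ha with h | ⟨rfl, rfl⟩
      · exact hPZ j h
      · exact hw)
    ⟨i₀, u₀, hsub _ hu₀⟩
    (by
      intro j
      by_cases hj : j = i
      · subst hj
        simpa using hstep j (P j) u w (hQ j) (hPZ j) hu hw huw
      · simpa [hj] using hQ j) rfl
  exact ⟨P', fun j => (hsub j).trans (h1 j), h2⟩

/-- In an `h`-connected set, given `x` and `h` other vertices, all vertices other than `x` can be
split into `h` parts, one for each of the given vertices, that hang on `x`. -/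
theorem KConn.exists_hanging_partition [Finite V] {M : Set V} {h : ℕ} (hM : G.KConn M h)
    (hh : 2 ≤ h) {x : V} (hx : x ∈ M) (a : Fin h → V) (ha : Function.Injective a)
    (haM : ∀ i, a i ∈ M) (hax : ∀ i, a i ≠ x) :
    ∃ C : Fin h → Set V, (∀ i j, i ≠ j → Disjoint (C i) (C j)) ∧ (∀ i, C i ⊆ M \ {x}) ∧
      (∀ v ∈ M \ {x}, ∃ i, v ∈ C i) ∧ (∀ i, a i ∈ C i) ∧ ∀ i, G.Hangs x (C i) := by
  classical
  obtain ⟨l, F, hl, hF, hF'⟩ := exists_fan G (fun v i => v = a i) M x h (by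
    intro X Y hxX hXY
    obtain ⟨i, hi⟩ : ∃ i, i ∉ Y ∧ a i ∉ X := by
      by_contra hno
      push Not at hno
      have h1 : (Finset.univ \ Y).card ≤ X.card :=
        Finset.card_le_card_of_injOn a (fun i hi => hno i (by simpa using hi)) ha.injOn
      have h2 := Finset.card_sdiff_add_card (Finset.univ : Finset (Fin h)) Y
      have h3 := Finset.card_le_card (Finset.subset_union_left (s₁ := Finset.univ) (s₂ := Y))
      have h4 : (Finset.univ : Finset (Fin h)).card = h := by simp
      omega
    refine ⟨a i, i, hi.1, ?_, rfl⟩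
    exact (hM.2 X (by omega) x ⟨hx, hxX⟩ (a i) ⟨haM i, hi.2⟩).mono
      (within_mono (Set.sdiff_subset_sdiff_left (Set.subset_insert _ _))))
  let e : Fin h ≃ Fin h := Equiv.ofBijective l (Finite.injective_iff_bijective.1 hl)
  have hle : ∀ i, l (e.symm i) = i := fun i => e.apply_symm_apply i
  obtain ⟨C, h1, h2, h3, h4, h5⟩ := exists_cover (G := G) (M \ {x})
    (fun i => {w | w ∈ F (e.symm i) ∧ (G.within (insert x (F (e.symm i)))).Reachable x w})
    (fun i j hij => (hF _ _ (e.symm.injective.ne hij)).mono (fun w hw => hw.1) (fun w hw => hw.1))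
    (fun i w hw => ⟨(hF' _).1 hw.1, fun hwx => (hF' _).2.1 (hwx ▸ hw.1)⟩)
    (by
      refine ⟨⟨0, by omega⟩, a ⟨0, by omega⟩, ?_⟩
      obtain ⟨-, -, v, rfl, h6, h7⟩ := hF' (e.symm ⟨0, by omega⟩)
      rw [hle] at h6 h7
      exact ⟨h6.resolve_left (hax _), h7⟩)
    (by
      intro u hu v hv
      have := hM.2 {x} (by simp; omega)
      simp only [Finset.coe_singleton] at this
      exact this u hu v hv)
    (fun _ W => G.Hangs x W) (fun i => hangs_component G x _)
    (fun i W u v hW _ hu _ huv => hW.insert_of_adj hu huv)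
  refine ⟨C, h2, h3, h4, fun i => h1 i ?_, h5⟩
  obtain ⟨-, -, v, rfl, h6, h7⟩ := hF' (e.symm i)
  rw [hle] at h6 h7
  exact ⟨h6.resolve_left (hax _), h7⟩

/-- In an `h`-connected set there are `h` internally disjoint connections between two vertices
`x` and `y`; if they are adjacent, the edge `xy` is the connection with index `0`. -/
theorem KConn.exists_links [Finite V] {M : Set V} {t : ℕ} (hM : G.KConn M (t + 1)) {x y : V}
    (hx : x ∈ M) (hy : y ∈ M) (hxy : x ≠ y) :
    ∃ P : Fin (t + 1) → Set V, (∀ i j, i ≠ j → Disjoint (P i) (P j)) ∧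
      (∀ i, P i ⊆ M \ {x, y}) ∧ (∀ i, G.Hangs x (P i)) ∧
      ∀ i, (∃ w ∈ P i, G.Adj w y) ∨ (P i = ∅ ∧ G.Adj x y ∧ i = 0) := by
  classical
  have main : ∀ s : ℕ, (∀ X : Finset V, X.card < s → x ∉ X → ∃ v, v ≠ x ∧ G.Adj v y ∧
      (G.within (insert x (M \ {y}) \ X)).Reachable x v) →
      ∃ P : Fin s → Set V, (∀ i j, i ≠ j → Disjoint (P i) (P j)) ∧
      (∀ i, P i ⊆ M \ {x, y}) ∧ (∀ i, G.Hangs x (P i)) ∧ ∀ i, ∃ w ∈ P i, G.Adj w y := by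
    intro s hs
    obtain ⟨-, F, -, hF, hF'⟩ := exists_fan (L := Fin s) G (fun v _ => v ≠ x ∧ G.Adj v y)
      (M \ {y}) x s (by
      intro X Y hxX hXY
      obtain ⟨i, hi⟩ : ∃ i, i ∉ Y := by
        by_contra hno
        push Not at hno
        have : Y = Finset.univ := Finset.eq_univ_of_forall hno
        simp [this] at hXY
      obtain ⟨v, h1, h2, h3⟩ := hs X (by omega) hxX
      exact ⟨v, i, hi, h3, h1, h2⟩)
    refine ⟨fun i => {w | w ∈ F i ∧ (G.within (insert x (F i))).Reachable x w}, ?_, ?_, ?_, ?_⟩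
    · exact fun i j hij => (hF i j hij).mono (fun w hw => hw.1) (fun w hw => hw.1)
    · rintro i w ⟨hw, -⟩
      refine ⟨((hF' i).1 hw).1, ?_⟩
      rintro (rfl | rfl)
      · exact (hF' i).2.1 hw
      · exact ((hF' i).1 hw).2 rfl
    · exact fun i => hangs_component G x _
    · intro i
      obtain ⟨-, -, v, h1, h2, h3⟩ := hF' i
      exact ⟨v, ⟨h2.resolve_left h1.1, h3⟩, h1.2⟩
  by_cases hadj : G.Adj x y
  · obtain ⟨P, h1, h2, h3, h4⟩ := main t (by
      intro X hX hxX
      have hc := Finset.card_erase_le (s := X) (a := y)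
      obtain ⟨v, hv1, hv2, hv3, hv4⟩ := hM.exists_adj (X := insert x (X.erase y))
        (by have := Finset.card_insert_le x (X.erase y); omega) hy (by simp [hxy.symm])
      simp only [Finset.mem_insert, Finset.mem_erase, not_or, not_and] at hv2
      refine ⟨v, hv2.1, hv4.symm, ?_⟩
      refine (hM.2 (insert y X) (by have := Finset.card_insert_le y X; omega) x
        ⟨hx, by simp [hxy, hxX]⟩ v ⟨hv1, by simp [hv3, hv2.2 hv3]⟩).mono (within_mono ?_)
      rintro w ⟨hw, hw'⟩
      simp only [Finset.coe_insert, Set.mem_insert_iff, Finset.mem_coe, not_or] at hw'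
      exact ⟨Or.inr ⟨hw, hw'.1⟩, hw'.2⟩)
    refine ⟨Fin.cons ∅ P, ?_, ?_, ?_, ?_⟩
    · intro i j hij
      cases i using Fin.cases <;> cases j using Fin.cases <;> simp_all
    · intro i
      cases i using Fin.cases <;> simp_all
    · intro i
      cases i using Fin.cases
      · intro w hw; exact hw.elim
      · simp_all
    · intro i
      cases i using Fin.cases <;> simp_all
  · obtain ⟨P, h1, h2, h3, h4⟩ := main (t + 1) (by
      intro X hX hxX
      by_contra hno
      push Not at hno
      have hc := Finset.card_erase_le (s := X) (a := y)
      have := (hM.2 (X.erase y) (by omega) x ⟨hx, by simp [hxX]⟩ y ⟨hy, by simp⟩).mem_of_closed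
        (C := {w | w ≠ y ∧ (G.within (insert x (M \ {y}) \ X)).Reachable x w})
        ⟨hxy, .refl _⟩ (by
          rintro a b ⟨h1, h2⟩ ⟨h3, h4, h5⟩
          have hby : b ≠ y := by
            rintro rfl
            by_cases hax : a = x
            · exact hadj (hax ▸ h3)
            · exact hno a hax h3 h2
          refine ⟨hby, h2.trans (h3.reachable_within ?_ ?_)⟩
          · exact ⟨Or.inr ⟨h4.1, h1⟩, fun hh => h4.2 (by simpa [h1] using hh)⟩
          · exact ⟨Or.inr ⟨h5.1, hby⟩, fun hh => h5.2 (by simpa [hby] using hh)⟩)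
      exact this.1 rfl)
    exact ⟨P, h1, h2, h3, fun i => Or.inl (h4 i)⟩

/-- The connections between `x` and `y` can be chosen to cover all other vertices. -/
theorem KConn.exists_link_partition [Finite V] {M : Set V} {t : ℕ} (hM : G.KConn M (t + 1))
    (ht : 2 ≤ t) {x y : V} (hx : x ∈ M) (hy : y ∈ M) (hxy : x ≠ y) :
    ∃ P : Fin (t + 1) → Set V, (∀ i j, i ≠ j → Disjoint (P i) (P j)) ∧
      (∀ i, P i ⊆ M \ {x, y}) ∧ (∀ v ∈ M \ {x, y}, ∃ i, v ∈ P i) ∧ (∀ i, G.Hangs x (P i)) ∧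
      ∀ i, (∃ w ∈ P i, G.Adj w y) ∨ (P i = ∅ ∧ G.Adj x y ∧ i = 0) := by
  classical
  obtain ⟨P, h1, h2, h3, h4⟩ := hM.exists_links hx hy hxy
  obtain ⟨P', h5, h6, h7, h8, h9⟩ := exists_cover (G := G) (M \ {x, y}) P h1 h2
    (by
      refine ⟨⟨1, by omega⟩, ?_⟩
      rcases h4 ⟨1, by omega⟩ with ⟨w, hw, -⟩ | h
      · exact ⟨w, hw⟩
      · exact absurd h.2.2 (by simp [Fin.ext_iff]))
    (by
      intro u hu v hv
      have := hM.2 {x, y} (by have := Finset.card_le_two (a := x) (b := y); omega)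
      simp only [Finset.coe_insert, Finset.coe_singleton] at this
      exact this u hu v hv)
    (fun i W => G.Hangs x W ∧ P i ⊆ W ∧ (P i = ∅ → W = ∅))
    (fun i => ⟨h3 i, subset_rfl, id⟩)
    (by
      rintro i W u v ⟨hW, hPW, hW'⟩ - hu - huv
      refine ⟨hW.insert_of_adj hu huv, hPW.trans (Set.subset_insert _ _), fun hP => ?_⟩
      rw [hW' hP] at hu
      exact hu.elim)
  refine ⟨P', h6, h7, h8, fun i => (h9 i).1, fun i => ?_⟩
  rcases h4 i with ⟨w, hw, hwy⟩ | ⟨h, h'⟩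
  · exact Or.inl ⟨w, h5 i hw, hwy⟩
  · exact Or.inr ⟨(h9 i).2.2 h, h'⟩

/-! ### Assembling connectors of three vertices -/

/-- If labels in `ι ⊕ Bool` are used at most once, and as many as `ι` has elements are used, then
those in the right summand can serve the unused elements of `ι`. -/
theorem exists_wild_assignment {ι κ : Type*} [Fintype ι] [Fintype κ]
    (hcard : Fintype.card ι = Fintype.card κ) (l : κ → ι ⊕ Bool) (hl : Function.Injective l) :
    ∃ σ : ι ≃ κ, ∀ i, l (σ i) = .inl i ∨ ∃ b, l (σ i) = .inr b := by
  classical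
  let s : Finset ι := Finset.univ.filter fun i => ∃ k, l k = .inl i
  have hs : ∀ i, i ∈ s ↔ ∃ k, l k = .inl i := by simp [s]
  let f : ι → κ := fun i => if h : ∃ k, l k = .inl i then h.choose else
    (Fintype.equivOfCardEq hcard) i
  have hf : ∀ i ∈ s, l (f i) = .inl i := by
    intro i hi
    have h := (hs i).1 hi
    simp only [f, dif_pos h]
    exact h.choose_spec
  obtain ⟨σ, hσ⟩ := Finset.exists_equiv_extend_of_card_eq (t := Finset.univ) (s := s) (f := f)
    (by simpa using hcard) (Finset.subset_univ _) (by
      intro i hi j hj hij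
      have h1 := hf i hi
      rw [hij, hf j hj] at h1
      simpa using h1.symm)
  let σ' : ι ≃ κ := σ.trans (Equiv.subtypeUnivEquiv (by simp))
  have hσ' : ∀ i ∈ s, σ' i = f i := fun i hi => hσ i hi
  refine ⟨σ', fun i => ?_⟩
  by_cases hi : i ∈ s
  · left
    rw [hσ' i hi, hf i hi]
  · right
    cases hj : l (σ' i) with
    | inr b => exact ⟨b, rfl⟩
    | inl j =>
      exfalso
      have hjs : j ∈ s := (hs j).2 ⟨_, hj⟩
      have h1 : σ' i = σ' j := by
        rw [hσ' j hjs]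
        apply hl
        rw [hf j hjs, hj]
      exact hi (σ'.injective h1 ▸ hjs)

theorem joined_of_reachable {x y z : V} {K : SimpleGraph V} (h1 : K.Reachable x y)
    (h2 : K.Reachable x z) : ∀ u ∈ ({x, y, z} : Set V), ∀ v ∈ ({x, y, z} : Set V),
      K.Reachable u v := by
  have key : ∀ u ∈ ({x, y, z} : Set V), K.Reachable x u := by
    rintro u (rfl | rfl | rfl)
    · exact .refl _
    · exact h1
    · exact h2
  exact fun u hu v hv => (key u hu).symm.trans (key v hv)

theorem Connectors.option {ι : Type*} {S : Set V} {W : ι → Set V} {E : ι → Set (Sym2 V)}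
    (h : G.Connectors S W E) {W₀ : Set V} {E₀ : Set (Sym2 V)} (h1 : Disjoint W₀ S)
    (h2 : ∀ i, Disjoint W₀ (W i)) (h3 : ∀ i, Disjoint E₀ (E i))
    (h4 : ∀ u ∈ S, ∀ v ∈ S, (G.through S W₀ E₀).Reachable u v) :
    G.Connectors (ι := Option ι) S (fun o => o.elim W₀ W) (fun o => o.elim E₀ E) := by
  refine ⟨?_, ?_, ?_, ?_⟩
  · rintro (_ | i)
    · exact h1
    · exact h.1 i
  · rintro (_ | i) (_ | j) hij
    · exact absurd rfl hij
    · exact h2 j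
    · exact (h2 i).symm
    · exact h.2 i j (fun e => hij (e ▸ rfl))
  · rintro (_ | i) (_ | j) hij
    · exact absurd rfl hij
    · exact h3 j
    · exact (h3 i).symm
    · exact h.3 i j (fun e => hij (e ▸ rfl))
  · rintro (_ | i)
    · exact h4
    · exact h.4 i

/-- The edge inside `{x, y, z}` which a walk of `z` that ends in a label may use: the label `true`
stands for `x`, the label `false` for `y`. -/
def wildEdge {ι : Type*} (x y z : V) : ι ⊕ Bool → Set (Sym2 V)
  | .inl _ => ∅
  | .inr true => {s(x, z)}
  | .inr false => {s(y, z)}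

/-- Given as many links between `x` and `y` as walks from `z`, each walk ending at its own link, or
in `x`, or in `y`, there are as many connectors. -/
theorem exists_wild_connectors {ι κ : Type*} [Fintype ι] [Fintype κ]
    (hcard : Fintype.card ι = Fintype.card κ) {x y z : V} (hxy : x ≠ y) (hxz : x ≠ z)
    (hyz : y ≠ z) {P : ι → Set V} {E : ι → Set (Sym2 V)} {F : κ → Set V} {l : κ → ι ⊕ Bool}
    (hl : Function.Injective l)
    (hPS : ∀ i, Disjoint (P i) {x, y, z}) (hFS : ∀ i, Disjoint (F i) {x, y, z})
    (hP : ∀ i j, i ≠ j → Disjoint (P i) (P j)) (hF : ∀ i j, i ≠ j → Disjoint (F i) (F j))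
    (hPF : ∀ i k, Disjoint (P i) (F k)) (hE : ∀ i j, i ≠ j → Disjoint (E i) (E j))
    (hE' : ∀ i, E i ⊆ {s(x, y)})
    (hlink : ∀ i, (G.through {x, y, z} (P i) (E i)).Reachable x y)
    (hland : ∀ k i, l k = .inl i → (G.through {x, y, z} (P i ∪ F k) (E i)).Reachable x z)
    (hx : ∀ k, l k = .inr true → (G.through {x, y, z} (F k) {s(x, z)}).Reachable x z)
    (hy : ∀ k, l k = .inr false → (G.through {x, y, z} (F k) {s(y, z)}).Reachable y z) :
    ∃ σ : ι ≃ κ, G.Connectors {x, y, z} (fun i => P i ∪ F (σ i))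
      (fun i => E i ∪ wildEdge x y z (l (σ i))) := by
  obtain ⟨σ, hσ⟩ := exists_wild_assignment hcard l hl
  have e1 : s(x, y) ≠ s(x, z) := by
    intro h; rw [Sym2.eq_iff] at h; rcases h with h | h
    · exact hyz h.2
    · exact hxz h.1
  have e2 : s(x, y) ≠ s(y, z) := by
    intro h; rw [Sym2.eq_iff] at h; rcases h with h | h
    · exact hxy h.1
    · exact hxz h.1
  have e3 : s(x, z) ≠ s(y, z) := by
    intro h; rw [Sym2.eq_iff] at h; rcases h with h | h
    · exact hxy h.1
    · exact hxz h.1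
  have hEW : ∀ i k, Disjoint (E i) (wildEdge x y z (l k)) := by
    intro i k
    refine Disjoint.mono_left (hE' i) ?_
    rcases l k with j | b | b <;> simp [wildEdge, e1, e2]
  have hWW : ∀ k k', k ≠ k' → Disjoint (wildEdge x y z (l k)) (wildEdge x y z (l k')) := by
    intro k k' hk
    have := hl.ne hk
    rcases h1 : l k with j | b | b <;> rcases h2 : l k' with j' | b' | b' <;>
      simp_all [wildEdge, e3.symm]
  refine ⟨σ, ⟨?_, ?_, ?_, ?_⟩⟩
  · intro i
    rw [Set.disjoint_union_left]
    exact ⟨hPS i, hFS _⟩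
  · intro i j hij
    rw [Set.disjoint_union_left, Set.disjoint_union_right, Set.disjoint_union_right]
    exact ⟨⟨hP i j hij, hPF _ _⟩, (hPF _ _).symm, hF _ _ (σ.injective.ne hij)⟩
  · intro i j hij
    rw [Set.disjoint_union_left, Set.disjoint_union_right, Set.disjoint_union_right]
    exact ⟨⟨hE i j hij, hEW _ _⟩, (hEW _ _).symm, hWW _ _ (σ.injective.ne hij)⟩
  · intro i
    have hxy' := (hlink i).mono (through_mono (G := G) (S := {x, y, z})
      (Set.subset_union_left (t := F (σ i)))
      (Set.subset_union_left (t := wildEdge x y z (l (σ i)))))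
    refine joined_of_reachable hxy' ?_
    rcases hσ i with h | ⟨b, h⟩
    · exact (hland _ i h).mono (through_mono subset_rfl Set.subset_union_left)
    · cases b
      · refine hxy'.trans ((hy _ h).mono (through_mono Set.subset_union_right ?_))
        rw [h]; exact Set.subset_union_right
      · refine (hx _ h).mono (through_mono Set.subset_union_right ?_)
        rw [h]; exact Set.subset_union_right

/-! ### Graphs of connectivity four and five -/

/-- `x` and `y` are joined by a walk through `P` that does not use the edge `xy`. -/
def LinkSet (G : SimpleGraph V) (x y : V) (P : Set V) : Prop :=
  ((G.deleteEdges {s(x, y)}).within (insert x (insert y P))).Reachable x y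

/-- An inclusion-minimal set that links `x` and `y`; its elements are the inner vertices of an
induced path. -/
def ThinLink (G : SimpleGraph V) (x y : V) (P : Set V) : Prop :=
  G.LinkSet x y P ∧ ∀ Q ⊂ P, ¬ G.LinkSet x y Q

theorem exists_thinLink [Finite V] {x y : V} {P : Set V} (h : G.LinkSet x y P) :
    ∃ Q ⊆ P, G.ThinLink x y Q := by
  induction hn : P.ncard using Nat.strong_induction_on generalizing P with
  | _ n ih =>
  by_cases hmin : ∀ Q ⊂ P, ¬ G.LinkSet x y Q
  · exact ⟨P, subset_rfl, h, hmin⟩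
  · push Not at hmin
    obtain ⟨Q, hQ, hQ'⟩ := hmin
    obtain ⟨Q', h1, h2⟩ := ih Q.ncard (hn ▸ Set.ncard_lt_ncard hQ (Set.toFinite _)) hQ' rfl
    exact ⟨Q', h1.trans hQ.1, h2⟩

theorem LinkSet.nonempty {x y : V} {P : Set V} (h : G.LinkSet x y P) (hxy : x ≠ y) :
    P.Nonempty := by
  by_contra hP
  rw [Set.not_nonempty_iff_eq_empty] at hP
  subst hP
  have := Reachable.mem_of_closed h (C := {x}) rfl (by
    rintro a b rfl ⟨h1, -, h3⟩
    rw [deleteEdges_adj] at h1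
    rcases h3 with rfl | rfl | h3
    · rfl
    · exact absurd rfl h1.2
    · exact h3.elim)
  exact hxy this.symm

/-- A vertex `u` of a thin link divides it into a part that hangs on `x` and a part that hangs
on `y`. -/
theorem ThinLink.split {x y : V} {P : Set V} (h : G.ThinLink x y P) (hxy : x ≠ y) (hx : x ∉ P)
    (hy : y ∉ P) {u : V} (hu : u ∈ P) :
    ∃ A B : Set V, A ⊆ P \ {u} ∧ B ⊆ P \ {u} ∧ Disjoint A B ∧ P \ {u} ⊆ A ∪ B ∧ G.Hangs x A ∧
      G.Hangs y B ∧ (G.within (insert x (insert u A))).Reachable x u ∧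
      (G.within (insert y (insert u B))).Reachable y u := by
  set H := G.deleteEdges {s(x, y)} with hH
  have hHG : H ≤ G := deleteEdges_le _
  have hmonoG : ∀ F : Set V, H.within F ≤ G.within F := fun F a b hab => ⟨hHG hab.1, hab.2⟩
  set A : Set V := {w | w ∈ P \ {u} ∧ (H.within (insert x (P \ {u}))).Reachable x w} with hA
  set B : Set V := {w | w ∈ P \ {u} ∧ (H.within (insert y (P \ {u}))).Reachable y w} with hB
  have hmin := h.2 (P \ {u}) ⟨Set.sdiff_subset, fun hh => (hh hu).2 rfl⟩
  have hAB : Disjoint A B := by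
    rw [Set.disjoint_left]
    rintro w ⟨-, hw⟩ ⟨-, hw'⟩
    apply hmin
    refine (hw.mono (within_mono ?_)).trans (hw'.mono (within_mono ?_)).symm
    · exact Set.insert_subset_insert (Set.subset_insert _ _)
    · exact Set.subset_insert _ _
  have hAx := hangs_component H x (P \ {u})
  have hBy := hangs_component H y (P \ {u})
  -- the first half of the link from `x` stays in `A` until it reaches `u`
  have half : ∀ x' y' : V, s(x', y') = s(x, y) → x' ≠ y' → x' ∉ P → y' ∉ P →
      (H.within (insert x' (insert y' P))).Reachable x' y' →
      ∀ A' B' : Set V, A' = {w | w ∈ P \ {u} ∧ (H.within (insert x' (P \ {u}))).Reachable x' w} →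
        B' = {w | w ∈ P \ {u} ∧ (H.within (insert y' (P \ {u}))).Reachable y' w} →
        Disjoint A' B' → (H.within (insert x' (insert u A'))).Reachable x' u := by
    intro x' y' he hne hx' hy' hreach A' B' hA' hB' hdis
    have hhang := hangs_component H x' (P \ {u})
    rw [← hA'] at hhang
    by_contra hno
    have hsub : insert x' A' ⊆ insert x' (insert u A') :=
      Set.insert_subset_insert (Set.subset_insert _ _)
    have := hreach.mem_of_closed (C := insert x' A') (Or.inl rfl) (by
      intro a b ha hab
      have hxa : (H.within (insert x' A')).Reachable x' a := by
        rcases ha with rfl | ha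
        · exact .refl _
        · exact hhang a ha
      have haP : a ∈ insert x' (P \ {u}) := by
        rcases ha with rfl | ha
        · exact Or.inl rfl
        · rw [hA'] at ha; exact Or.inr ha.1
      have hsub' : insert x' A' ⊆ insert x' (P \ {u}) := by
        rw [hA']
        exact Set.insert_subset_insert fun w hw => hw.1
      rcases hab.2.2 with rfl | rfl | hb
      · exact Or.inl rfl
      · exfalso
        rcases ha with rfl | ha
        · have := hab.1
          rw [hH, deleteEdges_adj] at this
          exact this.2 he
        · refine Set.disjoint_left.1 hdis ha ?_
          rw [hA'] at ha
          rw [hB']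
          exact ⟨ha.1, hab.1.symm.reachable_within (Or.inl rfl) (Or.inr ha.1)⟩
      · by_cases hbu : b = u
        · subst hbu
          exact absurd ((hxa.mono (within_mono hsub)).trans
            (hab.1.reachable_within (hsub ha) (Or.inr (Or.inl rfl)))) hno
        · right
          rw [hA']
          exact ⟨⟨hb, hbu⟩, (hxa.mono (within_mono hsub')).trans
            (hab.1.reachable_within haP (Or.inr ⟨hb, hbu⟩))⟩)
    rcases this with h1 | h1
    · exact hne h1.symm
    · rw [hA'] at h1
      exact hy' h1.1.1
  have hxu := half x y rfl hxy hx hy h.1 A B hA hB hAB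
  have hyu := half y x Sym2.eq_swap hxy.symm hy hx
    (by have := Reachable.symm h.1; rwa [Set.insert_comm] at this) B A hB hA hAB.symm
  refine ⟨A, B, fun w hw => hw.1, fun w hw => hw.1, hAB, ?_, ?_, ?_, hxu.mono (hmonoG _),
    hyu.mono (hmonoG _)⟩
  · by_contra hno
    refine h.2 (insert u (A ∪ B)) ⟨?_, fun hh => ?_⟩ ?_
    · rintro w (rfl | hw | hw)
      · exact hu
      · exact hw.1.1
      · exact hw.1.1
    · refine hno fun w hw => (hh hw.1).resolve_left hw.2
    · refine (hxu.mono (within_mono ?_)).trans (hyu.mono (within_mono ?_)).symm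
      · refine Set.insert_subset_insert ((Set.insert_subset_insert Set.subset_union_left).trans
          (Set.subset_insert _ _))
      · exact (Set.insert_subset_insert (Set.insert_subset_insert Set.subset_union_right)).trans
          (Set.subset_insert _ _)
  · exact fun w hw => (hAx w hw).mono (hmonoG _)
  · exact fun w hw => (hBy w hw).mono (hmonoG _)

/-- A walk from `z` through `F` to a neighbour of `x`. -/
def Half (G : SimpleGraph V) (z : V) (F : Set V) (x : V) : Prop :=
  ∃ w ∈ F, G.Adj w x ∧ (G.within (insert z F)).Reachable z w

/-- A walk from `z` through `F` to the vertex `u`, or the edge `zu`. -/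
def Land (G : SimpleGraph V) (z : V) (F : Set V) (u : V) : Prop :=
  ∃ w ∈ insert z F, G.Adj w u ∧ (G.within (insert z F)).Reachable z w

theorem Half.land {z : V} {F : Set V} {x : V} (h : G.Half z F x) : G.Land z F x := by
  obtain ⟨w, h1, h2⟩ := h
  exact ⟨w, Or.inr h1, h2⟩

theorem land_of_reachable {z x : V} {A : Set V} (hxz : x ≠ z) (hxA : x ∉ A)
    (h : (G.within (insert x (insert z A))).Reachable x z) : G.Land z A x := by
  by_contra hno
  have := h.symm.mem_of_closed
    (C := {v | v ∈ insert z A ∧ (G.within (insert z A)).Reachable z v}) ⟨Or.inl rfl, .refl _⟩ (by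
      rintro a b ⟨h1, h2⟩ hab
      rcases hab.2.2 with rfl | hb
      · exact absurd ⟨a, h1, hab.1, h2⟩ hno
      · exact ⟨hb, h2.trans (hab.1.reachable_within h1 hb)⟩)
  rcases this.1 with h | h
  · exact hxz h
  · exact hxA h

theorem Land.half_or_adj {z x : V} {F : Set V} (h : G.Land z F x) : G.Half z F x ∨ G.Adj z x := by
  obtain ⟨w, h1 | h1, h2, h3⟩ := h
  · exact Or.inr (h1 ▸ h2)
  · exact Or.inl ⟨w, h1, h2, h3⟩

/-- Prolonging a walk from `z` that lands in `u` by a walk from `u` to `x` through `A`. -/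
theorem Land.half {z x u : V} {F A : Set V} (h : G.Land z F u) (hu : u ∈ A) (hx : x ∉ A)
    (hux : (G.within (insert x A)).Reachable x u) : G.Half z (F ∪ A) x := by
  obtain ⟨w, h1, h2, h3⟩ := h
  have hsub : insert z F ⊆ insert z (F ∪ A) := Set.insert_subset_insert Set.subset_union_left
  have hzu : (G.within (insert z (F ∪ A))).Reachable z u :=
    (h3.mono (within_mono hsub)).trans (h2.reachable_within (hsub h1) (Or.inr (Or.inr hu)))
  by_contra hno
  have := hux.symm.mem_of_closed
    (C := {v | v ∈ A ∧ (G.within (insert z (F ∪ A))).Reachable z v}) ⟨hu, hzu⟩ (by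
      rintro a b ⟨h1, h2⟩ hab
      rcases hab.2.2 with rfl | hb
      · exact absurd ⟨a, Or.inr h1, hab.1, h2⟩ hno
      · exact ⟨hb, h2.trans (hab.1.reachable_within (Or.inr (Or.inr h1)) (Or.inr (Or.inr hb)))⟩)
  exact hx this.1

/-- A walk from `z` to `x`, seen inside a connector. -/
theorem Land.through {x z : V} {S F W : Set V} {E : Set (Sym2 V)} (hx : x ∈ S) (hz : z ∈ S)
    (hF : Disjoint F S) (hFW : F ⊆ W) (h : G.Land z F x) (hE : G.Adj z x → s(x, z) ∈ E) :
    (G.through S W E).Reachable x z := by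
  obtain ⟨w, h1, h2, h3⟩ := h
  refine Reachable.symm ((h3.mono (within_insert_le_through hz hF hFW)).trans
    (Adj.reachable (G := G.through S W E) ⟨h2, ?_, Or.inr hx, ?_⟩))
  · rcases h1 with rfl | h1
    · exact Or.inr hz
    · exact Or.inl (hFW h1)
  · intro hw _
    rcases h1 with rfl | h1
    · rw [Sym2.eq_swap]; exact hE h2
    · exact absurd hw (Set.disjoint_left.1 hF h1)

theorem Half.through {x z : V} {S F W : Set V} {E : Set (Sym2 V)} (hx : x ∈ S) (hz : z ∈ S)
    (hF : Disjoint F S) (hFW : F ⊆ W) (h : G.Half z F x) :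
    (G.through S W E).Reachable x z := by
  obtain ⟨w, h1, h2, h3⟩ := h
  exact Reachable.symm ((h3.mono (within_insert_le_through hz hF hFW)).trans
    (Adj.reachable (G := G.through S W E) ⟨h2, Or.inl (hFW h1), Or.inr hx,
      fun hw _ => absurd hw (Set.disjoint_left.1 hF h1)⟩))

/-- The vertex `x` for `true`, and `y` for `false`. -/
def side (x y : V) (b : Bool) : V := if b then x else y

/-- Disjoint links `P i` between `x` and `y` that avoid `z` (one of them may be the edge `xy`,
with `P i = ∅`), together with `j` walks from `z` to `x` and `j` walks from `z` to `y` through the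
sets `H (a, true)` and `H (a, false)`; only the walks with index `a = 0` may be single edges. -/
structure Config (G : SimpleGraph V) (x y z : V) {ι : Type*} (P : ι → Set V) {j : ℕ}
    (H : Fin j × Bool → Set V) : Prop where
  P_avoid : ∀ i, Disjoint (P i) {x, y, z}
  P_disj : ∀ i i', i ≠ i' → Disjoint (P i) (P i')
  link : ∀ i, G.ThinLink x y (P i) ∨ (P i = ∅ ∧ G.Adj x y)
  one_edge : ∀ i i', P i = ∅ → P i' = ∅ → i = i'
  H_avoid : ∀ k, Disjoint (H k) {x, y, z}
  H_disj : ∀ k k', k ≠ k' → Disjoint (H k) (H k')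
  P_H : ∀ i k, Disjoint (P i) (H k)
  half : ∀ a b, G.Half z (H (a, b)) (side x y b) ∨ (a.val = 0 ∧ G.Adj z (side x y b))

section Config

variable {x y z : V} {ι : Type*} {P : ι → Set V} {j : ℕ} {H : Fin j × Bool → Set V}

theorem Config.x_notMem (hc : G.Config x y z P H) (i : ι) : x ∉ P i :=
  fun h => Set.disjoint_left.1 (hc.P_avoid i) h (by simp)

theorem Config.y_notMem (hc : G.Config x y z P H) (i : ι) : y ∉ P i :=
  fun h => Set.disjoint_left.1 (hc.P_avoid i) h (by simp)

theorem Config.z_notMem (hc : G.Config x y z P H) (i : ι) : z ∉ P i :=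
  fun h => Set.disjoint_left.1 (hc.P_avoid i) h (by simp)

theorem Config.thin (hc : G.Config x y z P H) {i : ι} {u : V} (hu : u ∈ P i) :
    G.ThinLink x y (P i) := by
  rcases hc.link i with h | h
  · exact h
  · rw [h.1] at hu; exact hu.elim

theorem Config.card_le_of_subset [Fintype ι] (hc : G.Config x y z P H) {X : Finset V}
    (hX : ∀ i, ∀ q ∈ P i, q ∈ X) : Fintype.card ι ≤ X.card + 1 := by
  classical
  have h1 : (Finset.univ.filter fun i => (P i).Nonempty).card ≤ X.card := by
    have hch : ∀ i, ∃ q, (P i).Nonempty → q ∈ P i := fun i => by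
      by_cases h : (P i).Nonempty
      · exact ⟨h.some, fun _ => h.some_mem⟩
      · exact ⟨x, fun h' => absurd h' h⟩
    choose f hf using hch
    refine Finset.card_le_card_of_injOn f ?_ ?_
    · intro i hi
      exact hX _ _ (hf i (by simpa using hi))
    · intro i hi i' hi' hii
      by_contra hne
      refine Set.disjoint_left.1 (hc.P_disj i i' hne) (hf i (by simpa using hi)) ?_
      rw [hii]
      exact hf i' (by simpa using hi')
  have h2 : (Finset.univ.filter fun i => ¬ (P i).Nonempty).card ≤ 1 := by
    rw [Finset.card_le_one]
    intro i hi i' hi'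
    simp only [Finset.mem_filter, Finset.mem_univ, true_and, Set.not_nonempty_iff_eq_empty]
      at hi hi'
    exact hc.one_edge i i' hi hi'
  have h3 := Finset.card_filter_add_card_filter_not (s := (Finset.univ : Finset ι))
    (fun i => (P i).Nonempty)
  rw [Finset.card_univ] at h3
  omega

/-- Two walks from `z` that land in the same link break it into a walk from `z` to `x` and a walk
from `z` to `y`. -/
theorem Config.break (hc : G.Config x y z P H) (hxy : x ≠ y) {i₀ : ι} {u u' : V}
    (hu : u ∈ P i₀) (hu' : u' ∈ P i₀) (huu : u ≠ u') {K K' : Set V} (hK : G.Land z K u)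
    (hK' : G.Land z K' u') (hKK : Disjoint K K') (hKS : Disjoint K {x, y, z})
    (hKS' : Disjoint K' {x, y, z}) (hKP : ∀ i, Disjoint (P i) K) (hKP' : ∀ i, Disjoint (P i) K')
    (hKH : ∀ k, Disjoint (H k) K) (hKH' : ∀ k, Disjoint (H k) K') :
    ∃ H' : Fin (j + 1) × Bool → Set V,
      G.Config x y z (fun i : {i // i ≠ i₀} => P i) H' := by
  have key : ∃ Fx Fy : Set V, Fx ⊆ P i₀ ∪ K ∪ K' ∧ Fy ⊆ P i₀ ∪ K ∪ K' ∧ Disjoint Fx Fy ∧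
      G.Half z Fx x ∧ G.Half z Fy y := by
    have hthin := hc.thin hu
    have hPK := hKP i₀
    have hPK' := hKP' i₀
    obtain ⟨A, B, hA, hB, hAB, hcov, hxA, hyB, hxu, hyu⟩ := hthin.split hxy (hc.x_notMem _)
      (hc.y_notMem _) hu
    have hAP : A ⊆ P i₀ := hA.trans Set.sdiff_subset
    have hBP : B ⊆ P i₀ := hB.trans Set.sdiff_subset
    have hAu : insert u A ⊆ P i₀ := Set.insert_subset hu hAP
    have hBu : insert u B ⊆ P i₀ := Set.insert_subset hu hBP
    have hdA : Disjoint (insert u A) B := by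
      rw [Set.disjoint_insert_left]
      exact ⟨fun h => (hB h).2 rfl, hAB⟩
    have hdB : Disjoint A (insert u B) := by
      rw [Set.disjoint_insert_right]
      exact ⟨fun h => (hA h).2 rfl, hAB⟩
    have final : ∀ (C D K₁ K₂ : Set V), C ⊆ P i₀ → D ⊆ P i₀ → Disjoint C D → Disjoint K₁ K₂ →
        Disjoint (P i₀) K₁ → Disjoint (P i₀) K₂ → Disjoint (K₁ ∪ C) (K₂ ∪ D) := by
      intro C D K₁ K₂ h1 h2 h3 h4 h5 h6
      rw [Set.disjoint_union_left, Set.disjoint_union_right, Set.disjoint_union_right]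
      exact ⟨⟨h4, (h5.mono_left h2).symm⟩, h6.mono_left h1, h3⟩
    rcases hcov ⟨hu', huu.symm⟩ with h | h
    · refine ⟨K' ∪ A, K ∪ insert u B, ?_, ?_, final _ _ _ _ hAP hBu hdB hKK.symm hPK' hPK, ?_, ?_⟩
      · exact Set.union_subset Set.subset_union_right
          (hAP.trans (Set.subset_union_left.trans Set.subset_union_left))
      · exact Set.union_subset (Set.subset_union_right.trans Set.subset_union_left)
          (hBu.trans (Set.subset_union_left.trans Set.subset_union_left))
      · exact hK'.half h (fun hh => hc.x_notMem _ (hAP hh)) (hxA _ h)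
      · exact hK.half (Or.inl rfl) (fun hh => hc.y_notMem _ (hBu hh)) hyu
    · refine ⟨K ∪ insert u A, K' ∪ B, ?_, ?_, final _ _ _ _ hAu hBP hdA hKK hPK hPK', ?_, ?_⟩
      · exact Set.union_subset (Set.subset_union_right.trans Set.subset_union_left)
          (hAu.trans (Set.subset_union_left.trans Set.subset_union_left))
      · exact Set.union_subset Set.subset_union_right
          (hBP.trans (Set.subset_union_left.trans Set.subset_union_left))
      · exact hK.half (Or.inl rfl) (fun hh => hc.x_notMem _ (hAu hh)) hxu
      · exact hK'.half h (fun hh => hc.y_notMem _ (hBP hh)) (hyB _ h)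
  obtain ⟨Fx, Fy, h1, h2, h3, h4, h5⟩ := key
  have hsubS : Disjoint (P i₀ ∪ K ∪ K') {x, y, z} := by
    rw [Set.disjoint_union_left, Set.disjoint_union_left]
    exact ⟨⟨hc.P_avoid _, hKS⟩, hKS'⟩
  have hsubH : ∀ k, Disjoint (H k) (P i₀ ∪ K ∪ K') := by
    intro k
    rw [Set.disjoint_union_right, Set.disjoint_union_right]
    exact ⟨⟨(hc.P_H _ _).symm, hKH k⟩, hKH' k⟩
  have hsubP : ∀ i, i ≠ i₀ → Disjoint (P i) (P i₀ ∪ K ∪ K') := by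
    intro i hi
    rw [Set.disjoint_union_right, Set.disjoint_union_right]
    exact ⟨⟨hc.P_disj _ _ hi, hKP i⟩, hKP' i⟩
  have hF : ∀ b : Bool, (if b then Fx else Fy) ⊆ P i₀ ∪ K ∪ K' := by
    intro b; cases b <;> simp [h1, h2]
  refine ⟨fun k => Fin.lastCases (motive := fun _ => Bool → Set V) (fun b => if b then Fx else Fy)
    (fun a b => H (a, b)) k.1 k.2, ⟨fun i => hc.P_avoid i,
    fun i i' hii => hc.P_disj _ _ (fun h => hii (Subtype.ext h)), fun i => hc.link i,
    fun i i' h h' => Subtype.ext (hc.one_edge _ _ h h'), ?_, ?_, ?_, ?_⟩⟩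
  · rintro ⟨a, b⟩
    refine Fin.lastCases ?_ (fun a => ?_) a
    · simp only [Fin.lastCases_last]
      exact hsubS.mono_left (hF b)
    · simp only [Fin.lastCases_castSucc]
      exact hc.H_avoid _
  · rintro ⟨a, b⟩ ⟨a', b'⟩
    refine Fin.lastCases ?_ (fun a => ?_) a <;> refine Fin.lastCases ?_ (fun a' => ?_) a' <;>
      intro hne <;> simp only [Fin.lastCases_last, Fin.lastCases_castSucc]
    · cases b <;> cases b'
      · exact absurd rfl hne
      · exact h3.symm
      · exact h3
      · exact absurd rfl hne
    · exact ((hsubH _).mono_right (hF b)).symm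
    · exact (hsubH _).mono_right (hF b')
    · refine hc.H_disj _ _ fun h => hne ?_
      rw [Prod.mk.injEq] at h
      rw [h.1, h.2]
  · rintro ⟨i, hi⟩ ⟨a, b⟩
    refine Fin.lastCases ?_ (fun a => ?_) a
    · simp only [Fin.lastCases_last]
      exact (hsubP i hi).mono_right (hF b)
    · simp only [Fin.lastCases_castSucc]
      exact hc.P_H _ _
  · intro a b
    refine Fin.lastCases ?_ (fun a => ?_) a
    · simp only [Fin.lastCases_last]
      left
      cases b
      · exact h5
      · exact h4
    · simp only [Fin.lastCases_castSucc, Fin.val_castSucc]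
      exact hc.half a b

/-- The walks from `z` to `x` and `y` in a configuration can be replaced by others so that `z`
sends walks to different vertices on the links as well, `d` walks in total. -/
theorem Config.extend [Finite V] [Fintype ι] (hc : G.Config x y z P H) {d : ℕ}
    (hG : G.KConn Set.univ d) (hxy : x ≠ y) (hxz : x ≠ z) (hyz : y ≠ z) (hj : 1 ≤ j)
    (hd : Fintype.card ι + j = d) (hjd : 2 * j ≤ d) :
    ∃ (H' : Fin j × Bool → Set V) (K : Fin (d - 2 * j) → Set V) (u : Fin (d - 2 * j) → V),
      G.Config x y z P H' ∧ (∀ k, Disjoint (K k) {x, y, z}) ∧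
      (∀ k k', k ≠ k' → Disjoint (K k) (K k')) ∧ (∀ i k, Disjoint (P i) (K k)) ∧
      (∀ k k', Disjoint (H' k) (K k')) ∧ Function.Injective u ∧ (∀ k, ∃ i, u k ∈ P i) ∧
      ∀ k, G.Land z (K k) (u k) := by
  classical
  set Q : Set V := ⋃ i, P i with hQdef
  have hxQ : x ∉ Q := by simpa [Q] using hc.x_notMem
  have hyQ : y ∉ Q := by simpa [Q] using hc.y_notMem
  have hzQ : z ∉ Q := by simpa [Q] using hc.z_notMem
  have hside : ∀ b, side x y b ∉ Q := by intro b; cases b <;> simp [side, hxQ, hyQ]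
  have hsidez : ∀ b, z ≠ side x y b := by intro b; cases b <;> simp [side, hxz.symm, hyz.symm]
  let R : V → V → Prop := fun u w =>
    G.Adj u w ∧ u ∉ Q ∧ u ∉ ({x, y} : Set V) ∧ w ∉ ({x, y} : Set V)
  let touch : V → (Fin j × Bool) ⊕ Fin (d - 2 * j) → Prop := fun v l => match l with
    | .inl p => v ∉ Q ∧ G.Adj v (side x y p.2) ∧ (v = z → p.1.val = 0)
    | .inr _ => v ∈ Q
  have hzxy : z ∉ ({x, y} : Set V) := by simp [hxz.symm, hyz.symm]
  obtain ⟨l, F, hl, hF, hF'⟩ := Relation.exists_fan R touch {x, y}ᶜ (fun _ _ h => h.2.2.2) z d (by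
    intro X Y hzX hXY
    have hYcard := Finset.card_toLeft_add_card_toRight (u := Y)
    -- a walk of `G` from `z` to `q` yields a walk that ends in a label, or stays below the links
    have walk : ∀ (T : Finset V) (q : V), T.card < d → z ∉ T → q ∉ T →
        (∀ v, v ∉ T → v ∉ ({x, y} : Set V) → v ∉ X) →
        (∃ v, Relation.ReachIn R (X : Set V)ᶜ z v ∧
          (v ∈ Q ∨ (v ∉ Q ∧ ∃ b, G.Adj v (side x y b) ∧ side x y b ∉ T))) ∨
        (q ∉ Q ∧ q ∉ ({x, y} : Set V) ∧ Relation.ReachIn R (X : Set V)ᶜ z q) := by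
      intro T q hT hzT hqT hTX
      by_contra hno
      rw [not_or] at hno
      obtain ⟨hno1, hno2⟩ := hno
      push Not at hno1
      have := (hG.2 T hT z ⟨trivial, hzT⟩ q ⟨trivial, hqT⟩).mem_of_closed
        (C := {v | v ∉ Q ∧ v ∉ ({x, y} : Set V) ∧ Relation.ReachIn R (X : Set V)ᶜ z v})
        ⟨hzQ, hzxy, .refl⟩ (by
          rintro a b ⟨h1, h2, h3⟩ ⟨hab, -, hb⟩
          have haX : a ∈ (X : Set V)ᶜ := h3.mem hzX
          by_cases hbxy : b ∈ ({x, y} : Set V)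
          · exfalso
            rcases hbxy with rfl | hby
            · exact hb.2 ((hno1 a h3).2 h1 true hab)
            · rw [Set.mem_singleton_iff] at hby
              subst hby
              exact hb.2 ((hno1 a h3).2 h1 false hab)
          · have hbX : b ∉ X := hTX b hb.2 hbxy
            have h4 : Relation.ReachIn R (X : Set V)ᶜ z b :=
              h3.tail ⟨⟨hab, h1, h2, hbxy⟩, haX, hbX⟩
            exact ⟨(hno1 b h4).1, hbxy, h4⟩)
      exact hno2 this
    by_cases hall : ∀ k, Sum.inr k ∈ Y
    · -- some old walk avoids `X` and ends in an admissible label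
      have hYr : Y.toRight.card = d - 2 * j := by
        have : Y.toRight = Finset.univ := Finset.eq_univ_of_forall fun k => by simpa using hall k
        simp [this]
      obtain ⟨p, hpY, hpX⟩ : ∃ p, Sum.inl p ∉ Y ∧ ∀ w ∈ H p, w ∉ X := by
        by_contra hno
        push Not at hno
        have : Nonempty V := ⟨x⟩
        choose! f hf hfX using hno
        have h1 : (Finset.univ \ Y.toLeft).card ≤ X.card :=
          Finset.card_le_card_of_injOn f (fun p hp => hfX p (by simpa using hp)) (by
            intro p hp q hq hpq
            by_contra hne
            refine Set.disjoint_left.1 (hc.H_disj p q hne) (hf p (by simpa using hp)) ?_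
            rw [hpq]
            exact hf q (by simpa using hq))
        have h2 := Finset.card_sdiff_add_card (Finset.univ : Finset (Fin j × Bool)) Y.toLeft
        have h3 := Finset.card_le_card (Finset.subset_union_left
          (s₁ := (Finset.univ : Finset (Fin j × Bool))) (s₂ := Y.toLeft))
        have h4 : (Finset.univ : Finset (Fin j × Bool)).card = j * 2 := by simp
        omega
      rcases hc.half p.1 p.2 with ⟨w, h1, h2, h3⟩ | ⟨h1, h2⟩
      · have hmem : ∀ a ∈ insert z (H p), a ∉ Q ∧ a ∉ ({x, y} : Set V) ∧ a ∉ X := by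
          rintro a (rfl | ha)
          · exact ⟨hzQ, hzxy, hzX⟩
          · refine ⟨?_, fun h => Set.disjoint_left.1 (hc.H_avoid p) ha ?_, hpX a ha⟩
            · simp only [Q, Set.mem_iUnion, not_exists]
              exact fun i hi => Set.disjoint_left.1 (hc.P_H i p) hi ha
            · rcases h with h | h
              · exact Or.inl h
              · exact Or.inr (Or.inl h)
        refine ⟨w, .inl p, hpY, ?_, (hmem w (Or.inr h1)).1, h2, ?_⟩
        · rw [← reachIn_iff_within] at h3
          refine h3.mono (fun a b ha hb hab => ⟨hab, (hmem a ha).1, (hmem a ha).2.1,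
            (hmem b hb).2.1⟩) (fun a ha => (hmem a ha).2.2)
        · rintro rfl
          exact (Set.disjoint_left.1 (hc.H_avoid p) h1 (by simp)).elim
      · exact ⟨z, .inl p, hpY, .refl, hzQ, h2, fun _ => h1⟩
    push Not at hall
    obtain ⟨k, hk⟩ := hall
    let X₀ : Finset V := (X.erase x).erase y
    have hX₀ : X₀.card ≤ X.card :=
      (Finset.card_erase_le).trans Finset.card_erase_le
    let T : Finset V := X₀ ∪ Y.toLeft.image fun p => side x y p.2
    have hT : T.card < d := by
      have h1 := Finset.card_union_le X₀ (Y.toLeft.image fun p => side x y p.2)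
      have h2 := Finset.card_image_le (s := Y.toLeft) (f := fun p => side x y p.2)
      have h3 : T.card ≤ _ := h1
      omega
    have hzT : z ∉ T := by
      simp only [T, Finset.mem_union, Finset.mem_image, not_or, not_exists, not_and]
      refine ⟨fun h => hzX ?_, fun p _ h => hsidez _ h.symm⟩
      simp only [X₀, Finset.mem_erase] at h
      exact h.2.2
    have hTX : ∀ v, v ∉ T → v ∉ ({x, y} : Set V) → v ∉ X := by
      intro v hv hvxy hvX
      simp only [Set.mem_insert_iff, Set.mem_singleton_iff, not_or] at hvxy
      exact hv (Finset.mem_union_left _ (by simp [X₀, hvX, hvxy]))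
    have hbT : ∀ b, side x y b ∉ T → ∀ a, Sum.inl (a, b) ∉ Y := by
      intro b hb a hab
      exact hb (Finset.mem_union_right _ (Finset.mem_image.2 ⟨(a, b), by simpa using hab, rfl⟩))
    have finish : (∃ v, Relation.ReachIn R (X : Set V)ᶜ z v ∧
          (v ∈ Q ∨ (v ∉ Q ∧ ∃ b, G.Adj v (side x y b) ∧ side x y b ∉ T))) →
        ∃ v l, l ∉ Y ∧ Relation.ReachIn R (X : Set V)ᶜ z v ∧ touch v l := by
      rintro ⟨v, h1, h2 | ⟨h2, b, h3, h4⟩⟩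
      · exact ⟨v, .inr k, hk, h1, h2⟩
      · exact ⟨v, .inl (⟨0, hj⟩, b), hbT b h4 _, h1, h2, h3, fun _ => rfl⟩
    by_cases hTfull : ∃ q, q ∉ T ∧ (q ∈ Q ∨ q ∈ ({x, y} : Set V))
    · obtain ⟨q, hqT, hq⟩ := hTfull
      rcases walk T q hT hzT hqT hTX with h | h
      · exact finish h
      · exact (hq.elim h.1 h.2.1).elim
    -- now `X` contains all inner vertices of the links, and `Y` meets the labels of both sides
    push Not at hTfull
    have hQX : ∀ q ∈ Q, q ∈ X₀ := by
      intro q hq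
      have : q ∈ T := by
        by_contra hqT
        exact (hTfull q hqT).1 hq
      simp only [T, Finset.mem_union, Finset.mem_image] at this
      rcases this with h | ⟨p, -, rfl⟩
      · exact h
      · exact absurd hq (hside _)
    have hlab : ∀ b, ∃ a, Sum.inl (a, b) ∈ Y := by
      intro b
      have : side x y b ∈ T := by
        by_contra hqT
        apply (hTfull _ hqT).2
        cases b <;> simp [side]
      simp only [T, Finset.mem_union, Finset.mem_image] at this
      rcases this with h | ⟨p, hp, hpb⟩
      · exfalso
        revert h
        cases b <;> simp [side, X₀]
      · have : p.2 = b := by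
          rcases p with ⟨a, c⟩
          cases b <;> cases c <;> simp_all [side]
        exact ⟨p.1, by rw [← this]; simpa using hp⟩
    have hXcard : d ≤ X.card + j + 1 := by
      have := hc.card_le_of_subset (X := X₀) fun i q hq => hQX q (Set.mem_iUnion.2 ⟨i, hq⟩)
      omega
    obtain ⟨a', ha'⟩ := hlab false
    obtain ⟨a, ha⟩ : ∃ a, Sum.inl (a, true) ∉ Y := by
      by_contra hno
      push Not at hno
      have h1 : (insert (a', false) (Finset.univ.image fun a : Fin j => (a, true))).card ≤
          Y.toLeft.card := by
        refine Finset.card_le_card fun p hp => ?_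
        rw [Finset.mem_insert, Finset.mem_image] at hp
        rcases hp with rfl | ⟨a, -, rfl⟩
        · simpa using ha'
        · simpa using hno a
      rw [Finset.card_insert_of_notMem (by simp), Finset.card_image_of_injective _
        (fun a b h => (Prod.mk.inj h).1)] at h1
      simp only [Finset.card_univ, Fintype.card_fin] at h1
      omega
    obtain ⟨a'', ha''⟩ := hlab true
    have hY2 : 2 ≤ Y.card := by
      have : ({Sum.inl (a', false), Sum.inl (a'', true)} :
          Finset ((Fin j × Bool) ⊕ Fin (d - 2 * j))) ⊆ Y := by
        intro l hl
        simp only [Finset.mem_insert, Finset.mem_singleton] at hl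
        rcases hl with rfl | rfl <;> assumption
      have h2 := Finset.card_le_card this
      rwa [Finset.card_pair (by simp)] at h2
    obtain ⟨v, -, hv1, hv2, hv3⟩ := hG.exists_adj (X := insert y (insert z X₀))
      (by
        have h1 := Finset.card_insert_le y (insert z X₀)
        have h2 := Finset.card_insert_le z X₀
        omega) (Set.mem_univ x) (by simp [hxy, hxz, X₀])
    simp only [Finset.mem_insert, not_or] at hv1
    rcases walk (insert x (insert y X₀)) v
      (by
        have h1 := Finset.card_insert_le x (insert y X₀)
        have h2 := Finset.card_insert_le y X₀
        omega)
      (by simp [hxz.symm, hyz.symm, X₀, hzX]) (by simp [hv1, hv2])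
      (by
        intro w hw _ hwX
        simp only [Finset.mem_insert, not_or] at hw
        exact hw.2.2 (by simp [X₀, hwX, hw.1, hw.2.1])) with ⟨w, h1, h2 | ⟨h2, b, h3, h4⟩⟩ | h
    · exact ⟨w, .inr k, hk, h1, h2⟩
    · exact absurd (by cases b <;> simp [side]) h4
    · exact ⟨v, .inl (a, true), ha, h.2.2, h.1, hv3.symm, fun h => absurd h hv1.2.1⟩)
  have hbij : Function.Bijective l := by
    rw [Fintype.bijective_iff_injective_and_card]
    refine ⟨hl, ?_⟩
    simp
    omega
  let e := Equiv.ofBijective l hbij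
  have hle : ∀ i, l (e.symm i) = i := fun i => e.apply_symm_apply i
  have hreach : ∀ (F : Set V) v, z ∉ F → Relation.ReachIn R (insert z F) z v →
      (v ∉ Q → v ∈ insert z (F \ Q) ∧ (G.within (insert z (F \ Q))).Reachable z v) ∧
      (v ∈ Q → G.Land z (F \ Q) v) := by
    intro F v hzF hv
    induction hv with
    | refl => exact ⟨fun _ => ⟨Or.inl rfl, .refl _⟩, fun h => absurd h hzQ⟩
    | @tail a b _ hab ih =>
      obtain ⟨⟨h1, h2, h3, h4⟩, h5, h6⟩ := hab
      obtain ⟨h7, h8⟩ := ih.1 h2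
      refine ⟨fun hb => ?_, fun _ => ⟨a, h7, h1, h8⟩⟩
      have hb' : b ∈ insert z (F \ Q) := by
        rcases h6 with h | h
        · exact Or.inl h
        · exact Or.inr ⟨h, hb⟩
      exact ⟨hb', h8.trans (h1.reachable_within h7 hb')⟩
  have hav : ∀ k, Disjoint (F k \ Q) {x, y, z} := by
    intro k
    rw [Set.disjoint_left]
    rintro w ⟨hw, -⟩ hw'
    have h1 := (hF' k).1 hw
    rcases hw' with h | h | h
    · exact h1 (Or.inl h)
    · exact h1 (Or.inr h)
    · exact (hF' k).2.1 (h ▸ hw)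
  have hdisj : ∀ k k', k ≠ k' → Disjoint (F k \ Q) (F k' \ Q) := fun k k' h =>
    (hF k k' h).mono Set.sdiff_subset Set.sdiff_subset
  have hPQ : ∀ i k, Disjoint (P i) (F k \ Q) := fun i k =>
    (Set.disjoint_sdiff_right).mono_left (Set.subset_iUnion P i)
  have hlandK : ∀ k, ∃ u, u ∈ F (e.symm (.inr k)) ∧ u ∈ Q ∧
      G.Land z (F (e.symm (.inr k)) \ Q) u := by
    intro k
    obtain ⟨-, h1, v, h2, h3, h4⟩ := hF' (e.symm (.inr k))
    rw [hle] at h2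
    refine ⟨v, h3.resolve_left ?_, h2, (hreach _ v h1 h4).2 h2⟩
    rintro rfl
    exact hzQ h2
  choose u hu hu' hu'' using hlandK
  refine ⟨fun p => F (e.symm (.inl p)) \ Q, fun k => F (e.symm (.inr k)) \ Q, u,
    ⟨hc.P_avoid, hc.P_disj, hc.link, hc.one_edge, fun _ => hav _,
      fun k k' hk => hdisj _ _ (e.symm.injective.ne (by simpa using hk)), fun i k => hPQ _ _, ?_⟩,
    fun _ => hav _, fun k k' hk => hdisj _ _ (e.symm.injective.ne (by simpa using hk)),
    fun i k => hPQ _ _, fun k k' => hdisj _ _ (e.symm.injective.ne (by simp)), ?_,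
    fun k => by simpa [Q] using hu' k, hu''⟩
  · intro a b
    obtain ⟨-, h1, v, h2, h3, h4⟩ := hF' (e.symm (.inl (a, b)))
    rw [hle] at h2
    obtain ⟨h5, h6, h7⟩ := h2
    obtain ⟨h8, h9⟩ := (hreach _ v h1 h4).1 h5
    rcases h8 with rfl | h8
    · exact Or.inr ⟨h7 rfl, h6⟩
    · exact Or.inl ⟨v, h8, h6, h9⟩
  · intro k k' hkk
    by_contra hne
    refine Set.disjoint_left.1 (hF (e.symm (.inr k)) (e.symm (.inr k'))
      (e.symm.injective.ne (by simpa using hne))) (hu k) ?_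
    rw [hkk]
    exact hu k'

end Config

theorem LinkSet.through {x y z : V} {P : Set V} {E : Set (Sym2 V)}
    (h : G.LinkSet x y P) (hP : Disjoint P {x, y, z}) :
    (G.through {x, y, z} P E).Reachable x y := by
  refine Reachable.mono ?_ h
  rintro a b ⟨h1, h2, h3⟩
  rw [deleteEdges_adj] at h1
  have hmem : ∀ w ∈ insert x (insert y P), w ∈ P ∪ {x, y, z} := by
    rintro w (rfl | rfl | hw)
    · exact Or.inr (by simp)
    · exact Or.inr (by simp)
    · exact Or.inl hw
  refine ⟨h1.1, hmem _ h2, hmem _ h3, fun ha hb => ?_⟩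
  exfalso
  have h4 : ∀ w ∈ insert x (insert y P), w ∈ ({x, y, z} : Set V) → w = x ∨ w = y := by
    rintro w (rfl | rfl | hw) hw'
    · exact Or.inl rfl
    · exact Or.inr rfl
    · exact (Set.disjoint_left.1 hP hw hw').elim
  apply h1.2
  rcases h4 a h2 ha with rfl | rfl <;> rcases h4 b h3 hb with rfl | rfl
  · exact absurd rfl h1.1.ne
  · rfl
  · exact Sym2.eq_swap
  · exact absurd rfl h1.1.ne

/-- A walk from `z` that lands in `u`, followed by a walk from `u` to `x` in a set `P` which hangs
on `x`. -/
theorem Land.through_of_reachable {S F P : Set V} {x z u : V} {E : Set (Sym2 V)}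
    (hx : x ∈ S) (hz : z ∈ S) (h : G.Land z F u) (hu : u ∈ P) (hP : Disjoint P S)
    (hF : Disjoint F S) (hux : (G.within (insert x P)).Reachable x u) :
    (G.through S (P ∪ F) E).Reachable x z := by
  obtain ⟨w, h1, h2, h3⟩ := h
  refine (hux.mono (within_insert_le_through hx hP Set.subset_union_left)).trans
    (Reachable.trans (Adj.reachable ?_)
      (h3.mono (within_insert_le_through hz hF Set.subset_union_right)).symm)
  refine ⟨h2.symm, Or.inl (Or.inl hu), ?_, fun hu' => absurd hu' (Set.disjoint_left.1 hP hu)⟩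
  rcases h1 with rfl | h1
  · exact Or.inr hz
  · exact Or.inl (Or.inr h1)

section Config

variable {x y z : V} {ι : Type*} {P : ι → Set V} {j : ℕ} {H : Fin j × Bool → Set V}

theorem Config.wild_connectors [Fintype ι] {κ : Type*} [Fintype κ] (hc : G.Config x y z P H)
    (hxy : x ≠ y) (hxz : x ≠ z) (hyz : y ≠ z) (hcard : Fintype.card ι = Fintype.card κ)
    {F : κ → Set V} {l : κ → ι ⊕ Bool} (hl : Function.Injective l)
    (hFS : ∀ i, Disjoint (F i) {x, y, z}) (hF : ∀ i j, i ≠ j → Disjoint (F i) (F j))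
    (hPF : ∀ i k, Disjoint (P i) (F k)) (hland : ∀ k i, l k = .inl i → ∃ u ∈ P i, G.Land z (F k) u)
    (hwild : ∀ k b, l k = .inr b → G.Land z (F k) (side x y b)) :
    ∃ (σ : ι ≃ κ) (E : ι → Set (Sym2 V)), G.Connectors {x, y, z} (fun i => P i ∪ F (σ i)) E := by
  obtain ⟨σ, hσ⟩ := exists_wild_connectors (G := G) hcard hxy hxz hyz (P := P)
    (E := fun i => {e | e = s(x, y) ∧ P i = ∅}) hl hc.P_avoid hFS hc.P_disj hF hPF
    (by
      intro i i' hii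
      rw [Set.disjoint_left]
      rintro e ⟨-, h1⟩ ⟨-, h2⟩
      exact hii (hc.one_edge i i' h1 h2))
    (fun i e he => he.1)
    (by
      intro i
      rcases hc.link i with h | ⟨h1, h2⟩
      · exact h.1.through (hc.P_avoid i)
      · exact Adj.reachable (G := G.through _ _ _)
          ⟨h2, Or.inr (by simp), Or.inr (by simp), fun _ _ => ⟨rfl, h1⟩⟩)
    (by
      intro k i hk
      obtain ⟨u, hu, hul⟩ := hland k i hk
      obtain ⟨A, B, hA, -, -, -, -, -, hxu, -⟩ := (hc.thin hu).split hxy (hc.x_notMem i)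
        (hc.y_notMem i) hu
      refine hul.through_of_reachable (by simp) (by simp) hu (hc.P_avoid i) (hFS k)
        (hxu.mono (within_mono (Set.insert_subset_insert ?_)))
      exact Set.insert_subset hu (hA.trans Set.sdiff_subset))
    (fun k hk => (hwild k true hk).through (by simp) (by simp) (hFS k) subset_rfl fun _ => rfl)
    (fun k hk => (hwild k false hk).through (by simp) (by simp) (hFS k) subset_rfl fun _ => rfl)
  exact ⟨σ, _, hσ⟩

/-- In a configuration with at least one pair of walks from `z` to `x` and `y`, two links may be
served by these walks. -/
theorem Config.connectors [Fintype ι] {κ : Type*} [Fintype κ] (hc : G.Config x y z P H)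
    (hxy : x ≠ y) (hxz : x ≠ z) (hyz : y ≠ z) (hj : 0 < j)
    (hcard : Fintype.card ι = Fintype.card κ + 2)
    {K : κ → Set V} {l : κ → ι} {u : κ → V} (hl : Function.Injective l)
    (hKS : ∀ i, Disjoint (K i) {x, y, z}) (hK : ∀ i j, i ≠ j → Disjoint (K i) (K j))
    (hPK : ∀ i k, Disjoint (P i) (K k)) (hHK : ∀ k k', Disjoint (H k) (K k'))
    (hu : ∀ k, u k ∈ P (l k)) (hland : ∀ k, G.Land z (K k) (u k)) :
    ∃ (W : ι → Set V) (E : ι → Set (Sym2 V)), G.Connectors {x, y, z} W E ∧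
      ∀ T : Set V, (∀ i, Disjoint T (P i)) → (∀ k, Disjoint T (K k)) →
        (∀ b, Disjoint T (H (⟨0, hj⟩, b))) → ∀ i, Disjoint T (W i) := by
  obtain ⟨σ, E, h⟩ := hc.wild_connectors (κ := κ ⊕ Bool) hxy hxz hyz (by simpa using hcard)
    (F := Sum.elim K fun b => H (⟨0, hj⟩, b)) (l := Sum.map l id)
    (hl.sumMap Function.injective_id)
    (by
      rintro (k | b)
      · exact hKS k
      · exact hc.H_avoid _)
    (by
      rintro (k | b) (k' | b') hne
      · exact hK _ _ (fun h => hne (h ▸ rfl))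
      · exact (hHK _ _).symm
      · exact hHK _ _
      · refine hc.H_disj _ _ fun h => hne ?_
        rw [(Prod.mk.inj h).2])
    (by
      rintro i (k | b)
      · exact hPK i k
      · exact hc.P_H _ _)
    (by
      rintro (k | b) i hi
      · refine ⟨u k, ?_, hland k⟩
        have : l k = i := by simpa using hi
        exact this ▸ hu k
      · simp at hi)
    (by
      rintro (k | b') b hb
      · simp at hb
      · have : b' = b := by simpa using hb
        subst this
        rcases hc.half ⟨0, hj⟩ b' with h | h
        · exact h.land
        · exact ⟨z, Or.inl rfl, h.2, .refl _⟩)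
  refine ⟨_, E, h, fun T h1 h2 h3 i => ?_⟩
  rw [Set.disjoint_union_right]
  refine ⟨h1 i, ?_⟩
  rcases σ i with k | b
  · exact h2 k
  · exact h3 b

/-- Four links, or three, and one pair of walks from `z` to `x` and `y` suffice. -/
theorem Config.hasConnectors [Finite V] [Fintype ι] {H : Fin 1 × Bool → Set V}
    (hc : G.Config x y z P H) {d : ℕ} (hG : G.KConn Set.univ d) (hd : d = 4 ∨ d = 5)
    (hxy : x ≠ y) (hxz : x ≠ z) (hyz : y ≠ z) (hcard : Fintype.card ι + 1 = d) :
    G.HasConnectors {x, y, z} (d - 1) := by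
  classical
  obtain ⟨H', K, u, hc', hKS, hK, hPK, hHK, hu, huP, hland⟩ := hc.extend hG hxy hxz hyz le_rfl
    hcard (by omega)
  choose l hl using huP
  rcases hd with rfl | rfl
  · obtain ⟨W, E, h, -⟩ := hc'.connectors (κ := Unit) (K := fun _ => K 0) (l := fun _ => l 0)
      (u := fun _ => u 0) hxy hxz hyz one_pos (by simp; omega) (fun _ _ _ => rfl) (fun _ => hKS _)
      (fun i j hij => absurd rfl hij) (fun i _ => hPK i _) (fun _ _ => hHK _ _) (fun _ => hl _)
      (fun _ => hland _)
    exact h.hasConnectors (by omega)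
  · let k₀ : Fin (5 - 2 * 1) := 0
    let k₁ : Fin (5 - 2 * 1) := 1
    have hk : k₀ ≠ k₁ := by decide
    by_cases hll : l k₀ = l k₁
    · obtain ⟨H₂, hc₂⟩ := hc'.break hxy (hl k₀) (hll ▸ hl k₁) (hu.ne hk) (hland k₀) (hland k₁)
        (hK _ _ hk) (hKS _) (hKS _) (fun i => hPK i _) (fun i => hPK i _) (fun k => hHK k _)
        (fun k => hHK k _)
      have hcard₂ : Fintype.card {i // i ≠ l k₀} = 3 := by
        rw [Fintype.card_subtype_compl, Fintype.card_subtype_eq]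
        omega
      obtain ⟨H₃, K₃, u₃, hc₃, hKS₃, hK₃, hPK₃, hHK₃, hu₃, huP₃, hland₃⟩ := hc₂.extend hG hxy hxz
        hyz (by omega) (d := 5) (by omega) (by omega)
      choose l₃ hl₃ using huP₃
      let k : Fin (5 - 2 * (1 + 1)) := 0
      obtain ⟨W, E, h, hW⟩ := hc₃.connectors (κ := Unit) (K := fun _ => K₃ k)
        (l := fun _ => l₃ k) (u := fun _ => u₃ k) hxy hxz hyz two_pos
        (by rw [hcard₂]; rfl) (fun _ _ _ => rfl) (fun _ => hKS₃ _)
        (fun i j hij => absurd rfl hij) (fun i _ => hPK₃ i _) (fun _ _ => hHK₃ _ _)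
        (fun _ => hl₃ _) (fun _ => hland₃ _)
      -- the second walks to `x` and `y` form another connector
      have hhalf : ∀ b, G.Half z (H₃ (1, b)) (side x y b) := by
        intro b
        rcases hc₃.half 1 b with h | h
        · exact h
        · exact absurd h.1 (by decide)
      have h2 := h.option (W₀ := H₃ (1, true) ∪ H₃ (1, false)) (E₀ := ∅)
        (by rw [Set.disjoint_union_left]; exact ⟨hc₃.H_avoid _, hc₃.H_avoid _⟩)
        (hW _
          (fun i => by
            rw [Set.disjoint_union_left]; exact ⟨(hc₃.P_H i _).symm, (hc₃.P_H i _).symm⟩)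
          (fun k => by rw [Set.disjoint_union_left]; exact ⟨hHK₃ _ _, hHK₃ _ _⟩)
          (fun b => by
            rw [Set.disjoint_union_left]
            exact ⟨hc₃.H_disj _ _ (by simp), hc₃.H_disj _ _ (by simp)⟩))
        (fun _ => Set.empty_disjoint _)
        (by
          have h1 : (G.through {x, y, z} (H₃ (1, true) ∪ H₃ (1, false)) ∅).Reachable x z :=
            (hhalf true).through (by simp) (by simp) (hc₃.H_avoid _) Set.subset_union_left
          have h2 : (G.through {x, y, z} (H₃ (1, true) ∪ H₃ (1, false)) ∅).Reachable y z :=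
            (hhalf false).through (by simp) (by simp) (hc₃.H_avoid _) Set.subset_union_right
          exact joined_of_reachable (h1.trans h2.symm) h1)
      exact h2.hasConnectors (by rw [Fintype.card_option, hcard₂])
    · obtain ⟨W, E, h, -⟩ := hc'.connectors (κ := Bool) (K := fun b => K (if b then k₀ else k₁))
        (l := fun b => l (if b then k₀ else k₁)) (u := fun b => u (if b then k₀ else k₁)) hxy hxz
        hyz one_pos (by simp; omega)
        (by
          intro b b' hb
          cases b <;> cases b' <;> simp_all)
        (fun _ => hKS _)
        (by
          intro b b' hb
          apply hK
          cases b <;> cases b' <;> simp_all [hk.symm])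
        (fun i _ => hPK i _) (fun _ _ => hHK _ _) (fun _ => hl _) (fun _ => hland _)
      exact h.hasConnectors (by omega)

end Config

/-- In a graph of connectivity `d ∈ {4, 5}` any three vertices have `d - 1` connectors. -/
theorem KConn.hasConnectors [Finite V] {d : ℕ} (hG : G.KConn Set.univ d) (hd : d = 4 ∨ d = 5)
    {x y z : V} (hxy : x ≠ y) (hxz : x ≠ z) (hyz : y ≠ z) :
    G.HasConnectors {x, y, z} (d - 1) := by
  classical
  obtain ⟨t, rfl⟩ : ∃ t, d = t + 1 := ⟨d - 1, by omega⟩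
  obtain ⟨P₀, h1, h2, h3, h4⟩ := hG.exists_links (Set.mem_univ x) (Set.mem_univ y) hxy
  have hthin : ∀ i, ∃ Q ⊆ P₀ i, G.ThinLink x y Q ∨ (Q = ∅ ∧ G.Adj x y ∧ i = 0) := by
    intro i
    rcases h4 i with ⟨w, hw, hwy⟩ | h
    · have hlink : G.LinkSet x y (P₀ i) := by
        have hx0 : x ∉ P₀ i := fun h => (h2 i h).2 (by simp)
        have hy0 : y ∉ P₀ i := fun h => (h2 i h).2 (by simp)
        have hle : G.within (insert x (P₀ i)) ≤
            (G.deleteEdges {s(x, y)}).within (insert x (insert y (P₀ i))) := by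
          rintro a b ⟨h5, h6, h7⟩
          have hsub : insert x (P₀ i) ⊆ insert x (insert y (P₀ i)) :=
            Set.insert_subset_insert (Set.subset_insert _ _)
          refine ⟨?_, hsub h6, hsub h7⟩
          rw [deleteEdges_adj]
          refine ⟨h5, fun h8 => ?_⟩
          have hy1 : y ∉ insert x (P₀ i) := by
            rintro (h | h)
            · exact hxy h.symm
            · exact hy0 h
          rw [Set.mem_singleton_iff, Sym2.eq_iff] at h8
          rcases h8 with ⟨-, rfl⟩ | ⟨rfl, -⟩
          · exact hy1 h7
          · exact hy1 h6
        refine ((h3 i w hw).mono hle).trans (Adj.reachable ⟨?_, Or.inr (Or.inr hw), by simp⟩)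
        rw [deleteEdges_adj]
        refine ⟨hwy, fun h8 => ?_⟩
        rw [Set.mem_singleton_iff, Sym2.eq_iff] at h8
        rcases h8 with ⟨rfl, -⟩ | ⟨rfl, -⟩
        · exact hx0 hw
        · exact hy0 hw
      obtain ⟨Q, hQ, hQ'⟩ := exists_thinLink hlink
      exact ⟨Q, hQ, Or.inl hQ'⟩
    · exact ⟨∅, Set.empty_subset _, Or.inr ⟨rfl, h.2⟩⟩
  choose P hPsub hP using hthin
  have hPdisj : ∀ i i', i ≠ i' → Disjoint (P i) (P i') := fun i i' h =>
    (h1 i i' h).mono (hPsub i) (hPsub i')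
  have hPxy : ∀ i, x ∉ P i ∧ y ∉ P i := fun i =>
    ⟨fun h => (h2 i (hPsub i h)).2 (by simp), fun h => (h2 i (hPsub i h)).2 (by simp)⟩
  have hPlink : ∀ i, G.ThinLink x y (P i) ∨ (P i = ∅ ∧ G.Adj x y) := fun i =>
    (hP i).imp id fun h => ⟨h.1, h.2.1⟩
  have hP0 : ∀ i, P i = ∅ → i = 0 := by
    intro i hi
    rcases hP i with h | h
    · exact absurd hi (h.1.nonempty hxy).ne_empty
    · exact h.2.2
  have hPone : ∀ i i', P i = ∅ → P i' = ∅ → i = i' := fun i i' h h' =>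
    (hP0 i h).trans (hP0 i' h').symm
  by_cases hz : ∃ i, z ∈ P i
  · -- `z` lies on a link, which it breaks into two walks
    obtain ⟨i₀, hz⟩ := hz
    have hth : G.ThinLink x y (P i₀) := by
      rcases hPlink i₀ with h | h
      · exact h
      · rw [h.1] at hz; exact hz.elim
    obtain ⟨A, B, hA, hB, hAB, -, -, -, hxz', hyz'⟩ := hth.split hxy (hPxy i₀).1 (hPxy i₀).2 hz
    have hAx : G.Land z A x := land_of_reachable hxz (fun h => (hPxy i₀).1 (hA h).1) hxz'
    have hBy : G.Land z B y := land_of_reachable hyz (fun h => (hPxy i₀).2 (hB h).1) hyz'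
    have havoid : ∀ Q ⊆ P i₀ \ {z}, Disjoint Q {x, y, z} := by
      intro Q hQ
      rw [Set.disjoint_left]
      rintro w hw (rfl | rfl | rfl)
      · exact (hPxy i₀).1 (hQ hw).1
      · exact (hPxy i₀).2 (hQ hw).1
      · exact (hQ hw).2 rfl
    have hsub : ∀ b : Bool, (if b then A else B) ⊆ P i₀ \ {z} := by
      intro b; cases b <;> simp [hA, hB]
    have hc : G.Config x y z (fun i : {i // i ≠ i₀} => P i) (j := 1)
        (fun k => if k.2 then A else B) := by
      refine ⟨?_, fun i i' h => hPdisj _ _ fun h' => h (Subtype.ext h'), fun i => hPlink i,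
        fun i i' h h' => Subtype.ext (hPone _ _ h h'), fun k => havoid _ (hsub k.2), ?_, ?_, ?_⟩
      · rintro ⟨i, hi⟩
        rw [Set.disjoint_left]
        rintro w hw (rfl | rfl | rfl)
        · exact (hPxy i).1 hw
        · exact (hPxy i).2 hw
        · exact Set.disjoint_left.1 (hPdisj i i₀ hi) hw hz
      · rintro ⟨a, b⟩ ⟨a', b'⟩ hne
        have hbb : b ≠ b' := fun h => hne (by rw [h, Subsingleton.elim a a'])
        cases b <;> cases b'
        · exact absurd rfl hbb
        · exact hAB.symm
        · exact hAB
        · exact absurd rfl hbb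
      · rintro ⟨i, hi⟩ k
        exact (hPdisj i i₀ hi).mono_right ((hsub k.2).trans Set.sdiff_subset)
      · intro a b
        cases b
        · exact hBy.half_or_adj.imp id fun h => ⟨by omega, h⟩
        · exact hAx.half_or_adj.imp id fun h => ⟨by omega, h⟩
    refine hc.hasConnectors hG hd hxy hxz hyz ?_
    rw [Fintype.card_subtype_compl, Fintype.card_subtype_eq, Fintype.card_fin]
    omega
  push Not at hz
  have hc : G.Config x y z P (j := 0) (fun k => k.1.elim0) := by
    refine ⟨?_, hPdisj, hPlink, hPone, fun k => k.1.elim0, fun k => k.1.elim0,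
      fun _ k => k.1.elim0, fun a => a.elim0⟩
    intro i
    rw [Set.disjoint_left]
    rintro w hw (rfl | rfl | rfl)
    · exact (hPxy i).1 hw
    · exact (hPxy i).2 hw
    · exact hz i hw
  obtain ⟨u, F, hu, hF, hF'⟩ := exists_fan G
    (fun v u => G.Adj v u ∧ ((∃ i, u ∈ P i) ∨ ∃ b, u = side x y b))
    {v | (∀ i, v ∉ P i) ∧ v ≠ x ∧ v ≠ y} z (t + 1) (by
    intro X Y hzX hXY
    let T := X ∪ Y.erase z
    have hT : T.card < t + 1 := by
      have h5 := Finset.card_union_le X (Y.erase z)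
      have h6 := Finset.card_erase_le (s := Y) (a := z)
      have h7 : T.card ≤ _ := h5
      omega
    obtain ⟨q, hqT, hq⟩ : ∃ q, q ∉ T ∧ ((∃ i, q ∈ P i) ∨ q = x ∨ q = y) := by
      by_contra hno
      push Not at hno
      have h5 := hc.card_le_of_subset (X := (T.erase x).erase y) (by
        intro i q hq
        have hqT : q ∈ T := by
          by_contra hqT
          exact (hno q hqT).1 i hq
        rw [Finset.mem_erase, Finset.mem_erase]
        exact ⟨fun h => (hPxy i).2 (h ▸ hq), fun h => (hPxy i).1 (h ▸ hq), hqT⟩)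
      have hxT : x ∈ T := by
        by_contra h
        exact (hno x h).2.1 rfl
      have hyT : y ∈ T.erase x := by
        rw [Finset.mem_erase]
        refine ⟨hxy.symm, ?_⟩
        by_contra h
        exact (hno y h).2.2 rfl
      rw [Finset.card_erase_of_mem hyT, Finset.card_erase_of_mem hxT, Fintype.card_fin] at h5
      omega
    have hzT : z ∉ T := by simp [T, hzX]
    by_contra hno
    push Not at hno
    have := (hG.2 T hT z ⟨trivial, hzT⟩ q ⟨trivial, hqT⟩).mem_of_closed
      (C := {v | ((∀ i, v ∉ P i) ∧ v ≠ x ∧ v ≠ y) ∧ v ∉ X ∧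
        (G.within (insert z {v | (∀ i, v ∉ P i) ∧ v ≠ x ∧ v ≠ y} \ X)).Reachable z v})
      ⟨⟨hz, hxz.symm, hyz.symm⟩, hzX, .refl _⟩ (by
        rintro a b ⟨h5, h6, h7⟩ ⟨hab, -, hb⟩
        have hb2 := hb.2
        simp only [T, Finset.coe_union, Finset.coe_erase, Set.mem_union, Finset.mem_coe,
          Set.mem_sdiff, Set.mem_singleton_iff, not_or, not_and, not_not] at hb2
        have hbn : (∀ i, b ∉ P i) ∧ b ≠ x ∧ b ≠ y := by
          by_contra hcon
          have hbz : b ≠ z := by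
            rintro rfl
            exact hcon ⟨hz, hxz.symm, hyz.symm⟩
          have hbY : b ∉ Y := fun h => hbz (hb2.2 h)
          obtain ⟨h8, h9⟩ := hno a b hbY h7 hab
          exact hcon ⟨h8, h9 true, h9 false⟩
        exact ⟨hbn, hb2.1, h7.trans (hab.reachable_within ⟨Or.inr h5, h6⟩ ⟨Or.inr hbn, hb2.1⟩)⟩)
    obtain ⟨⟨h5, h6, h7⟩, -⟩ := this
    rcases hq with ⟨i, hi⟩ | h | h
    · exact h5 i hi
    · exact h6 h
    · exact h7 h)
  have hland : ∀ k, G.Land z (F k) (u k) := by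
    intro k
    obtain ⟨-, -, v, h5, h6, h7⟩ := hF' k
    exact ⟨v, h6, h5.1, h7⟩
  have hFS : ∀ k, Disjoint (F k) {x, y, z} := by
    intro k
    rw [Set.disjoint_left]
    rintro w hw (rfl | rfl | rfl)
    · exact ((hF' k).1 hw).2.1 rfl
    · exact ((hF' k).1 hw).2.2 rfl
    · exact (hF' k).2.1 hw
  have hPF : ∀ i k, Disjoint (P i) (F k) := by
    intro i k
    rw [Set.disjoint_left]
    exact fun w hw hw' => ((hF' k).1 hw').1 i hw
  have hlab : ∀ k, ∃ l : Fin (t + 1) ⊕ Bool, (∀ i, l = .inl i → u k ∈ P i) ∧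
      ∀ b, l = .inr b → u k = side x y b := by
    intro k
    obtain ⟨-, -, v, h5, -⟩ := hF' k
    rcases h5.2 with ⟨i, hi⟩ | ⟨b, hb⟩
    · exact ⟨.inl i, by rintro i' ⟨⟩; exact hi, by rintro b' ⟨⟩⟩
    · exact ⟨.inr b, by rintro i' ⟨⟩, by rintro b' ⟨⟩; exact hb⟩
  choose l hl using hlab
  by_cases hinj : Function.Injective l
  · obtain ⟨σ, E, h⟩ := hc.wild_connectors hxy hxz hyz rfl hinj hFS hF hPF
      (fun k i hi => ⟨u k, (hl k).1 i hi, hland k⟩)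
      (fun k b hb => (hl k).2 b hb ▸ hland k)
    exact h.hasConnectors (by simp)
  · -- two walks land in the same link
    unfold Function.Injective at hinj
    push Not at hinj
    obtain ⟨k, k', hkk, hne⟩ := hinj
    cases hlk : l k with
    | inr b =>
      exact absurd (hu (((hl k).2 b hlk).trans ((hl k').2 b (hkk ▸ hlk)).symm)) hne
    | inl i =>
      obtain ⟨H', hc'⟩ := hc.break hxy ((hl k).1 i hlk) ((hl k').1 i (hkk ▸ hlk)) (hu.ne hne)
        (hland k) (hland k') (hF k k' hne) (hFS k) (hFS k') (fun i => hPF i k) (fun i => hPF i k')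
        (fun k => k.1.elim0) (fun k => k.1.elim0)
      refine hc'.hasConnectors hG hd hxy hxz hyz ?_
      rw [Fintype.card_subtype_compl, Fintype.card_subtype_eq, Fintype.card_fin]
      omega

/-! ### Graphs composed of copies -/

/-- `G` is composed of copies, indexed by `I`, each of which is `h`-connected; every vertex has
exactly two neighbours outside its copy, in different copies; and any two copies are joined by a
matching of `h + 2` edges. -/
structure CopyGraph (G : SimpleGraph V) (copy : V → ℕ) (I : Set ℕ) (h : ℕ) : Prop where
  mem : ∀ v, copy v ∈ I
  kconn : ∀ i ∈ I, G.KConn {v | copy v = i} h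
  out : ∀ u, ∃ o₁ o₂, G.Adj u o₁ ∧ G.Adj u o₂ ∧ copy o₁ ≠ copy u ∧ copy o₂ ≠ copy u ∧
    copy o₁ ≠ copy o₂ ∧ ∀ w, G.Adj u w → copy w ≠ copy u → w = o₁ ∨ w = o₂
  cross : ∀ i ∈ I, ∀ j ∈ I, i ≠ j → ∃ a b : Fin (h + 2) → V, Function.Injective a ∧
    Function.Injective b ∧ ∀ k, G.Adj (a k) (b k) ∧ copy (a k) = i ∧ copy (b k) = j

namespace CopyGraph

variable {copy : V → ℕ} {I : Set ℕ} {h : ℕ}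

theorem eq_of_adj (hc : G.CopyGraph copy I h) {u w w' : V} (hw : G.Adj u w) (hw' : G.Adj u w')
    (hne : copy w ≠ copy u) (heq : copy w = copy w') : w = w' := by
  obtain ⟨o₁, o₂, -, -, -, -, ho, hall⟩ := hc.out u
  rcases hall w hw hne with rfl | rfl <;> rcases hall w' hw' (heq ▸ hne) with rfl | rfl
  · rfl
  · exact absurd heq ho
  · exact absurd heq.symm ho
  · rfl

/-- Different vertices of a copy have no common neighbour outside. -/
theorem ne_of_adj (hc : G.CopyGraph copy I h) {u u' w w' : V} (hw : G.Adj u w)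
    (hw' : G.Adj u' w') (hne : copy w ≠ copy u) (heq : copy u = copy u') (hu : u ≠ u') :
    w ≠ w' := by
  rintro rfl
  exact hu (hc.eq_of_adj hw.symm hw'.symm hne.symm heq)

theorem exists_out (hc : G.CopyGraph copy I h) (u : V) (j : ℕ) :
    ∃ w, G.Adj u w ∧ copy w ≠ copy u ∧ copy w ≠ j := by
  obtain ⟨o₁, o₂, h1, h2, h3, h4, h5, -⟩ := hc.out u
  by_cases h : copy o₁ = j
  · exact ⟨o₂, h2, h4, fun h' => h5 (h.trans h'.symm)⟩
  · exact ⟨o₁, h1, h3, h⟩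

/-- A union of copies stays connected when fewer than `h` vertices of each copy, and fewer than
`h + 2` vertices in total, are deleted. -/
theorem joined (hc : G.CopyGraph copy I h) {D : Set ℕ} (hD : D ⊆ I) {X : Finset V}
    (hX : ∀ j ∈ D, (X.filter (copy · = j)).card < h) (hX' : X.card < h + 2) {u v : V}
    (hu : copy u ∈ D) (hv : copy v ∈ D) (huX : u ∉ X) (hvX : v ∉ X) :
    (G.within ({w | copy w ∈ D} \ X)).Reachable u v := by
  classical
  have same : ∀ u v, copy u ∈ D → copy u = copy v → u ∉ X → v ∉ X →
      (G.within ({w | copy w ∈ D} \ X)).Reachable u v := by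
    intro u v hu huv huX hvX
    refine ((hc.kconn _ (hD hu)).2 _ (hX _ hu) u ⟨rfl, by simp [huX]⟩ v
      ⟨huv.symm, by simp [hvX]⟩).mono (within_mono ?_)
    rintro w ⟨hw, hw'⟩
    have hw2 : copy w = copy u := hw
    refine ⟨?_, fun hwX => hw' (by simp [hw2, Finset.mem_coe.1 hwX])⟩
    change copy w ∈ D
    rwa [hw2]
  by_cases huv : copy u = copy v
  · exact same u v hu huv huX hvX
  obtain ⟨a, b, ha, hb, hab⟩ := hc.cross _ (hD hu) _ (hD hv) huv
  obtain ⟨k, hk⟩ : ∃ k, a k ∉ X ∧ b k ∉ X := by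
    by_contra hno
    push Not at hno
    have h1 : (Finset.univ : Finset (Fin (h + 2))).card ≤ X.card := by
      refine Finset.card_le_card_of_injOn (fun k => if a k ∈ X then a k else b k) ?_ ?_
      · intro k _
        dsimp only
        split_ifs with h
        · exact h
        · exact hno k h
      · intro k _ k' _ hkk
        dsimp only at hkk
        split_ifs at hkk
        · exact ha hkk
        · exact absurd (by rw [← (hab k).2.1, hkk, (hab k').2.2]) huv
        · exact absurd (by rw [← (hab k').2.1, ← hkk, (hab k).2.2]) huv
        · exact hb hkk
    simp at h1
    omega
  have h1 := same u (a k) hu (hab k).2.1.symm huX hk.1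
  have h2 := same (b k) v (by rw [(hab k).2.2]; exact hv) (hab k).2.2 hk.2 hvX
  refine (h1.trans ((hab k).1.reachable_within ⟨?_, hk.1⟩ ⟨?_, hk.2⟩)).trans h2
  · change copy (a k) ∈ D
    rw [(hab k).2.1]; exact hu
  · change copy (b k) ∈ D
    rw [(hab k).2.2]; exact hv

/-- After the deletion of at most `h + 1` vertices from a union of copies, either all of it can be
reached from `z`, or one copy `j` contains all but at most one of the deleted vertices. In
the latter case all vertices outside copy `j` can be reached from `z`, unless `z` lies in copy `j`
and has no way to leave it. -/
theorem reach_or (hc : G.CopyGraph copy I h) (hh : 2 ≤ h) {D : Set ℕ} (hD : D ⊆ I) {X : Finset V}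
    (hX : X.card < h + 2) {z : V} (hz : copy z ∈ D) (hzX : z ∉ X) :
    (∀ v, copy v ∈ D → v ∉ X → (G.within (insert z {w | copy w ∈ D} \ X)).Reachable z v) ∨
    ∃ j, (X.filter (copy · ≠ j)).card + h ≤ X.card ∧
      ((∀ v, copy v ∈ D → copy v ≠ j → v ∉ X →
        (G.within (insert z {w | copy w ∈ D} \ X)).Reachable z v) ∨
      (copy z = j ∧ ∀ w, G.Adj z w → copy w ≠ j → copy w ∈ D → w ∈ X.filter (copy · ≠ j))) := by
  classical
  have hins : insert z {w | copy w ∈ D} = {w | copy w ∈ D} := Set.insert_eq_of_mem hz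
  rw [hins]
  by_cases hall : ∀ j ∈ D, (X.filter (copy · = j)).card < h
  · exact Or.inl fun v hv hvX => hc.joined hD hall hX hz hv hzX hvX
  right
  push Not at hall
  obtain ⟨j, hj, hjX⟩ := hall
  have hcard : (X.filter (copy · = j)).card + (X.filter (copy · ≠ j)).card = X.card :=
    Finset.card_filter_add_card_filter_not _
  have hrest : ∀ u v, copy u ∈ D → copy u ≠ j → u ∉ X → copy v ∈ D → copy v ≠ j → v ∉ X →
      (G.within ({w | copy w ∈ D} \ X)).Reachable u v := by
    intro u v hu huj huX hv hvj hvX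
    refine (hc.joined (D := D \ {j}) (Set.sdiff_subset.trans hD) (X := X) ?_ hX
      (show copy u ∈ D \ {j} from ⟨hu, huj⟩) (show copy v ∈ D \ {j} from ⟨hv, hvj⟩)
      huX hvX).mono (within_mono (Set.sdiff_subset_sdiff_left fun w hw => hw.1))
    rintro i ⟨-, hi⟩
    have : X.filter (copy · = i) ⊆ X.filter (copy · ≠ j) := by
      intro w hw
      rw [Finset.mem_filter] at hw ⊢
      exact ⟨hw.1, fun h => hi (hw.2.symm.trans h)⟩
    have := Finset.card_le_card this
    omega
  refine ⟨j, by omega, ?_⟩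
  by_cases hzj : copy z = j
  · by_cases hexit : ∃ w, G.Adj z w ∧ copy w ≠ j ∧ copy w ∈ D ∧ w ∉ X
    · obtain ⟨w, h1, h2, h3, h4⟩ := hexit
      exact Or.inl fun v hv hvj hvX => (h1.reachable_within
        (show z ∈ {w | copy w ∈ D} \ (X : Set V) from ⟨hz, hzX⟩)
        (show w ∈ {w | copy w ∈ D} \ (X : Set V) from ⟨h3, h4⟩)).trans
          (hrest w v h3 h2 h4 hv hvj hvX)
    · push Not at hexit
      exact Or.inr ⟨hzj, fun w h1 h2 h3 => Finset.mem_filter.2 ⟨hexit w h1 h2 h3, h2⟩⟩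
  · exact Or.inl fun v hv hvj hvX => hrest z v hz hzj hzX hv hvj hvX

end CopyGraph

/-- If `z` sends walks to all links between `x` and `y`, and to `x` and to `y`, then there is one
connector more than there are links. -/
theorem hasConnectors_of_all_labels {ι : Type*} [Fintype ι] {x y z : V} (hxy : x ≠ y)
    (hxz : x ≠ z) (hyz : y ≠ z) {P : ι → Set V} {E : ι → Set (Sym2 V)} {F : ι ⊕ Bool → Set V}
    (hPS : ∀ i, Disjoint (P i) {x, y, z}) (hFS : ∀ i, Disjoint (F i) {x, y, z})
    (hP : ∀ i j, i ≠ j → Disjoint (P i) (P j)) (hF : ∀ i j, i ≠ j → Disjoint (F i) (F j))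
    (hPF : ∀ i k, Disjoint (P i) (F k)) (hE : ∀ i j, i ≠ j → Disjoint (E i) (E j))
    (hE' : ∀ i, E i ⊆ {s(x, y)})
    (hlink : ∀ i, (G.through {x, y, z} (P i) (E i)).Reachable x y)
    (hland : ∀ i, (G.through {x, y, z} (P i ∪ F (.inl i)) (E i)).Reachable x z)
    (hwild : ∀ b, G.Land z (F (.inr b)) (side x y b)) :
    G.HasConnectors {x, y, z} (Fintype.card ι + 1) := by
  have h1 : G.Connectors {x, y, z} (fun i => P i ∪ F (.inl i)) E := by
    refine ⟨fun i => ?_, fun i j hij => ?_, hE, fun i => ?_⟩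
    · rw [Set.disjoint_union_left]
      exact ⟨hPS i, hFS _⟩
    · rw [Set.disjoint_union_left, Set.disjoint_union_right, Set.disjoint_union_right]
      exact ⟨⟨hP i j hij, hPF _ _⟩, (hPF _ _).symm, hF _ _ (by simpa using hij)⟩
    · exact joined_of_reachable ((hlink i).mono (through_mono Set.subset_union_left subset_rfl))
        (hland i)
  have h2 := h1.option (W₀ := F (.inr true) ∪ F (.inr false)) (E₀ := {s(x, z), s(y, z)})
    (by rw [Set.disjoint_union_left]; exact ⟨hFS _, hFS _⟩)
    (fun i => by
      rw [Set.disjoint_union_left, Set.disjoint_union_right, Set.disjoint_union_right]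
      exact ⟨⟨(hPF _ _).symm, hF _ _ (by simp)⟩, (hPF _ _).symm, hF _ _ (by simp)⟩)
    (fun i => by
      rw [Set.disjoint_right]
      intro e he
      rw [Set.mem_singleton_iff.1 (hE' i he)]
      rintro (h | h)
      · rw [Sym2.eq_iff] at h
        rcases h with h | h
        · exact hyz h.2
        · exact hxz h.1
      · rw [Set.mem_singleton_iff, Sym2.eq_iff] at h
        rcases h with h | h
        · exact hxy h.1
        · exact hxz h.1)
    (by
      have h3 : (G.through {x, y, z} (F (.inr true) ∪ F (.inr false))
          {s(x, z), s(y, z)}).Reachable x z :=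
        (hwild true).through (by simp) (by simp) (hFS _) Set.subset_union_left
          (fun _ => Or.inl rfl)
      have h4 : (G.through {x, y, z} (F (.inr true) ∪ F (.inr false))
          {s(x, z), s(y, z)}).Reachable y z :=
        (hwild false).through (by simp) (by simp) (hFS _) Set.subset_union_right
          (fun _ => Or.inr rfl)
      exact joined_of_reachable (h3.trans h4.symm) h3)
  exact h2.hasConnectors (by rw [Fintype.card_option])

/-! ### Two vertices in the same copy, the third in another one -/

/-- The copy of `x` and `y` is partitioned into `h` links, to all of which, and to `x` and `y`, the
vertex `z` sends walks through the other copies. -/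
theorem CopyGraph.hasConnectors_two_one [Finite V] {copy : V → ℕ} {I : Set ℕ} {h : ℕ}
    (hc : G.CopyGraph copy I h) (hh : 3 ≤ h) {x y z : V} (hxy : x ≠ y) (hcxy : copy x = copy y)
    (hz : copy z ≠ copy x) : G.HasConnectors {x, y, z} (h + 1) := by
  classical
  have hxz : x ≠ z := fun e => hz (e ▸ rfl)
  have hyz : y ≠ z := fun e => hz (e ▸ hcxy.symm)
  obtain ⟨t, rfl⟩ : ∃ t, h = t + 1 := ⟨h - 1, by omega⟩
  obtain ⟨P, hP, hPM, hPcov, hPx, hPy⟩ := (hc.kconn _ (hc.mem x)).exists_link_partition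
    (by omega) (x := x) (y := y) rfl hcxy.symm hxy
  have hPcopy : ∀ i, ∀ w ∈ P i, copy w = copy x := fun i w hw => (hPM i hw).1
  have hPxy : ∀ i, x ∉ P i ∧ y ∉ P i := fun i =>
    ⟨fun h => (hPM i h).2 (by simp), fun h => (hPM i h).2 (by simp)⟩
  have hP0 : ∀ i, P i = ∅ → G.Adj x y ∧ i = 0 := by
    intro i hi
    rcases hPy i with ⟨w, hw, -⟩ | h
    · rw [hi] at hw; exact hw.elim
    · exact h.2
  set D : Set ℕ := I \ {copy x} with hD
  have hDI : D ⊆ I := Set.sdiff_subset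
  have hDmem : ∀ w, copy w ≠ copy x → copy w ∈ D := fun w hw => ⟨hc.mem w, hw⟩
  let touch : V → Fin (t + 1) ⊕ Bool → Prop := fun v l => match l with
    | .inl i => (∃ w ∈ P i, G.Adj v w) ∨ (P i = ∅ ∧ G.Adj v x ∧ v ≠ z)
    | .inr b => G.Adj v (side x y b)
  have hsidecopy : ∀ b, copy (side x y b) = copy x := by
    intro b; cases b <;> simp [side, hcxy]
  have hlabel : ∀ v w, G.Adj v w → copy w = copy x → ∃ l, touch v l := by
    intro v w hvw hw
    by_cases hwx : w = x
    · exact ⟨.inr true, by simpa [touch, side, ← hwx] using hvw⟩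
    · by_cases hwy : w = y
      · exact ⟨.inr false, by simpa [touch, side, ← hwy] using hvw⟩
      · obtain ⟨i, hi⟩ := hPcov w ⟨hw, by simp [hwx, hwy]⟩
        exact ⟨.inl i, Or.inl ⟨w, hi, hvw⟩⟩
  obtain ⟨l, F, hl, hF, hF'⟩ := exists_fan G touch {v | copy v ∈ D} z (t + 1 + 2) (by
    intro X Y hzX hXY
    by_contra hno
    push Not at hno
    rcases hc.reach_or (by omega) hDI (X := X) (by omega) (hDmem z hz) hzX with hA | ⟨j, hj, hB⟩
    · -- every label has its own vertex outside, so these vertices were all deleted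
      have hX : ∀ v l, l ∉ Y → copy v ≠ copy x → touch v l → v ∈ X := by
        intro v l hl hv hvl
        by_contra hvX
        exact hno v l hl (hA v (hDmem v hv) hvX) hvl
      obtain ⟨ox, ox', h1, h2, h3, h4, h5, h6⟩ : ∃ ox ox', G.Adj x ox ∧ G.Adj x ox' ∧
          copy ox ≠ copy x ∧ copy ox' ≠ copy x ∧ ox ≠ ox' ∧ ox' ≠ z := by
        obtain ⟨o₁, o₂, h1, h2, h3, h4, h5, -⟩ := hc.out x
        have hne : o₁ ≠ o₂ := fun e => h5 (e ▸ rfl)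
        by_cases ho : o₂ = z
        · exact ⟨o₂, o₁, h2, h1, h4, h3, hne.symm, fun e => hne (e.trans ho.symm)⟩
        · exact ⟨o₁, o₂, h1, h2, h3, h4, hne, ho⟩
      -- `owner l` is a vertex of the first copy with label `l`, and `n l` its neighbour outside
      have hown : ∀ l : Fin (t + 1) ⊕ Bool, ∃ w n, copy w = copy x ∧ G.Adj w n ∧
          copy n ≠ copy x ∧ touch n l ∧
          (∀ i, l = .inl i → (w ∈ P i) ∨ (i = 0 ∧ w = x ∧ n = ox')) ∧
          (∀ b, l = .inr b → w = side x y b ∧ (b = true → n = ox)) := by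
        rintro (i | b)
        · by_cases hi : (P i).Nonempty
          · obtain ⟨w, hw⟩ := hi
            obtain ⟨n, hn1, hn2, -⟩ := hc.exists_out w (copy x)
            exact ⟨w, n, hPcopy i w hw, hn1, hPcopy i w hw ▸ hn2, Or.inl ⟨w, hw, hn1.symm⟩,
              by rintro i' ⟨⟩; exact Or.inl hw, by rintro b ⟨⟩⟩
          · rw [Set.not_nonempty_iff_eq_empty] at hi
            exact ⟨x, ox', rfl, h2, h4, Or.inr ⟨hi, h2.symm, h6⟩,
              by rintro i' ⟨⟩; exact Or.inr ⟨(hP0 i hi).2, rfl, rfl⟩, by rintro b ⟨⟩⟩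
        · cases b
          · obtain ⟨n, hn1, hn2, -⟩ := hc.exists_out y (copy x)
            exact ⟨y, n, hcxy.symm, hn1, hcxy ▸ hn2, hn1.symm, by rintro i ⟨⟩,
              by rintro b ⟨⟩; simp [side]⟩
          · exact ⟨x, ox, rfl, h1, h3, h1.symm, by rintro i ⟨⟩, by rintro b ⟨⟩; simp [side]⟩
      choose w n hw1 hw2 hw3 hw4 hw5 hw6 using hown
      have hinj : Function.Injective n := by
        intro l l' hll
        have hww : w l = w l' := by
          by_contra hne
          exact hc.ne_of_adj (hw2 l) (hw2 l') (by rw [hw1 l]; exact hw3 l)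
            ((hw1 l).trans (hw1 l').symm) hne hll
        rcases l with i | b <;> rcases l' with i' | b'
        · rcases hw5 (.inl i) i rfl with h7 | ⟨h7, h8, -⟩ <;>
            rcases hw5 (.inl i') i' rfl with h7' | ⟨h7', h8', -⟩
          · by_contra hne
            exact Set.disjoint_left.1 (hP i i' (fun e => hne (e ▸ rfl))) h7 (hww ▸ h7')
          · exact absurd (h8' ▸ hww ▸ h7) (hPxy i).1
          · exact absurd (h8 ▸ hww ▸ h7') (hPxy i').1
          · rw [h7, h7']
        · exfalso
          obtain ⟨h9, h10⟩ := hw6 (.inr b') b' rfl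
          rcases hw5 (.inl i) i rfl with h7 | ⟨-, h8, h8'⟩
          · rw [hww, h9] at h7
            cases b'
            · exact (hPxy i).2 h7
            · exact (hPxy i).1 h7
          · cases b'
            · exact hxy (h8.symm.trans (hww.trans h9))
            · exact h5 ((h10 rfl).symm.trans (hll.symm.trans h8'))
        · exfalso
          obtain ⟨h9, h10⟩ := hw6 (.inr b) b rfl
          rcases hw5 (.inl i') i' rfl with h7 | ⟨-, h8, h8'⟩
          · rw [← hww, h9] at h7
            cases b
            · exact (hPxy i').2 h7
            · exact (hPxy i').1 h7
          · cases b
            · exact hxy (h8.symm.trans (hww.symm.trans h9))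
            · exact h5 ((h10 rfl).symm.trans (hll.trans h8'))
        · have h9 := (hw6 (.inr b) b rfl).1
          have h9' := (hw6 (.inr b') b' rfl).1
          have h10 : side x y b = side x y b' := h9.symm.trans (hww.trans h9')
          cases b <;> cases b' <;> simp_all [side]
      have h7 : (Finset.univ \ Y).card ≤ X.card :=
        Finset.card_le_card_of_injOn n
          (fun l hl => hX _ l (by simpa using hl) (hw3 l) (hw4 l)) hinj.injOn
      have h8 := Finset.card_sdiff_add_card (Finset.univ : Finset (Fin (t + 1) ⊕ Bool)) Y
      have h9 := Finset.card_le_card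
        (Finset.subset_union_left (s₁ := (Finset.univ : Finset (Fin (t + 1) ⊕ Bool))) (s₂ := Y))
      have h10 : (Finset.univ : Finset (Fin (t + 1) ⊕ Bool)).card = t + 1 + 2 := by simp
      omega
    · set X' := X.filter (copy · ≠ j) with hX'
      have hbudget : X'.card + Y.card ≤ 1 := by omega
      have two : ∀ v v' : V, v ≠ v' → v ∈ X' → v' ∈ X' → False := by
        intro v v' hne hv hv'
        have := Finset.one_lt_card.2 ⟨v, hv, v', hv', hne⟩
        omega
      have one : ∀ v l, v ∈ X' → l ∈ Y → False := by
        intro v l hv hl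
        have h1 := Finset.card_pos.2 ⟨v, hv⟩
        have h2 := Finset.card_pos.2 ⟨l, hl⟩
        omega
      rcases hB with hB | ⟨hzj, hB⟩
      · have hb : ∀ b, ∃ v, G.Adj (side x y b) v ∧ copy v ≠ copy x ∧
            (Sum.inr b ∈ Y ∨ v ∈ X') := by
          intro b
          obtain ⟨v, h1, h2, h3⟩ := hc.exists_out (side x y b) j
          rw [hsidecopy] at h2
          refine ⟨v, h1, h2, ?_⟩
          by_contra hcon
          rw [not_or] at hcon
          have hvX : v ∉ X := fun h => hcon.2 (Finset.mem_filter.2 ⟨h, h3⟩)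
          exact hno v (.inr b) hcon.1 (hB v (hDmem v h2) h3 hvX) h1.symm
        obtain ⟨v, h1, h2, h3⟩ := hb true
        obtain ⟨v', h1', h2', h3'⟩ := hb false
        rcases h3 with h3 | h3 <;> rcases h3' with h3' | h3'
        · have := Finset.one_lt_card.2 ⟨_, h3, _, h3', by simp⟩
          omega
        · exact one _ _ h3' h3
        · exact one _ _ h3 h3'
        · exact two _ _ (hc.ne_of_adj h1 h1' (by rw [hsidecopy]; exact h2)
            (by rw [hsidecopy, hsidecopy]) (by simpa [side] using hxy)) h3 h3'
      · obtain ⟨o₁, o₂, h1, h2, h3, h4, h5, -⟩ := hc.out z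
        have ho : ∀ o, G.Adj z o → copy o ≠ copy z → (copy o = copy x ∧ ∃ l, l ∈ Y) ∨ o ∈ X' := by
          intro o ho1 ho2
          by_cases hox : copy o = copy x
          · obtain ⟨l, hl⟩ := hlabel z o ho1 hox
            refine Or.inl ⟨hox, l, ?_⟩
            by_contra hlY
            exact hno z l hlY (.refl _) hl
          · exact Or.inr (hB o ho1 (hzj ▸ ho2) (hDmem o hox))
        rcases ho o₁ h1 h3 with ⟨h6, l, hl⟩ | h6 <;> rcases ho o₂ h2 h4 with ⟨h7, l', hl'⟩ | h7
        · exact h5 (h6.trans h7.symm)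
        · exact one _ _ h7 hl
        · exact one _ _ h6 hl'
        · exact two _ _ (fun e => h5 (congrArg copy e)) h6 h7)
  have hbij : Function.Bijective l := by
    rw [Fintype.bijective_iff_injective_and_card]
    exact ⟨hl, by simp⟩
  let e := Equiv.ofBijective l hbij
  have hle : ∀ i, l (e.symm i) = i := fun i => e.apply_symm_apply i
  have hFD : ∀ k, ∀ w ∈ F k, copy w ≠ copy x := fun k w hw => ((hF' k).1 hw).2
  have hFS : ∀ k, Disjoint (F k) {x, y, z} := by
    intro k
    rw [Set.disjoint_left]
    rintro w hw (rfl | rfl | rfl)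
    · exact hFD k _ hw rfl
    · exact hFD k _ hw hcxy.symm
    · exact (hF' k).2.1 hw
  have hPS : ∀ i, Disjoint (P i) {x, y, z} := by
    intro k
    rw [Set.disjoint_left]
    rintro w hw (rfl | rfl | rfl)
    · exact (hPxy k).1 hw
    · exact (hPxy k).2 hw
    · exact hz (hPcopy k _ hw)
  have := hasConnectors_of_all_labels (G := G) hxy hxz hyz (P := P)
    (E := fun i => {e | e = s(x, y) ∧ P i = ∅}) (F := fun i => F (e.symm i)) hPS
    (fun _ => hFS _) hP (fun i j hij => hF _ _ (e.symm.injective.ne hij))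
    (by
      intro i k
      rw [Set.disjoint_left]
      exact fun w hw hw' => hFD _ w hw' (hPcopy i w hw))
    (by
      intro i i' hii
      rw [Set.disjoint_left]
      rintro e ⟨-, h1⟩ ⟨-, h2⟩
      exact hii ((hP0 i h1).2.trans (hP0 i' h2).2.symm))
    (fun i e he => he.1)
    (by
      intro i
      rcases hPy i with ⟨w, hw, hwy⟩ | ⟨h1, h2, -⟩
      · exact ((hPx i w hw).mono (within_insert_le_through (by simp) (hPS i) subset_rfl)).trans
          (Adj.reachable ⟨hwy, Or.inl hw, Or.inr (by simp),
            fun h => absurd h (Set.disjoint_left.1 (hPS i) hw)⟩)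
      · exact Adj.reachable ⟨h2, Or.inr (by simp), Or.inr (by simp), fun _ _ => ⟨rfl, h1⟩⟩)
    (by
      intro i
      obtain ⟨-, -, v, h1, h2, h3⟩ := hF' (e.symm (.inl i))
      rw [hle] at h1
      rcases h1 with ⟨w, hw, hvw⟩ | ⟨h4, h5, h6⟩
      · exact Land.through_of_reachable (by simp) (by simp) ⟨v, h2, hvw, h3⟩ hw (hPS i) (hFS _)
          (hPx i w hw)
      · exact Half.through (by simp) (by simp) (hFS _) Set.subset_union_right
          ⟨v, h2.resolve_left h6, h5, h3⟩)
    (by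
      intro b
      obtain ⟨-, -, v, h1, h2, h3⟩ := hF' (e.symm (.inr b))
      rw [hle] at h1
      exact ⟨v, h2, h1, h3⟩)
  simpa using this

/-! ### Three vertices in three different copies -/

/-- Disjoint links `P i` between `x` and `y` that avoid `z`; the set `E i` says whether the link
`P i` uses the edge `xy`. -/
structure Links (G : SimpleGraph V) (x y z : V) {ι : Type*} (P : ι → Set V)
    (E : ι → Set (Sym2 V)) : Prop where
  avoid : ∀ i, Disjoint (P i) {x, y, z}
  disjoint : ∀ i j, i ≠ j → Disjoint (P i) (P j)
  disjoint_edge : ∀ i j, i ≠ j → Disjoint (E i) (E j)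
  edge : ∀ i, E i ⊆ {s(x, y)}
  link : ∀ i, (G.through {x, y, z} (P i) (E i)).Reachable x y
  reach : ∀ i, ∀ w ∈ P i, (G.through {x, y, z} (P i) (E i)).Reachable x w

/-- The vertex `w` carries a label: that of the link containing it, or that of `x` or of `y`. -/
def Carries {ι : Type*} (x y : V) (P : ι → Set V) (w : V) : ι ⊕ Bool → Prop
  | .inl i => w ∈ P i
  | .inr b => w = side x y b

section Links

variable {x y z : V} {ι : Type*} {P : ι → Set V} {E : ι → Set (Sym2 V)}

theorem Links.through_of_land (hL : G.Links x y z P E) {i : ι} {F : Set V} {u : V} (hu : u ∈ P i)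
    (hF : Disjoint F {x, y, z}) (h : G.Land z F u) :
    (G.through {x, y, z} (P i ∪ F) (E i)).Reachable x z := by
  obtain ⟨w, h1, h2, h3⟩ := h
  refine ((hL.reach i u hu).mono (through_mono Set.subset_union_left subset_rfl)).trans
    (Reachable.trans (Adj.reachable ?_)
      (h3.mono (within_insert_le_through (by simp) hF Set.subset_union_right)).symm)
  refine ⟨h2.symm, Or.inl (Or.inl hu), ?_,
    fun hu' => absurd hu' (Set.disjoint_left.1 (hL.avoid i) hu)⟩
  rcases h1 with rfl | h1
  · exact Or.inr (by simp)
  · exact Or.inl (Or.inr h1)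

/-- Links and walks from `z` which end at different labels. -/
theorem Links.wild_hasConnectors [Fintype ι] (hL : G.Links x y z P E) (hxy : x ≠ y) (hxz : x ≠ z)
    (hyz : y ≠ z) {m : ℕ} (hm : Fintype.card ι = m) {F : Fin m → Set V} {l : Fin m → ι ⊕ Bool}
    (hl : Function.Injective l) (hFS : ∀ k, Disjoint (F k) {x, y, z})
    (hF : ∀ i j, i ≠ j → Disjoint (F i) (F j)) (hPF : ∀ i k, Disjoint (P i) (F k))
    (hland : ∀ k, ∃ u, Carries x y P u (l k) ∧ G.Land z (F k) u) :
    G.HasConnectors {x, y, z} m := by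
  have hside : ∀ k b, l k = .inr b → G.Land z (F k) (side x y b) := by
    intro k b hk
    obtain ⟨u, h1, h2⟩ := hland k
    rw [hk] at h1
    have h1 : u = side x y b := h1
    rwa [h1] at h2
  obtain ⟨σ, hσ⟩ := exists_wild_connectors (G := G) (by simpa using hm) hxy hxz hyz hl hL.avoid hFS
    hL.disjoint hF hPF hL.disjoint_edge hL.edge hL.link
    (by
      intro k i hk
      obtain ⟨u, h1, h2⟩ := hland k
      rw [hk] at h1
      exact hL.through_of_land h1 (hFS k) h2)
    (fun k hk => (hside k true hk).through (by simp) (by simp) (hFS k) subset_rfl fun _ => rfl)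
    (fun k hk => (hside k false hk).through (by simp) (by simp) (hFS k) subset_rfl fun _ => rfl)
  exact hσ.hasConnectors hm.ge

variable {copy : V → ℕ} {I : Set ℕ} {h : ℕ}

/-- The links fill the copies of `x` and `y`. -/
structure Fills (copy : V → ℕ) (x y : V) (P : ι → Set V) : Prop where
  copy_eq : ∀ i, ∀ w ∈ P i, copy w = copy x ∨ copy w = copy y
  cover : ∀ w, copy w = copy x ∨ copy w = copy y → ∃ l, Carries x y P w l

theorem Fills.fan_disjoint (hP : Fills copy x y P) {F : Set V}
    (hF : F ⊆ {v | copy v ∈ I \ {copy x, copy y}}) (i : ι) : Disjoint (P i) F := by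
  rw [Set.disjoint_left]
  intro w hw hw'
  refine (hF hw').2 ?_
  rcases hP.copy_eq i w hw with h | h <;> simp [h]

theorem disjoint_triple {F : Set V} (hF : F ⊆ {v | copy v ∈ I \ {copy x, copy y}}) (hz : z ∉ F) :
    Disjoint F {x, y, z} := by
  rw [Set.disjoint_left]
  rintro w hw (rfl | rfl | rfl)
  · exact (hF hw).2 (by simp)
  · exact (hF hw).2 (by simp)
  · exact hz hw

/-- With `h + 1` links between `x` and `y`, the vertex `z` has to reach only `h + 1` of the
labels. The hypotheses on `lab` and `u` say that `h + 1` labels are carried by different vertices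
of the copy of `x`; each of these has its own neighbour outside the copies of `x` and `y`. -/
theorem CopyGraph.hasConnectors_of_wild [Finite V] [Fintype ι] (hc : G.CopyGraph copy I h)
    (hh : 2 ≤ h) (hxy : copy x ≠ copy y) (hzx : copy z ≠ copy x) (hzy : copy z ≠ copy y)
    (hL : G.Links x y z P E) (hP : Fills copy x y P) (hcard : Fintype.card ι = h + 1)
    {lab : Fin (h + 1) → ι ⊕ Bool} (hlab : Function.Injective lab) {u : Fin (h + 1) → V}
    (hu : Function.Injective u) (hux : ∀ k, copy (u k) = copy x)
    (hul : ∀ k, Carries x y P (u k) (lab k)) :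
    G.HasConnectors {x, y, z} (h + 1) := by
  classical
  set D : Set ℕ := I \ {copy x, copy y} with hD
  have hDI : D ⊆ I := Set.sdiff_subset
  have hDmem : ∀ w, copy w ≠ copy x → copy w ≠ copy y → copy w ∈ D :=
    fun w h1 h2 => ⟨hc.mem w, by simp [h1, h2]⟩
  have hDnot : ∀ w, copy w ∉ D → copy w = copy x ∨ copy w = copy y := by
    intro w hw
    by_contra hcon
    rw [not_or] at hcon
    exact hw (hDmem w hcon.1 hcon.2)
  have hzD : copy z ∈ D := hDmem z hzx hzy
  obtain ⟨l, F, hl, hF, hF'⟩ := exists_fan G (fun v l => ∃ w, G.Adj v w ∧ Carries x y P w l)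
    {v | copy v ∈ D} z (h + 1) (by
    intro X Y hzX hXY
    by_contra hno
    push Not at hno
    have hout : ∀ v w, (G.within (insert z {v | copy v ∈ D} \ (X : Set V))).Reachable z v →
        G.Adj v w → copy w ∈ D ∨ ∃ l ∈ Y, Carries x y P w l := by
      intro v w hv hvw
      by_contra hcon
      rw [not_or] at hcon
      obtain ⟨l, hl⟩ := hP.cover w (hDnot w hcon.1)
      exact hno v l (fun hlY => hcon.2 ⟨l, hlY, hl⟩) hv w hvw hl
    rcases hc.reach_or hh hDI (X := X) (by omega) hzD hzX with hA | ⟨j, hj, hB⟩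
    · have hn : ∀ k, ∃ n, G.Adj (u k) n ∧ copy n ≠ copy x ∧ copy n ∈ D := by
        intro k
        obtain ⟨n, h1, h2, h3⟩ := hc.exists_out (u k) (copy y)
        rw [hux k] at h2
        exact ⟨n, h1, h2, hDmem n h2 h3⟩
      choose n hn1 hn2 hn3 using hn
      have h1 : (Finset.univ.filter fun k => lab k ∉ Y).card ≤ X.card := by
        refine Finset.card_le_card_of_injOn n ?_ ?_
        · intro k hk
          by_contra hX
          exact hno (n k) (lab k) (by simpa using hk) (hA _ (hn3 k) hX) (u k) (hn1 k).symm (hul k)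
        · intro k _ k' _ hkk
          by_contra hne
          exact hc.ne_of_adj (hn1 k) (hn1 k') (by rw [hux k]; exact hn2 k)
            ((hux k).trans (hux k').symm) (hu.ne hne) hkk
      have h2 : (Finset.univ.filter fun k => lab k ∈ Y).card ≤ Y.card :=
        Finset.card_le_card_of_injOn lab (fun k hk => by simpa using hk) hlab.injOn
      have h3 := Finset.card_filter_add_card_filter_not (s := Finset.univ) (fun k => lab k ∈ Y)
      rw [Finset.card_univ, Fintype.card_fin] at h3
      omega
    · -- copy `j` contains all of the deleted vertices, and no label is forbidden
      have hX' : X.filter (copy · ≠ j) = ∅ := Finset.card_eq_zero.1 (by omega)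
      have hY : Y = ∅ := Finset.card_eq_zero.1 (by omega)
      subst hY
      simp only [Finset.notMem_empty, false_and, exists_false, or_false] at hout
      rw [hX'] at hB
      rcases hB with hB | ⟨-, hB⟩
      · by_cases hk : ∃ k ∈ D, k ≠ j
        · obtain ⟨k, hkD, hkj⟩ := hk
          obtain ⟨a, b, -, -, hab⟩ := hc.cross k (hDI hkD) _ (hc.mem x)
            (fun e => hkD.2 (by simp [e]))
          obtain ⟨h1, h2, h3⟩ := hab 0
          have h4 : a 0 ∉ X := fun h => by
            have : a 0 ∈ X.filter (copy · ≠ j) := Finset.mem_filter.2 ⟨h, by rw [h2]; exact hkj⟩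
            rw [hX'] at this
            simp at this
          have h5 := hout _ _ (hB (a 0) (h2 ▸ hkD) (h2 ▸ hkj) h4) h1
          exact h5.2 (by simp [h3])
        · push Not at hk
          obtain ⟨w, h1, h2, -⟩ := hc.exists_out z 0
          exact h2 ((hk _ (hout z w (.refl _) h1)).trans (hk _ hzD).symm)
      · obtain ⟨w, h1, h2, h3⟩ := hc.exists_out z j
        have := hB w h1 h3 (hout z w (.refl _) h1)
        simp at this)
  refine hL.wild_hasConnectors (fun e => hxy (congrArg copy e))
    (fun e => hzx (congrArg copy e.symm)) (fun e => hzy (congrArg copy e.symm)) hcard hl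
    (fun k => disjoint_triple (hF' k).1 (hF' k).2.1) hF
    (fun i k => hP.fan_disjoint (hF' k).1 i) fun k => ?_
  obtain ⟨-, -, v, ⟨w, h1, h2⟩, h3, h4⟩ := hF' k
  exact ⟨w, h2, v, h3, h1, h4⟩

/-- With only `h` links between `x` and `y`, the vertex `z` has to reach all labels. Both
neighbours of `y` outside its copy help `z` to reach `x` and `y`, as neither is in the copy of
`x`. -/
theorem CopyGraph.hasConnectors_of_links [Finite V] [Fintype ι] (hc : G.CopyGraph copy I h)
    (hh : 2 ≤ h) (hxy : copy x ≠ copy y) (hzx : copy z ≠ copy x) (hzy : copy z ≠ copy y)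
    (hL : G.Links x y z P E) (hP : Fills copy x y P) (hcard : Fintype.card ι = h)
    {a b : ι → V} (haP : ∀ i, a i ∈ P i) (hbP : ∀ i, b i ∈ P i) (hax : ∀ i, copy (a i) = copy x)
    (hby : ∀ i, copy (b i) = copy y) (hy : ∀ w, G.Adj y w → copy w ≠ copy x)
    (hz : ∀ w w', G.Adj z w → G.Adj z w' → copy w = copy x → copy w' ≠ copy y) :
    G.HasConnectors {x, y, z} (h + 1) := by
  classical
  set D : Set ℕ := I \ {copy x, copy y} with hD
  have hDI : D ⊆ I := Set.sdiff_subset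
  have hDmem : ∀ w, copy w ≠ copy x → copy w ≠ copy y → copy w ∈ D :=
    fun w h1 h2 => ⟨hc.mem w, by simp [h1, h2]⟩
  have hDnot : ∀ w, copy w ∉ D → copy w = copy x ∨ copy w = copy y := by
    intro w hw
    by_contra hcon
    rw [not_or] at hcon
    exact hw (hDmem w hcon.1 hcon.2)
  have hzD : copy z ∈ D := hDmem z hzx hzy
  have hne : ∀ i w, w ∈ P i → w ≠ x ∧ w ≠ y := by
    intro i w hw
    have := Set.disjoint_left.1 (hL.avoid i) hw
    simp only [Set.mem_insert_iff, Set.mem_singleton_iff, not_or] at this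
    exact ⟨this.1, this.2.1⟩
  have hPinj : ∀ i j w, w ∈ P i → w ∈ P j → i = j := by
    intro i j w h1 h2
    by_contra hij
    exact Set.disjoint_left.1 (hL.disjoint i j hij) h1 h2
  obtain ⟨l, F, hl, hF, hF'⟩ := exists_fan G (fun v l => ∃ w, G.Adj v w ∧ Carries x y P w l)
    {v | copy v ∈ D} z (h + 2) (by
    intro X Y hzX hXY
    by_contra hno
    push Not at hno
    have hout : ∀ v w, (G.within (insert z {v | copy v ∈ D} \ (X : Set V))).Reachable z v →
        G.Adj v w → copy w ∈ D ∨ ∃ l ∈ Y, Carries x y P w l := by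
      intro v w hv hvw
      by_contra hcon
      rw [not_or] at hcon
      obtain ⟨l, hl⟩ := hP.cover w (hDnot w hcon.1)
      exact hno v l (fun hlY => hcon.2 ⟨l, hlY, hl⟩) hv w hvw hl
    obtain ⟨o₁, o₂, ho₁, ho₂, ho₁', ho₂', ho, -⟩ := hc.out y
    have hydeg : ∀ w, G.Adj y w → copy w ≠ copy y → copy w ∈ D := fun w h1 h2 =>
      hDmem w (hy w h1) h2
    rcases hc.reach_or hh hDI (X := X) (by omega) hzD hzX with hA | ⟨j, hj, hB⟩
    · -- different labels outside `Y` get different deleted vertices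
      have hcount : ∀ n : ι ⊕ Bool → V, (∀ l l', l ∉ Y → l' ∉ Y → n l = n l' → l = l') →
          (∀ l, copy (n l) ∈ D) →
          (∀ l, l ∉ Y → ∃ l' w, l' ∉ Y ∧ G.Adj (n l) w ∧ Carries x y P w l') → False := by
        intro n hn hnD hnl
        have h7 : (Finset.univ \ Y).card ≤ X.card := by
          refine Finset.card_le_card_of_injOn n (fun l hl => ?_)
            (fun l hl l' hl' => hn l l' (by simpa using hl) (by simpa using hl'))
          obtain ⟨l', w, h1, h2, h3⟩ := hnl l (by simpa using hl)
          by_contra hX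
          exact hno _ l' h1 (hA _ (hnD l) hX) w h2 h3
        have h8 := Finset.card_sdiff_add_card (Finset.univ : Finset (ι ⊕ Bool)) Y
        have h9 := Finset.card_le_card
          (Finset.subset_union_left (s₁ := (Finset.univ : Finset (ι ⊕ Bool))) (s₂ := Y))
        have h10 : (Finset.univ : Finset (ι ⊕ Bool)).card = h + 2 := by simp [hcard]
        omega
      by_cases hYy : Sum.inr false ∈ Y
      · have : ∀ k : ι ⊕ Bool, ∃ w n, w = k.elim a (fun _ => x) ∧ G.Adj w n ∧
            copy w = copy x ∧ copy n ∈ D := by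
          intro k
          have hk : copy (k.elim a fun _ => x) = copy x := by
            cases k
            · exact hax _
            · rfl
          obtain ⟨n, h1, h2, h3⟩ := hc.exists_out (k.elim a fun _ => x) (copy y)
          exact ⟨_, n, rfl, h1, hk, hDmem n (hk ▸ h2) h3⟩
        choose w n hw hwn hwx hnD using this
        have hwl : ∀ l, l ∉ Y → Carries x y P (w l) l := by
          rintro (i | b) hl
          · rw [hw]; exact haP i
          · cases b
            · exact absurd hYy hl
            · rw [hw]; rfl
        refine hcount n (fun l l' hl hl' hll => ?_) hnD
          (fun l hl => ⟨l, w l, hl, (hwn l).symm, hwl l hl⟩)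
        have hww : w l = w l' := by
          by_contra hne
          refine hc.ne_of_adj (hwn l) (hwn l') (fun e => (hnD l).2 ?_)
            ((hwx l).trans (hwx l').symm) hne hll
          rw [e, hwx]; simp
        have h1 := hwl l hl
        have h2 := hwl l' hl'
        rw [← hww] at h2
        rcases l with i | b <;> rcases l' with i' | b'
        · rw [hPinj i i' _ h1 h2]
        · exact absurd ((hw (.inl i)).symm.trans (hww.trans (hw (.inr b'))) : a i = x)
            (hne i _ (haP i)).1
        · exact absurd ((hw (.inl i')).symm.trans (hww.symm.trans (hw (.inr b))) : a i' = x)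
            (hne i' _ (haP i')).1
        · cases b
          · exact absurd hYy hl
          · cases b'
            · exact absurd hYy hl'
            · rfl
      · have : ∀ i, ∃ n, G.Adj (b i) n ∧ copy n ∈ D := by
          intro i
          obtain ⟨n, h1, h2, h3⟩ := hc.exists_out (b i) (copy x)
          exact ⟨n, h1, hDmem n h3 (hby i ▸ h2)⟩
        choose n hn hnD using this
        have hny : ∀ i, copy (n i) ≠ copy y := fun i e => (hnD i).2 (by simp [e])
        have hno₁ : ∀ i o, G.Adj y o → n i ≠ o := fun i o ho =>
          hc.ne_of_adj (hn i) ho (by rw [hby]; exact hny i) (hby i) (hne i _ (hbP i)).2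
        refine hcount (Sum.elim n fun b => if b then o₂ else o₁) ?_ ?_ ?_
        · rintro (i | b₁) (i' | b₁') - - hll
          · have hbb : b i = b i' := by
              by_contra hne
              exact hc.ne_of_adj (hn i) (hn i') (by rw [hby]; exact hny i)
                ((hby i).trans (hby i').symm) hne hll
            rw [hPinj i i' _ (hbP i) (hbb ▸ hbP i')]
          · exfalso
            cases b₁'
            · exact hno₁ i _ ho₁ hll
            · exact hno₁ i _ ho₂ hll
          · exfalso
            cases b₁
            · exact hno₁ i' _ ho₁ hll.symm
            · exact hno₁ i' _ ho₂ hll.symm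
          · cases b₁ <;> cases b₁'
            · rfl
            · exact absurd (congrArg copy hll) ho
            · exact absurd (congrArg copy hll.symm) ho
            · rfl
        · rintro (i | b₁)
          · exact hnD i
          · cases b₁
            · exact hydeg _ ho₁ ho₁'
            · exact hydeg _ ho₂ ho₂'
        · rintro (i | b₁) hl
          · exact ⟨_, b i, hl, (hn i).symm, hbP i⟩
          · refine ⟨.inr false, y, hYy, ?_, rfl⟩
            cases b₁
            · exact ho₁.symm
            · exact ho₂.symm
    · set X' := X.filter (copy · ≠ j) with hX'
      have two : ∀ v v' : V, v ≠ v' → v ∈ X' → v' ∈ X' → False := by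
        intro v v' hne hv hv'
        have := Finset.one_lt_card.2 ⟨v, hv, v', hv', hne⟩
        omega
      have one : ∀ v l, v ∈ X' → l ∈ Y → False := by
        intro v l hv hl
        have h1 := Finset.card_pos.2 ⟨v, hv⟩
        have h2 := Finset.card_pos.2 ⟨l, hl⟩
        omega
      rcases hB with hB | ⟨hzj, hB⟩
      · obtain ⟨v, h1, h2, h3⟩ := hc.exists_out y j
        have hvD := hydeg v h1 h2
        -- the copy of `v` has an edge to the copy of `x` that avoids `v`
        obtain ⟨c, d, hci, -, hcd⟩ := hc.cross (copy v) (hc.mem v) (copy x) (hc.mem x) (hy v h1)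
        obtain ⟨k, hk⟩ : ∃ k, c k ≠ v := by
          by_cases h0 : c 0 = v
          · exact ⟨1, fun e => by simpa using hci (h0.trans e.symm)⟩
          · exact ⟨0, h0⟩
        obtain ⟨h4, h5, h6⟩ := hcd k
        have hcut : v ∈ X' ∨ Sum.inr false ∈ Y := by
          by_contra hcon
          rw [not_or] at hcon
          exact hno v (.inr false) hcon.2
            (hB v hvD h3 fun hX => hcon.1 (Finset.mem_filter.2 ⟨hX, h3⟩)) y h1.symm rfl
        have hck : c k ∉ X := by
          intro hX
          have : c k ∈ X' := Finset.mem_filter.2 ⟨hX, h5 ▸ h3⟩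
          rcases hcut with h | h
          · exact two _ _ hk this h
          · exact one _ _ this h
        rcases hout _ _ (hB (c k) (h5 ▸ hvD) (h5 ▸ h3) hck) h4 with h7 | ⟨l, h7, h8⟩
        · exact h7.2 (by simp [h6])
        · rcases hcut with h | h
          · exact one _ _ h h7
          · have hl : l ≠ .inr false := by
              rintro rfl
              have h8 : d k = y := h8
              exact hxy (h6.symm.trans (congrArg copy h8))
            have := Finset.one_lt_card.2 ⟨_, h7, _, h, hl⟩
            omega
      · obtain ⟨o₁, o₂, h1, h2, h3, h4, h5, -⟩ := hc.out z
        have hsplit : ∀ o, G.Adj z o → copy o ≠ copy z →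
            o ∈ X' ∨ ((copy o = copy x ∨ copy o = copy y) ∧ ∃ l, l ∈ Y) := by
          intro o h6 h7
          rcases hout z o (.refl _) h6 with h8 | ⟨l, h8, -⟩
          · exact Or.inl (hB o h6 (hzj ▸ h7) h8)
          · by_cases h9 : copy o ∈ D
            · exact Or.inl (hB o h6 (hzj ▸ h7) h9)
            · exact Or.inr ⟨hDnot o h9, l, h8⟩
        rcases hsplit o₁ h1 h3 with h6 | ⟨h6, l, hl⟩ <;>
          rcases hsplit o₂ h2 h4 with h7 | ⟨h7, l', hl'⟩
        · exact two _ _ (fun e => h5 (congrArg copy e)) h6 h7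
        · exact one _ _ h6 hl'
        · exact one _ _ h7 hl
        · rcases h6 with h6 | h6 <;> rcases h7 with h7 | h7
          · exact h5 (h6.trans h7.symm)
          · exact hz _ _ h1 h2 h6 h7
          · exact hz _ _ h2 h1 h7 h6
          · exact h5 (h6.trans h7.symm))
  have hbij : Function.Bijective l := by
    rw [Fintype.bijective_iff_injective_and_card]
    exact ⟨hl, by simp [hcard]⟩
  let e := Equiv.ofBijective l hbij
  have hle : ∀ i, l (e.symm i) = i := fun i => e.apply_symm_apply i
  have hFS : ∀ k, Disjoint (F k) {x, y, z} := fun k => disjoint_triple (hF' k).1 (hF' k).2.1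
  have := hasConnectors_of_all_labels (G := G) (fun e => hxy (congrArg copy e))
    (fun e => hzx (congrArg copy e.symm)) (fun e => hzy (congrArg copy e.symm)) (P := P) (E := E)
    (F := fun i => F (e.symm i)) hL.avoid (fun _ => hFS _) hL.disjoint
    (fun i j hij => hF _ _ (e.symm.injective.ne hij)) (fun i k => hP.fan_disjoint (hF' _).1 i)
    hL.disjoint_edge hL.edge hL.link
    (by
      intro i
      obtain ⟨-, -, v, ⟨w, h1, h2⟩, h3, h4⟩ := hF' (e.symm (.inl i))
      rw [hle] at h2
      exact hL.through_of_land h2 (hFS _) ⟨v, h3, h1, h4⟩)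
    (by
      intro b
      obtain ⟨-, -, v, ⟨w, h1, h2⟩, h3, h4⟩ := hF' (e.symm (.inr b))
      rw [hle] at h2
      have h2 : w = side x y b := h2
      exact ⟨v, h3, h2 ▸ h1, h4⟩)
  rwa [hcard] at this

/-- A hanging set of `x` and a hanging set of `y` that are joined by an edge form a link. -/
theorem link_of_hangs {S C C' : Set V} {E : Set (Sym2 V)} (hx : x ∈ S)
    (hy : y ∈ S) (hC : G.Hangs x C) (hC' : G.Hangs y C') (hS : Disjoint (C ∪ C') S)
    {a b : V} (ha : a ∈ C) (hb : b ∈ C')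
    (hab : G.Adj a b) :
    (G.through S (C ∪ C') E).Reachable x y ∧
      ∀ w ∈ C ∪ C', (G.through S (C ∪ C') E).Reachable x w := by
  have h1 : ∀ w ∈ C, (G.through S (C ∪ C') E).Reachable x w := fun w hw => (hC w hw).mono
    (within_insert_le_through hx (hS.mono_left Set.subset_union_left) Set.subset_union_left)
  have h2 : ∀ w ∈ C', (G.through S (C ∪ C') E).Reachable y w := fun w hw => (hC' w hw).mono
    (within_insert_le_through hy (hS.mono_left Set.subset_union_right) Set.subset_union_right)
  have h3 : (G.through S (C ∪ C') E).Reachable a b := Adj.reachable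
    ⟨hab, Or.inl (Or.inl ha), Or.inl (Or.inr hb),
      fun h => absurd h (Set.disjoint_left.1 hS (Or.inl ha))⟩
  have hxy := ((h1 a ha).trans h3).trans (h2 b hb).symm
  refine ⟨hxy, ?_⟩
  rintro w (hw | hw)
  · exact h1 w hw
  · exact hxy.trans (h2 w hw)

/-- Of the edges between two copies, `h` avoid two given vertices `x` and `y`. -/
theorem CopyGraph.exists_cross_avoiding (hc : G.CopyGraph copy I h) (hxy : copy x ≠ copy y) :
    ∃ a b : Fin h → V, Function.Injective a ∧ Function.Injective b ∧
      ∀ k, G.Adj (a k) (b k) ∧ copy (a k) = copy x ∧ copy (b k) = copy y ∧ a k ≠ x ∧ b k ≠ y := by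
  classical
  obtain ⟨a, b, ha, hb, hab⟩ := hc.cross _ (hc.mem x) _ (hc.mem y) hxy
  have h1 : (Finset.univ.filter fun k => a k = x).card ≤ 1 :=
    Finset.card_le_one.2 fun k hk k' hk' => ha (by simp at hk hk'; rw [hk, hk'])
  have h2 : (Finset.univ.filter fun k => b k = y).card ≤ 1 :=
    Finset.card_le_one.2 fun k hk k' hk' => hb (by simp at hk hk'; rw [hk, hk'])
  have h3 := Finset.card_union_le (Finset.univ.filter fun k => a k = x)
    (Finset.univ.filter fun k => b k = y)
  rw [← Finset.filter_or] at h3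
  have h4 := Finset.card_filter_add_card_filter_not (s := Finset.univ)
    (fun k => a k = x ∨ b k = y)
  rw [Finset.card_univ, Fintype.card_fin] at h4
  have : Nonempty (Fin h ↪ {k // ¬ (a k = x ∨ b k = y)}) := by
    refine Function.Embedding.nonempty_of_card_le ?_
    rw [Fintype.card_subtype, Fintype.card_fin]
    omega
  obtain ⟨e⟩ := this
  refine ⟨fun k => a (e k), fun k => b (e k), fun k k' hk => e.injective (Subtype.ext (ha hk)),
    fun k k' hk => e.injective (Subtype.ext (hb hk)), fun k => ?_⟩
  have h5 := (e k).2
  rw [not_or] at h5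
  exact ⟨(hab _).1, (hab _).2.1, (hab _).2.2, h5.1, h5.2⟩

/-- The copies of `x` and `y`, without `x` and `y`, split into sets hanging from `x` and from `y`,
with a prescribed vertex in each of these sets. -/
theorem CopyGraph.exists_hanging_pair [Finite V] (hc : G.CopyGraph copy I h) (hh : 2 ≤ h)
    (hxy : copy x ≠ copy y) (hzx : copy z ≠ copy x) (hzy : copy z ≠ copy y) {a b : Fin h → V}
    (ha : Function.Injective a) (hb : Function.Injective b) (hax : ∀ i, copy (a i) = copy x)
    (hby : ∀ i, copy (b i) = copy y) (hax' : ∀ i, a i ≠ x) (hby' : ∀ i, b i ≠ y) :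
    ∃ C C' : Fin h → Set V, (∀ i j, i ≠ j → Disjoint (C i) (C j)) ∧
      (∀ i j, i ≠ j → Disjoint (C' i) (C' j)) ∧ (∀ i j, Disjoint (C i) (C' j)) ∧
      (∀ i, Disjoint (C i) {x, y, z}) ∧ (∀ i, Disjoint (C' i) {x, y, z}) ∧
      (∀ i, ∀ w ∈ C i, copy w = copy x) ∧ (∀ i, ∀ w ∈ C' i, copy w = copy y) ∧
      (∀ w, copy w = copy x → w ≠ x → ∃ i, w ∈ C i) ∧
      (∀ w, copy w = copy y → w ≠ y → ∃ i, w ∈ C' i) ∧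
      (∀ i, a i ∈ C i) ∧ (∀ i, b i ∈ C' i) ∧ (∀ i, G.Hangs x (C i)) ∧ ∀ i, G.Hangs y (C' i) := by
  obtain ⟨C, hC1, hC2, hC3, hC4, hC5⟩ := (hc.kconn _ (hc.mem x)).exists_hanging_partition hh
    (x := x) rfl a ha hax hax'
  obtain ⟨C', hC1', hC2', hC3', hC4', hC5'⟩ := (hc.kconn _ (hc.mem y)).exists_hanging_partition hh
    (x := y) rfl b hb hby hby'
  refine ⟨C, C', hC1, hC1', fun i j => ?_, fun i => ?_, fun i => ?_, fun i w hw => (hC2 i hw).1,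
    fun i w hw => (hC2' i hw).1, fun w h1 h2 => hC3 w ⟨h1, h2⟩, fun w h1 h2 => hC3' w ⟨h1, h2⟩,
    hC4, hC4', hC5, hC5'⟩ <;> rw [Set.disjoint_left]
  · exact fun w hw hw' => hxy ((hC2 i hw).1.symm.trans (hC2' j hw').1)
  · rintro w hw (rfl | rfl | rfl)
    · exact (hC2 i hw).2 rfl
    · exact hxy (hC2 i hw).1.symm
    · exact hzx (hC2 i hw).1
  · rintro w hw (rfl | rfl | rfl)
    · exact hxy (hC2' i hw).1
    · exact (hC2' i hw).2 rfl
    · exact hzy (hC2' i hw).1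

/-- The links are made from the edges between the copies of `x` and `y`. -/
theorem CopyGraph.hasConnectors_of_not_adj_copy [Finite V] (hc : G.CopyGraph copy I h)
    (hh : 2 ≤ h) (hxy : copy x ≠ copy y) (hzx : copy z ≠ copy x) (hzy : copy z ≠ copy y)
    (hy : ∀ w, G.Adj y w → copy w ≠ copy x)
    (hz : ∀ w w', G.Adj z w → G.Adj z w' → copy w = copy x → copy w' ≠ copy y) :
    G.HasConnectors {x, y, z} (h + 1) := by
  obtain ⟨a, b, ha, hb, hab⟩ := hc.exists_cross_avoiding (x := x) (y := y) hxy
  obtain ⟨C, C', hC, hC', hCC, hS, hS', hCx, hCy, hCov, hCov', haC, hbC, hH, hH'⟩ :=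
    hc.exists_hanging_pair hh hxy hzx hzy ha hb (fun k => (hab k).2.1) (fun k => (hab k).2.2.1)
      (fun k => (hab k).2.2.2.1) (fun k => (hab k).2.2.2.2)
  have hSS : ∀ i, Disjoint (C i ∪ C' i) {x, y, z} :=
    fun i => Set.disjoint_union_left.2 ⟨hS i, hS' i⟩
  have hdisj : ∀ i j, i ≠ j → Disjoint (C i ∪ C' i) (C j ∪ C' j) := by
    intro i j hij
    rw [Set.disjoint_union_left, Set.disjoint_union_right, Set.disjoint_union_right]
    exact ⟨⟨hC i j hij, hCC i j⟩, (hCC j i).symm, hC' i j hij⟩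
  have hlink := fun i => link_of_hangs (S := {x, y, z}) (E := ∅) (by simp) (by simp) (hH i) (hH' i)
    (hSS i) (haC i) (hbC i) (hab i).1
  refine hc.hasConnectors_of_links hh hxy hzx hzy (P := fun i => C i ∪ C' i) (E := fun _ => ∅)
    ⟨hSS, hdisj, fun _ _ _ => Set.disjoint_empty _, fun _ => Set.empty_subset _,
      fun i => (hlink i).1, fun i => (hlink i).2⟩ ⟨?_, ?_⟩ (by simp) (a := a) (b := b)
    (fun i => Or.inl (haC i)) (fun i => Or.inr (hbC i)) (fun i => (hab i).2.1)
    (fun i => (hab i).2.2.1) hy hz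
  · rintro i w (hw | hw)
    · exact Or.inl (hCx i w hw)
    · exact Or.inr (hCy i w hw)
  · rintro w (hw | hw)
    · by_cases hwx : w = x
      · exact ⟨.inr true, hwx⟩
      · obtain ⟨i, hi⟩ := hCov w hw hwx
        exact ⟨.inl i, Or.inl hi⟩
    · by_cases hwy : w = y
      · exact ⟨.inr false, hwy⟩
      · obtain ⟨i, hi⟩ := hCov' w hw hwy
        exact ⟨.inl i, Or.inr hi⟩

/-- If `x` and `y` are adjacent, then the edge `xy` is an additional link. -/
theorem CopyGraph.hasConnectors_of_adj_of_ne [Finite V] (hc : G.CopyGraph copy I h)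
    (hh : 2 ≤ h) (hzx : copy z ≠ copy x) (hzy : copy z ≠ copy y)
    (hxy : G.Adj x y) (hcxy : copy x ≠ copy y) :
    G.HasConnectors {x, y, z} (h + 1) := by
  obtain ⟨a, b, ha, hb, hab⟩ := hc.exists_cross_avoiding (x := x) (y := y) hcxy
  obtain ⟨C, C', hC, hC', hCC, hS, hS', hCx, hCy, hCov, hCov', haC, hbC, hH, hH'⟩ :=
    hc.exists_hanging_pair hh hcxy hzx hzy ha hb (fun k => (hab k).2.1) (fun k => (hab k).2.2.1)
      (fun k => (hab k).2.2.2.1) (fun k => (hab k).2.2.2.2)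
  have hSS : ∀ i, Disjoint (C i ∪ C' i) {x, y, z} :=
    fun i => Set.disjoint_union_left.2 ⟨hS i, hS' i⟩
  have hdisj : ∀ i j, i ≠ j → Disjoint (C i ∪ C' i) (C j ∪ C' j) := by
    intro i j hij
    rw [Set.disjoint_union_left, Set.disjoint_union_right, Set.disjoint_union_right]
    exact ⟨⟨hC i j hij, hCC i j⟩, (hCC j i).symm, hC' i j hij⟩
  have hlink := fun i => link_of_hangs (S := {x, y, z}) (E := ∅) (by simp) (by simp) (hH i) (hH' i)
    (hSS i) (haC i) (hbC i) (hab i).1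
  refine hc.hasConnectors_of_wild hh hcxy hzx hzy
    (P := fun o : Option (Fin h) => o.elim ∅ fun i => C i ∪ C' i)
    (E := fun o => o.elim {s(x, y)} fun _ => ∅)
    ⟨?_, ?_, ?_, ?_, ?_, ?_⟩ ⟨?_, ?_⟩ (by simp)
    (lab := Fin.cons (.inr true) fun i => .inl (some i)) ?_ (u := Fin.cons x a) ?_ ?_ ?_
  · rintro (_ | i)
    · exact Set.empty_disjoint _
    · exact hSS i
  · rintro (_ | i) (_ | j) hij
    · exact absurd rfl hij
    · exact Set.empty_disjoint _
    · exact Set.disjoint_empty _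
    · exact hdisj i j fun e => hij (e ▸ rfl)
  · rintro (_ | i) (_ | j) hij
    · exact absurd rfl hij
    · exact Set.disjoint_empty _
    · exact Set.empty_disjoint _
    · exact Set.disjoint_empty _
  · rintro (_ | i)
    · exact subset_rfl
    · exact Set.empty_subset _
  · rintro (_ | i)
    · exact Adj.reachable ⟨hxy, Or.inr (by simp), Or.inr (by simp), fun _ _ => rfl⟩
    · exact (hlink i).1
  · rintro (_ | i) w hw
    · exact hw.elim
    · exact (hlink i).2 w hw
  · rintro (_ | i) w hw
    · exact hw.elim
    · rcases hw with hw | hw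
      · exact Or.inl (hCx i w hw)
      · exact Or.inr (hCy i w hw)
  · rintro w (hw | hw)
    · by_cases hwx : w = x
      · exact ⟨.inr true, hwx⟩
      · obtain ⟨i, hi⟩ := hCov w hw hwx
        exact ⟨.inl (some i), Or.inl hi⟩
    · by_cases hwy : w = y
      · exact ⟨.inr false, hwy⟩
      · obtain ⟨i, hi⟩ := hCov' w hw hwy
        exact ⟨.inl (some i), Or.inr hi⟩
  · rw [Fin.cons_injective_iff]
    exact ⟨by simp, fun i j hij => by simpa using hij⟩
  · rw [Fin.cons_injective_iff]
    exact ⟨fun ⟨k, hk⟩ => (hab k).2.2.2.1 hk, ha⟩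
  · intro k
    cases k using Fin.cases with
    | zero => rfl
    | succ k => exact (hab k).2.1
  · intro k
    cases k using Fin.cases with
    | zero => rfl
    | succ k => exact Or.inl (haC k)

/-- If `x` has a neighbour in the copy of `y`, and `y` has one in the copy of `x`, then each of
the two copies contains a link of its own, so that there are `h + 1` links. -/
theorem CopyGraph.hasConnectors_of_mutual [Finite V] (hc : G.CopyGraph copy I h)
    (hh : 2 ≤ h) (hcxy : copy x ≠ copy y) (hzx : copy z ≠ copy x) (hzy : copy z ≠ copy y)
    {x' y' : V} (hx' : G.Adj x x') (hy' : G.Adj y y') (hcx : copy x' = copy y)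
    (hcy : copy y' = copy x) : G.HasConnectors {x, y, z} (h + 1) := by
  by_cases hxy : G.Adj x y
  · exact hc.hasConnectors_of_adj_of_ne hh hzx hzy hxy hcxy
  have hx'y : x' ≠ y := fun e => hxy (e ▸ hx')
  have hy'x : y' ≠ x := fun e => hxy (e ▸ hy'.symm)
  obtain ⟨t, rfl⟩ : ∃ t, h = t + 1 := ⟨h - 1, by omega⟩
  obtain ⟨a, b, ha, hb, hab⟩ := hc.exists_cross_avoiding (x := x) (y := y) hcxy
  have hay' : ∀ k, a k ≠ y' := by
    intro k hk
    refine (hab k).2.2.2.2 (hc.eq_of_adj (hk ▸ (hab k).1) hy'.symm ?_ (hab k).2.2.1)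
    rw [(hab k).2.2.1, hcy]
    exact hcxy.symm
  have hbx' : ∀ k, b k ≠ x' := by
    intro k hk
    refine (hab k).2.2.2.1 (hc.eq_of_adj (hk ▸ (hab k).1.symm) hx'.symm ?_ (hab k).2.1)
    rw [(hab k).2.1, hcx]
    exact hcxy
  obtain ⟨C, C', hC, hC', hCC, hS, hS', hCx, hCy, hCov, hCov', haC, hbC, hH, hH'⟩ :=
    hc.exists_hanging_pair hh hcxy hzx hzy (a := Fin.cons y' (Fin.tail a))
      (b := Fin.cons x' (Fin.tail b))
      (Fin.cons_injective_iff.2 ⟨fun ⟨k, hk⟩ => hay' _ hk, ha.comp (Fin.succ_injective t)⟩)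
      (Fin.cons_injective_iff.2 ⟨fun ⟨k, hk⟩ => hbx' _ hk, hb.comp (Fin.succ_injective t)⟩)
      (Fin.cases hcy fun k => (hab k.succ).2.1) (Fin.cases hcx fun k => (hab k.succ).2.2.1)
      (Fin.cases hy'x fun k => (hab k.succ).2.2.2.1) (Fin.cases hx'y fun k => (hab k.succ).2.2.2.2)
  have hSS : ∀ i, Disjoint (C i ∪ C' i) {x, y, z} :=
    fun i => Set.disjoint_union_left.2 ⟨hS i, hS' i⟩
  have hlink := fun k : Fin t => link_of_hangs (S := {x, y, z}) (E := ∅) (by simp) (by simp)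
    (hH k.succ) (hH' k.succ) (hSS k.succ) (haC k.succ) (hbC k.succ) (hab k.succ).1
  have hlink₁ : ∀ w ∈ C 0, (G.through {x, y, z} (C 0) ∅).Reachable x w := fun w hw =>
    (hH 0 w hw).mono (within_insert_le_through (by simp) (hS 0) subset_rfl)
  have hlink₂ : ∀ w ∈ C' 0, (G.through {x, y, z} (C' 0) ∅).Reachable y w := fun w hw =>
    (hH' 0 w hw).mono (within_insert_le_through (by simp) (hS' 0) subset_rfl)
  have hy'C : y' ∈ C 0 := haC 0
  have hx'C : x' ∈ C' 0 := hbC 0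
  have hlink₃ : (G.through {x, y, z} (C 0) ∅).Reachable x y := (hlink₁ y' hy'C).trans
    (Adj.reachable ⟨hy'.symm, Or.inl hy'C, Or.inr (by simp),
      fun h => absurd h (Set.disjoint_left.1 (hS 0) hy'C)⟩)
  have hlink₄ : (G.through {x, y, z} (C' 0) ∅).Reachable x y := ((hlink₂ x' hx'C).trans
    (Adj.reachable ⟨hx'.symm, Or.inl hx'C, Or.inr (by simp),
      fun h => absurd h (Set.disjoint_left.1 (hS' 0) hx'C)⟩)).symm
  have hall : ∀ {p : Option (Fin (t + 1)) → Prop}, p none → p (some 0) →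
      (∀ k : Fin t, p (some k.succ)) → ∀ o, p o := by
    rintro p h1 h2 h3 (_ | k)
    · exact h1
    · exact Fin.cases h2 h3 k
  -- `x` reaches `y` through the copy of `x` and `y'`, or through `x'` and the copy of `y`
  let P : Option (Fin (t + 1)) → Set V :=
    fun o => o.elim (C 0) (Fin.cons (C' 0) fun k => C k.succ ∪ C' k.succ)
  have hPC : ∀ o, (∃ i, P o ⊆ C i ∪ C' i) :=
    hall ⟨0, Set.subset_union_left⟩ ⟨0, Set.subset_union_right⟩ fun k => ⟨k.succ, subset_rfl⟩
  have hCU : ∀ i j, i ≠ j → Disjoint (C i ∪ C' i) (C j ∪ C' j) := by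
    intro i j hij
    rw [Set.disjoint_union_left, Set.disjoint_union_right, Set.disjoint_union_right]
    exact ⟨⟨hC i j hij, hCC i j⟩, (hCC j i).symm, hC' i j hij⟩
  have hs0 : ∀ k : Fin t, (0 : Fin (t + 1)) ≠ k.succ := fun k => (Fin.succ_ne_zero k).symm
  refine hc.hasConnectors_of_wild hh hcxy hzx hzy (P := P) (E := fun _ => ∅)
    ⟨?_, ?_, fun _ _ _ => Set.disjoint_empty _, fun _ => Set.empty_subset _, ?_, ?_⟩ ⟨?_, ?_⟩
    (by simp) (lab := Fin.cons (.inr true) (Fin.cons (.inl none) fun i => .inl (some i.succ))) ?_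
    (u := Fin.cons x (Fin.cons y' (Fin.tail a))) ?_ ?_ ?_
  · exact hall (hS 0) (hS' 0) fun k => hSS k.succ
  · refine hall (hall (fun h => absurd rfl h) (fun _ => hCC 0 0) fun k _ => ?_)
      (hall (fun _ => (hCC 0 0).symm) (fun h => absurd rfl h) fun k _ => ?_)
      fun k => hall (fun _ => ?_) (fun _ => ?_) fun k' hk => hCU _ _ fun e => hk (by rw [e])
    · exact (hCU _ _ (hs0 k)).mono_left Set.subset_union_left
    · exact (hCU _ _ (hs0 k)).mono_left Set.subset_union_right
    · exact (hCU _ _ (hs0 k).symm).mono_right Set.subset_union_left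
    · exact (hCU _ _ (hs0 k).symm).mono_right Set.subset_union_right
  · exact hall hlink₃ hlink₄ fun k => (hlink k).1
  · exact hall hlink₁ (fun w hw => hlink₄.trans (hlink₂ w hw)) fun k => (hlink k).2
  · intro o w hw
    obtain ⟨i, hi⟩ := hPC o
    rcases hi hw with hw | hw
    · exact Or.inl (hCx i w hw)
    · exact Or.inr (hCy i w hw)
  · rintro w (hw | hw)
    · by_cases hwx : w = x
      · exact ⟨.inr true, hwx⟩
      · obtain ⟨i, hi⟩ := hCov w hw hwx
        cases i using Fin.cases with
        | zero => exact ⟨.inl none, hi⟩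
        | succ k => exact ⟨.inl (some k.succ), Or.inl hi⟩
    · by_cases hwy : w = y
      · exact ⟨.inr false, hwy⟩
      · obtain ⟨i, hi⟩ := hCov' w hw hwy
        cases i using Fin.cases with
        | zero => exact ⟨.inl (some 0), hi⟩
        | succ k => exact ⟨.inl (some k.succ), Or.inr hi⟩
  · rw [Fin.cons_injective_iff, Fin.cons_injective_iff]
    refine ⟨?_, by simp, fun i j hij => by simpa using hij⟩
    rintro ⟨k, hk⟩
    cases k using Fin.cases <;> simp at hk
  · rw [Fin.cons_injective_iff, Fin.cons_injective_iff]
    refine ⟨?_, fun ⟨k, hk⟩ => hay' _ hk, ha.comp (Fin.succ_injective t)⟩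
    rintro ⟨k, hk⟩
    cases k using Fin.cases with
    | zero => exact hy'x hk
    | succ k => exact (hab k.succ).2.2.2.1 hk
  · exact Fin.cases rfl (Fin.cases hcy fun k => (hab k.succ).2.1)
  · exact Fin.cases rfl (Fin.cases hy'C fun k => Or.inl (haC k.succ))

/-- Three vertices in different copies: if two of them have neighbours in the copies of each
other, these two are linked first; otherwise some two of them can be named `x` and `y` such that
`y` has no neighbour in the copy of `x` and the third vertex has no neighbour in one of the two
copies. -/
theorem CopyGraph.hasConnectors_one_one_one [Finite V] (hc : G.CopyGraph copy I h) (hh : 2 ≤ h)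
    (hxy : copy x ≠ copy y) (hxz : copy x ≠ copy z) (hyz : copy y ≠ copy z) :
    G.HasConnectors {x, y, z} (h + 1) := by
  let r : V → V → Prop := fun u v => ∃ w, G.Adj u w ∧ copy w = copy v
  have e1 : ({x, z, y} : Set V) = {x, y, z} := by
    rw [Set.pair_comm]
  have e2 : ({y, z, x} : Set V) = {x, y, z} := by
    rw [Set.pair_comm z x, Set.insert_comm]
  have e3 : ({y, x, z} : Set V) = {x, y, z} := Set.insert_comm _ _ _
  have e4 : ({z, x, y} : Set V) = {x, y, z} := by rw [Set.insert_comm, e1]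
  have e5 : ({z, y, x} : Set V) = {x, y, z} := by rw [Set.pair_comm, e4]
  have both : ∀ u v w : V, copy u ≠ copy v → copy w ≠ copy u → copy w ≠ copy v → r u v → r v u →
      G.HasConnectors {u, v, w} (h + 1) := by
    rintro u v w h1 h2 h3 ⟨u', hu, hu'⟩ ⟨v', hv, hv'⟩
    exact hc.hasConnectors_of_mutual hh h1 h2 h3 hu hv hu' hv'
  have arrow : ∀ u v w : V, copy u ≠ copy v → copy w ≠ copy u → copy w ≠ copy v → ¬ r v u →
      ¬ (r w u ∧ r w v) → G.HasConnectors {u, v, w} (h + 1) := by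
    intro u v w h1 h2 h3 h4 h5
    exact hc.hasConnectors_of_not_adj_copy hh h1 h2 h3 (fun o ho ho' => h4 ⟨o, ho, ho'⟩)
      fun o o' ho ho' h6 h7 => h5 ⟨⟨o, ho, h6⟩, o', ho', h7⟩
  by_cases h1 : r x y ∧ r y x
  · exact both x y z hxy hxz.symm hyz.symm h1.1 h1.2
  by_cases h2 : r x z ∧ r z x
  · exact e1 ▸ both x z y hxz hxy.symm hyz h2.1 h2.2
  by_cases h3 : r y z ∧ r z y
  · exact e2 ▸ both y z x hyz hxy hxz h3.1 h3.2
  by_cases h4 : r z x ∧ r z y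
  · -- then `y` has no neighbour in the copy of `z`
    have h5 : ¬ r y z := fun h => h3 ⟨h, h4.2⟩
    have h6 : ¬ r x z := fun h => h2 ⟨h, h4.1⟩
    exact e5 ▸ arrow z y x hyz.symm hxz hxy h5 fun h => h6 h.1
  · by_cases h5 : r y x
    · exact e3 ▸ arrow y x z hxy.symm hyz.symm hxz.symm (fun h => h1 ⟨h, h5⟩) fun h => h4 h.symm
    · exact arrow x y z hxy hxz.symm hyz.symm h5 h4

end Links

/-! ### Three vertices in the same copy -/

/-- Any two vertices of `A` are joined by a walk inside `A`. -/
def JoinedIn (G : SimpleGraph V) (A : Set V) : Prop :=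
  ∀ u ∈ A, ∀ v ∈ A, (G.within A).Reachable u v

theorem joinedIn_of_center {A : Set V} {c : V} (h : ∀ v ∈ A, (G.within A).Reachable c v) :
    G.JoinedIn A := fun u hu v hv => (h u hu).symm.trans (h v hv)

theorem JoinedIn.union {A B : Set V} (hA : G.JoinedIn A) (hB : G.JoinedIn B) {a b : V}
    (ha : a ∈ A) (hb : b ∈ B) (hab : G.Adj a b) : G.JoinedIn (A ∪ B) := by
  refine joinedIn_of_center (c := a) ?_
  rintro v (hv | hv)
  · exact (hA a ha v hv).mono (within_mono Set.subset_union_left)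
  · exact (hab.reachable_within (Or.inl ha) (Or.inr hb)).trans
      ((hB b hb v hv).mono (within_mono Set.subset_union_right))

theorem KConn.joinedIn {M : Set V} {h : ℕ} (hM : G.KConn M h) {X : Finset V} (hX : X.card < h) :
    G.JoinedIn (M \ X) := hM.2 X hX

/-- If `M` is `4`-connected and covered by two sets `T` and `U`, each with at least four elements in
`M`, then `x` and `y` lie in disjoint connected subsets of `M`, the first of which meets `T` and
the second `U`. -/
theorem KConn.exists_disjoint_joinedIn {M : Set V} {h : ℕ} (hM : G.KConn M h) (hh : 4 ≤ h)
    {T U : Set V} (hTU : ∀ v ∈ M, v ∈ T ∨ v ∈ U)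
    (hT : ∀ X : Finset V, X.card ≤ 3 → ∃ v ∈ M, v ∈ T ∧ v ∉ X)
    (hU : ∀ X : Finset V, X.card ≤ 3 → ∃ v ∈ M, v ∈ U ∧ v ∉ X) {x y : V} (hx : x ∈ M)
    (hy : y ∈ M) (hxy : x ≠ y) :
    ∃ R K : Set V, Disjoint R K ∧ R ⊆ M ∧ K ⊆ M ∧ x ∈ R ∧ y ∈ K ∧ G.JoinedIn R ∧ G.JoinedIn K ∧
      (∃ v ∈ R, v ∈ T) ∧ ∃ v ∈ K, v ∈ U := by
  classical
  by_cases hxT : x ∈ T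
  · obtain ⟨v, hvM, hvU, hvx⟩ := hU {x} (by simp)
    refine ⟨{x}, M \ ({x} : Finset V), ?_, by simpa using hx, Set.sdiff_subset, rfl,
      ⟨hy, by simpa using hxy.symm⟩, joinedIn_of_center (c := x) ?_, hM.joinedIn (by simp; omega),
      ⟨x, rfl, hxT⟩, v, ⟨hvM, by simpa using hvx⟩, hvU⟩
    · simp
    · rintro v rfl
      exact .refl _
  by_cases hyU : ∃ w ∈ M, w ∈ U ∧ w ≠ x ∧ (w = y ∨ G.Adj y w)
  · obtain ⟨w, hwM, hwU, hwx, hwy⟩ := hyU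
    have hcard := Finset.card_le_two (a := y) (b := w)
    obtain ⟨v, hvM, hvT, hvx⟩ := hT {y, w} (by omega)
    refine ⟨M \ ({y, w} : Finset V), {y, w}, ?_, Set.sdiff_subset, ?_,
      ⟨hx, by simpa using ⟨hxy, hwx.symm⟩⟩, by simp, hM.joinedIn (by omega),
      joinedIn_of_center (c := y) ?_, ⟨v, ⟨hvM, by simpa using hvx⟩, hvT⟩, w, by simp, hwU⟩
    · simp
    · rintro v (rfl | rfl)
      · exact hy
      · exact hwM
    · rintro v (rfl | rfl)
      · rfl
      · rcases hwy with rfl | hwy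
        · rfl
        · exact hwy.reachable_within (by simp) (by simp)
  push Not at hyU
  have hyT : y ∈ T := (hTU y hy).resolve_right fun h => (hyU y hy h hxy.symm).1 rfl
  -- vertices of `M` outside `T` that are not adjacent to `T`, apart from `y`
  set D : Set V := {v | v ∈ M ∧ v ∉ T ∧ ∀ w ∈ M, w ∈ T → w ≠ y → ¬ G.Adj v w} with hD
  set C : Set V := {w | w ∈ D ∧ (G.within (insert x D)).Reachable x w} with hC
  have hCx : G.Hangs x C := hangs_component G x D
  have hQ : ∀ q ∈ insert x C, q ∈ M ∧ q ∉ T ∧ (G.within (insert x D)).Reachable x q ∧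
      (G.within (insert x C)).Reachable x q ∧ q ∈ insert x D := by
    rintro q (rfl | hq)
    · exact ⟨hx, hxT, .refl _, .refl _, Or.inl rfl⟩
    · exact ⟨hq.1.1, hq.1.2.1, hq.2, hCx q hq, Or.inr hq.1⟩
  obtain ⟨a, b, haM, haT, hbM, hbT, hby, hab, haQ⟩ : ∃ a b, a ∈ M ∧ a ∉ T ∧ b ∈ M ∧ b ∈ T ∧ b ≠ y ∧
      G.Adj a b ∧ (a ∈ insert x C ∨ ∃ q ∈ insert x C, G.Adj q a) := by
    by_contra hno
    push Not at hno
    obtain ⟨t, htM, htT, hty⟩ := hT {y} (by simp)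
    have := (hM.joinedIn (X := {y}) (by simp; omega) x ⟨hx, by simpa using hxy⟩ t
      ⟨htM, by simpa using hty⟩).mem_of_closed (C := insert x C) (Or.inl rfl) (by
        rintro q w hq hqw
        obtain ⟨h1, h2, h3, -, h5⟩ := hQ q hq
        have hwM : w ∈ M := hqw.2.2.1
        have hwy : w ≠ y := by simpa using hqw.2.2.2
        by_cases hwT : w ∈ T
        · exact absurd hq (hno q w h1 h2 hwM hwT hwy hqw.1).1
        · have hwD : w ∈ D := by
            refine ⟨hwM, hwT, fun b hb hbT hby hwb => ?_⟩
            exact (hno w b hwM hwT hb hbT hby hwb).2 q hq hqw.1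
          exact Or.inr ⟨hwD, h3.trans (hqw.1.reachable_within h5 (Or.inr hwD))⟩)
    exact (hQ t this).2.1 htT
  set R : Set V := insert x C ∪ {a, b} with hR
  have hyR : y ∉ R := by
    rintro (h | rfl | h)
    · exact (hQ y h).2.1 hyT
    · exact haT hyT
    · exact hby h.symm
  have hRM : R ⊆ M := by
    rintro v (h | rfl | rfl)
    · exact (hQ v h).1
    · exact haM
    · exact hbM
  set K : Set V := {w | w ∈ M \ R ∧ (G.within (insert y (M \ R))).Reachable y w} with hK
  have hyK : y ∈ K := ⟨⟨hy, hyR⟩, .refl _⟩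
  have hKj : ∀ v ∈ K, (G.within K).Reachable y v := by
    have := hangs_component G y (M \ R)
    rw [← hK] at this
    intro v hv
    simpa [Set.insert_eq_of_mem hyK] using this v hv
  refine ⟨R, K, ?_, hRM, fun v hv => hv.1.1, Or.inl (Or.inl rfl), hyK,
    joinedIn_of_center (c := x) ?_, joinedIn_of_center hKj, ⟨b, by simp [hR], hbT⟩, ?_⟩
  · rw [Set.disjoint_right]
    exact fun v hv => hv.1.2
  · have hq : ∀ q ∈ insert x C, (G.within R).Reachable x q := fun q hq =>
      (hQ q hq).2.2.2.1.mono (within_mono Set.subset_union_left)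
    have ha : (G.within R).Reachable x a := by
      rcases haQ with h | ⟨q, h, hqa⟩
      · exact hq a h
      · exact (hq q h).trans (hqa.reachable_within (Or.inl h) (by simp [hR]))
    rintro v (h | rfl | rfl)
    · exact hq v h
    · exact ha
    · exact ha.trans (hab.reachable_within (by simp [hR]) (by simp [hR]))
  · -- otherwise `a`, `b` and `x` separate `y` from a vertex of `U`
    by_contra hno
    push Not at hno
    have hcard := Finset.card_le_three (a := a) (b := b) (c := x)
    obtain ⟨u, huM, huU, hu⟩ := hU {a, b, x} hcard
    have hyX : y ∉ ({a, b, x} : Finset V) := by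
      simp only [Finset.mem_insert, Finset.mem_singleton, not_or]
      exact ⟨fun e => haT (e ▸ hyT), hby.symm, hxy.symm⟩
    have := (hM.joinedIn (X := {a, b, x}) (by omega) y ⟨hy, hyX⟩ u ⟨huM, hu⟩).mem_of_closed
      (C := K) hyK (by
        intro v w hv hvw
        have hwX : w ∉ ({a, b, x} : Finset V) := hvw.2.2.2
        simp only [Finset.mem_insert, Finset.mem_singleton, not_or] at hwX
        have hwM : w ∈ M := hvw.2.2.1
        by_cases hwR : w ∈ R
        · exfalso
          rcases hwR with (h | h) | h | h
          · exact hwX.2.2 h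
          · by_cases hvy : v = y
            · exact (hyU w hwM ((hTU w hwM).resolve_left h.1.2.1) hwX.2.2).2 (hvy ▸ hvw.1)
            · exact h.1.2.2 v hv.1.1 ((hTU v hv.1.1).resolve_right (hno v hv)) hvy hvw.1.symm
          · exact hwX.1 h
          · exact hwX.2.1 h
        · exact ⟨⟨hwM, hwR⟩, hv.2.trans (hvw.1.reachable_within (Or.inr hv.1)
            (Or.inr ⟨hwM, hwR⟩))⟩)
    exact hno u this huU

/-- Three pairs can be split by a common set, unless they form a triangle. -/
theorem exists_split_or_triangle {p₁ p₂ q₁ q₂ s₁ s₂ : ℕ} (hp : p₁ ≠ p₂) (hq : q₁ ≠ q₂)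
    (hs : s₁ ≠ s₂) : (∃ J : Set ℕ, (p₁ ∈ J ↔ p₂ ∉ J) ∧ (q₁ ∈ J ↔ q₂ ∉ J) ∧ (s₁ ∈ J ↔ s₂ ∉ J)) ∨
    ∃ i j k, i ≠ j ∧ i ≠ k ∧ j ≠ k ∧ (p₁ = i ∧ p₂ = j ∨ p₁ = j ∧ p₂ = i) ∧
      (q₁ = j ∧ q₂ = k ∨ q₁ = k ∧ q₂ = j) ∧ (s₁ = i ∧ s₂ = k ∨ s₁ = k ∧ s₂ = i) := by
  by_contra hno
  rw [not_or] at hno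
  obtain ⟨h1, h2⟩ := hno
  have hJ : ∀ u v w : ℕ, ¬ ((p₁ ∈ ({u, v, w} : Set ℕ) ↔ p₂ ∉ ({u, v, w} : Set ℕ)) ∧
      (q₁ ∈ ({u, v, w} : Set ℕ) ↔ q₂ ∉ ({u, v, w} : Set ℕ)) ∧
      (s₁ ∈ ({u, v, w} : Set ℕ) ↔ s₂ ∉ ({u, v, w} : Set ℕ))) := fun u v w h => h1 ⟨_, h⟩
  simp only [Set.mem_insert_iff, Set.mem_singleton_iff] at hJ
  have a1 := hJ p₁ q₁ s₁
  have a2 := hJ p₁ q₁ s₂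
  have a3 := hJ p₁ q₂ s₁
  have a4 := hJ p₁ q₂ s₂
  have b1 := fun h => h2 ⟨p₁, p₂, q₁, h⟩
  have b2 := fun h => h2 ⟨p₁, p₂, q₂, h⟩
  have b3 := fun h => h2 ⟨p₂, p₁, q₁, h⟩
  have b4 := fun h => h2 ⟨p₂, p₁, q₂, h⟩
  clear h1 h2 hJ
  grind (splits := 40)

/-- Outside the copy of `x`, `y` and `z` there are two disjoint connected sets, each of which
contains neighbours of all three vertices. -/
theorem CopyGraph.exists_outer_pair {copy : V → ℕ} {I : Set ℕ} {h : ℕ}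
    (hc : G.CopyGraph copy I h) (hh : 4 ≤ h) {x y z : V} (hxy : x ≠ y) (hcxy : copy y = copy x)
    (hcxz : copy z = copy x) :
    ∃ A B : Set V, Disjoint A B ∧ (∀ v ∈ A, copy v ≠ copy x) ∧ (∀ v ∈ B, copy v ≠ copy x) ∧
      G.JoinedIn A ∧ G.JoinedIn B ∧ (∀ u ∈ ({x, y, z} : Set V), ∃ v ∈ A, G.Adj u v) ∧
      ∀ u ∈ ({x, y, z} : Set V), ∃ v ∈ B, G.Adj u v := by
  classical
  have hunion : ∀ J : Set ℕ, G.JoinedIn {w | copy w ∈ I ∩ J} := by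
    intro J u hu v hv
    have := hc.joined (D := I ∩ J) Set.inter_subset_left (X := ∅) (by simp; omega) (by simp)
      hu hv (by simp) (by simp)
    simpa using this
  obtain ⟨p₁, p₂, hp₁, hp₂, hp₁', hp₂', hp, hpall⟩ := hc.out x
  obtain ⟨q₁, q₂, hq₁, hq₂, hq₁', hq₂', hq, hqall⟩ := hc.out y
  obtain ⟨s₁, s₂, hs₁, hs₂, hs₁', hs₂', hs, hsall⟩ := hc.out z
  rw [hcxy] at hq₁' hq₂'
  rw [hcxz] at hs₁' hs₂'
  rcases exists_split_or_triangle hp hq hs with ⟨J, hJp, hJq, hJs⟩ |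
    ⟨i, j, k, hij, hik, hjk, hpt, hqt, hst⟩
  · have key : ∀ J' : Set ℕ, (copy p₁ ∈ J' ∨ copy p₂ ∈ J') → (copy q₁ ∈ J' ∨ copy q₂ ∈ J') →
        (copy s₁ ∈ J' ∨ copy s₂ ∈ J') → ∀ u ∈ ({x, y, z} : Set V),
        ∃ v ∈ {w | copy w ∈ I ∩ (J' \ {copy x})}, G.Adj u v := by
      rintro J' h1 h2 h3 u (rfl | rfl | rfl)
      · rcases h1 with h1 | h1
        · exact ⟨p₁, ⟨hc.mem _, h1, hp₁'⟩, hp₁⟩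
        · exact ⟨p₂, ⟨hc.mem _, h1, hp₂'⟩, hp₂⟩
      · rcases h2 with h1 | h1
        · exact ⟨q₁, ⟨hc.mem _, h1, hq₁'⟩, hq₁⟩
        · exact ⟨q₂, ⟨hc.mem _, h1, hq₂'⟩, hq₂⟩
      · rcases h3 with h1 | h1
        · exact ⟨s₁, ⟨hc.mem _, h1, hs₁'⟩, hs₁⟩
        · exact ⟨s₂, ⟨hc.mem _, h1, hs₂'⟩, hs₂⟩
    refine ⟨_, _, ?_, fun v hv => hv.2.2, fun v hv => hv.2.2, hunion (J \ {copy x}),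
      hunion (Jᶜ \ {copy x}), key J ?_ ?_ ?_, key Jᶜ ?_ ?_ ?_⟩
    · rw [Set.disjoint_left]
      exact fun v hv hv' => hv'.2.1 hv.2.1
    · tauto
    · tauto
    · tauto
    · rw [Set.mem_compl_iff, Set.mem_compl_iff]; tauto
    · rw [Set.mem_compl_iff, Set.mem_compl_iff]; tauto
    · rw [Set.mem_compl_iff, Set.mem_compl_iff]; tauto
  · obtain ⟨xi, xj, hxi, hxj, hi, hj⟩ : ∃ xi xj, G.Adj x xi ∧ G.Adj x xj ∧ copy xi = i ∧
        copy xj = j := by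
      rcases hpt with ⟨h1, h2⟩ | ⟨h1, h2⟩
      · exact ⟨_, _, hp₁, hp₂, h1, h2⟩
      · exact ⟨_, _, hp₂, hp₁, h2, h1⟩
    obtain ⟨yj, yk, hyj, hyk, hj', hk⟩ : ∃ yj yk, G.Adj y yj ∧ G.Adj y yk ∧ copy yj = j ∧
        copy yk = k := by
      rcases hqt with ⟨h1, h2⟩ | ⟨h1, h2⟩
      · exact ⟨_, _, hq₁, hq₂, h1, h2⟩
      · exact ⟨_, _, hq₂, hq₁, h2, h1⟩
    obtain ⟨zi, zk, hzi, hzk, hi', hk'⟩ : ∃ zi zk, G.Adj z zi ∧ G.Adj z zk ∧ copy zi = i ∧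
        copy zk = k := by
      rcases hst with ⟨h1, h2⟩ | ⟨h1, h2⟩
      · exact ⟨_, _, hs₁, hs₂, h1, h2⟩
      · exact ⟨_, _, hs₂, hs₁, h2, h1⟩
    have hix : i ≠ copy x := by
      rcases hpt with ⟨h1, h2⟩ | ⟨h1, h2⟩
      · exact h1 ▸ hp₁'
      · exact h2 ▸ hp₂'
    have hjx : j ≠ copy x := by
      rcases hpt with ⟨h1, h2⟩ | ⟨h1, h2⟩
      · exact h2 ▸ hp₂'
      · exact h1 ▸ hp₁'
    have hkx : k ≠ copy x := by
      rcases hqt with ⟨h1, h2⟩ | ⟨h1, h2⟩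
      · exact h2 ▸ hq₂'
      · exact h1 ▸ hq₁'
    have hiI : i ∈ I := hi ▸ hc.mem xi
    have hjI : j ∈ I := hj ▸ hc.mem xj
    have hkI : k ∈ I := hk ▸ hc.mem yk
    have hcross : ∀ l ∈ I, j ≠ l → ∀ X : Finset V, X.card ≤ 3 →
        ∃ v, copy v = j ∧ (∃ w, G.Adj v w ∧ copy w = l) ∧ v ∉ X := by
      intro l hl hjl X hX
      obtain ⟨a, b, ha, -, hab⟩ := hc.cross j hjI l hl hjl
      by_contra hno
      push Not at hno
      have := Finset.card_le_card_of_injOn (s := Finset.univ) (t := X) a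
        (fun t _ => hno (a t) (hab t).2.1 ⟨b t, (hab t).1, (hab t).2.2⟩) ha.injOn
      rw [Finset.card_univ, Fintype.card_fin] at this
      omega
    have hkO : k ∈ ({copy x, i, j} : Set ℕ)ᶜ := by simp [hkx, hik.symm, hjk.symm]
    -- in copy `j`, the neighbour of `x` is led on to the remaining copies, that of `y` to copy `i`
    obtain ⟨R, K, hRK, hR, hK, hxR, hyK, hRj, hKj, ⟨v, hvR, w, hvw, hw⟩, v', hvK, w', hvw', hw'⟩ :=
      (hc.kconn j hjI).exists_disjoint_joinedIn hh
        (T := {v | ∃ w, G.Adj v w ∧ copy w ∈ ({copy x, i, j} : Set ℕ)ᶜ})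
        (U := {v | ∃ w, G.Adj v w ∧ copy w = i})
        (by
          intro v hv
          have hv : copy v = j := hv
          obtain ⟨w, h1, h2, h3⟩ := hc.exists_out v (copy x)
          by_cases h4 : copy w = i
          · exact Or.inr ⟨w, h1, h4⟩
          · exact Or.inl ⟨w, h1, by simp [h3, h4, hv ▸ h2]⟩)
        (fun X hX => by
          obtain ⟨v, h1, ⟨w, h2, h3⟩, h4⟩ := hcross k hkI hjk X hX
          exact ⟨v, h1, ⟨w, h2, h3 ▸ hkO⟩, h4⟩)
        (fun X hX => hcross i hiI hij.symm X hX) (x := xj) (y := yj) hj hj'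
        (hc.ne_of_adj hxj hyj (hj ▸ hjx) hcxy.symm hxy)
    have hRc : ∀ u ∈ R, copy u = j := hR
    have hKc : ∀ u ∈ K, copy u = j := hK
    refine ⟨{w | copy w ∈ I ∩ {i}} ∪ K, {w | copy w ∈ I ∩ {copy x, i, j}ᶜ} ∪ R, ?_, ?_, ?_,
      (hunion _).union hKj ⟨hc.mem _, hw'⟩ hvK hvw'.symm,
      (hunion _).union hRj ⟨hc.mem _, hw⟩ hvR hvw.symm, ?_, ?_⟩
    · rw [Set.disjoint_left]
      rintro u (⟨-, h1⟩ | h1) (⟨-, h2⟩ | h2)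
      · exact h2 (by rw [Set.mem_singleton_iff.1 h1]; simp)
      · exact hij ((Set.mem_singleton_iff.1 h1).symm.trans (hRc u h2))
      · exact h2 (by simp [hKc u h1])
      · exact Set.disjoint_left.1 hRK h2 h1
    · rintro u (⟨-, h1⟩ | h1)
      · rw [Set.mem_singleton_iff.1 h1]; exact hix
      · rw [hKc u h1]; exact hjx
    · rintro u (⟨-, h1⟩ | h1)
      · exact fun h => h1 (by simp [h])
      · rw [hRc u h1]; exact hjx
    · rintro u (rfl | rfl | rfl)
      · exact ⟨xi, Or.inl ⟨hc.mem _, hi⟩, hxi⟩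
      · exact ⟨yj, Or.inr hyK, hyj⟩
      · exact ⟨zi, Or.inl ⟨hc.mem _, hi'⟩, hzi⟩
    · rintro u (rfl | rfl | rfl)
      · exact ⟨xj, Or.inr hxR, hxj⟩
      · exact ⟨yk, Or.inl ⟨hc.mem _, hk ▸ hkO⟩, hyk⟩
      · exact ⟨zk, Or.inl ⟨hc.mem _, hk' ▸ hkO⟩, hzk⟩

/-- A connected set with neighbours of all elements of `S` provides a connector of `S`. -/
theorem joined_through {S A : Set V} (hA : G.JoinedIn A) (hAS : Disjoint A S)
    (hS : ∀ u ∈ S, ∃ v ∈ A, G.Adj u v) (E : Set (Sym2 V)) :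
    ∀ u ∈ S, ∀ v ∈ S, (G.through S A E).Reachable u v := by
  have hle : G.within A ≤ G.through S A E := fun u v huv =>
    ⟨huv.1, Or.inl huv.2.1, Or.inl huv.2.2,
      fun h => absurd h (Set.disjoint_left.1 hAS huv.2.1)⟩
  intro u hu v hv
  obtain ⟨a, ha, hua⟩ := hS u hu
  obtain ⟨b, hb, hvb⟩ := hS v hv
  have h1 : (G.through S A E).Reachable u a := Adj.reachable
    ⟨hua, Or.inr hu, Or.inl ha, fun _ h => absurd h (Set.disjoint_left.1 hAS ha)⟩
  have h2 : (G.through S A E).Reachable v b := Adj.reachable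
    ⟨hvb, Or.inr hv, Or.inl hb, fun _ h => absurd h (Set.disjoint_left.1 hAS hb)⟩
  exact (h1.trans ((hA a ha b hb).mono hle)).trans h2.symm

/-- Connectors inside the copy of `x`, `y` and `z` are completed by two connectors outside. -/
theorem CopyGraph.hasConnectors_three {copy : V → ℕ} {I : Set ℕ} {h : ℕ}
    (hc : G.CopyGraph copy I h) (hh : 4 ≤ h) {x y z : V} (hxy : x ≠ y) (hcxy : copy y = copy x)
    (hcxz : copy z = copy x) {t : ℕ} {W : Fin t → Set V} {E : Fin t → Set (Sym2 V)}
    (hW : G.Connectors {x, y, z} W E) (hWc : ∀ i, ∀ w ∈ W i, copy w = copy x) :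
    G.HasConnectors {x, y, z} (t + 2) := by
  obtain ⟨A, B, hAB, hA, hB, hAj, hBj, hAS, hBS⟩ := hc.exists_outer_pair hh hxy hcxy hcxz
  have hS : ∀ u ∈ ({x, y, z} : Set V), copy u = copy x := by
    rintro u (rfl | rfl | rfl)
    · rfl
    · exact hcxy
    · exact hcxz
  have hdisj : ∀ A : Set V, (∀ v ∈ A, copy v ≠ copy x) → Disjoint A {x, y, z} ∧
      ∀ i, Disjoint A (W i) := by
    intro A hA
    refine ⟨Set.disjoint_left.2 fun v hv hv' => hA v hv (hS v hv'),
      fun i => Set.disjoint_left.2 fun v hv hv' => hA v hv (hWc i v hv')⟩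
  have h1 := hW.option (hdisj A hA).1 (hdisj A hA).2 (fun _ => Set.empty_disjoint _)
    (joined_through hAj (hdisj A hA).1 hAS ∅)
  have h2 := h1.option (hdisj B hB).1
    (by
      rintro (_ | i)
      · exact hAB.symm
      · exact (hdisj B hB).2 i)
    (fun _ => Set.empty_disjoint _) (joined_through hBj (hdisj B hB).1 hBS ∅)
  exact h2.hasConnectors (by simp)

/-! ### Transport along embeddings, and vertex connectivity -/

section Transport

variable {V' : Type*} {H : SimpleGraph V'}

theorem reachable_map {K : SimpleGraph V} {K' : SimpleGraph V'} {f : V' → V}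
    (hf : ∀ u v, K'.Adj u v → K.Adj (f u) (f v)) {u v : V'} (h : K'.Reachable u v) :
    K.Reachable (f u) (f v) :=
  h.map (G' := K) ⟨f, fun h => hf _ _ h⟩

theorem KConn.map {h : ℕ} (hH : H.KConn Set.univ h) {f : V' → V} (hf : Function.Injective f)
    (hadj : ∀ u v, H.Adj u v → G.Adj (f u) (f v)) : G.KConn (Set.range f) h := by
  classical
  refine ⟨?_, ?_⟩
  · rw [← Set.image_univ, Set.ncard_image_of_injective _ hf]
    exact hH.1
  · rintro X hX _ ⟨⟨u, rfl⟩, hu⟩ _ ⟨⟨v, rfl⟩, hv⟩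
    have hX' : (X.preimage f hf.injOn).card < h :=
      lt_of_le_of_lt (Finset.card_le_card_of_injOn f (fun w hw => by simpa using hw) hf.injOn) hX
    refine reachable_map ?_ (hH.2 _ hX' u ⟨trivial, by simpa using hu⟩ v
      ⟨trivial, by simpa using hv⟩)
    rintro a b ⟨hab, ha, hb⟩
    exact ⟨hadj a b hab, ⟨⟨a, rfl⟩, by simpa using ha.2⟩, ⟨b, rfl⟩, by simpa using hb.2⟩

theorem Connectors.map {ι : Type*} {S : Set V'} {W : ι → Set V'} {E : ι → Set (Sym2 V')}
    (hW : H.Connectors S W E) {f : V' → V} (hf : Function.Injective f)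
    (hadj : ∀ u v, H.Adj u v → G.Adj (f u) (f v)) :
    G.Connectors (f '' S) (fun i => f '' W i) (fun i => Sym2.map f '' E i) := by
  refine ⟨fun i => ?_, fun i j hij => ?_, fun i j hij => ?_, ?_⟩
  · exact (Set.disjoint_image_iff hf).2 (hW.disjoint_left i)
  · exact (Set.disjoint_image_iff hf).2 (hW.disjoint i j hij)
  · exact (Set.disjoint_image_iff (Sym2.map.injective hf)).2 (hW.disjoint_edge i j hij)
  · rintro i _ ⟨u, hu, rfl⟩ _ ⟨v, hv, rfl⟩
    refine reachable_map ?_ (hW.joined i u hu v hv)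
    rintro a b ⟨hab, ha, hb, hE⟩
    refine ⟨hadj a b hab, ?_, ?_, ?_⟩
    · rw [← Set.image_union]
      exact ⟨a, ha, rfl⟩
    · rw [← Set.image_union]
      exact ⟨b, hb, rfl⟩
    · intro h1 h2
      exact ⟨s(a, b), hE ((Function.Injective.mem_set_image hf).1 h1)
        ((Function.Injective.mem_set_image hf).1 h2), rfl⟩

end Transport

theorem IsVertexConnected.kConn [Finite V] {m : ℕ} (h : G.IsVertexConnected m) :
    G.KConn Set.univ m := by
  refine ⟨?_, ?_⟩
  · rw [Set.ncard_univ]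
    have := h.1
    rw [ENat.card_eq_coe_natCard] at this
    exact_mod_cast this
  · rintro X hX u ⟨-, hu⟩ v ⟨-, hv⟩
    have := (h.2 X hX).preconnected ⟨u, hu⟩ ⟨v, hv⟩
    refine reachable_map (f := Subtype.val) ?_ this
    rintro ⟨a, ha⟩ ⟨b, hb⟩ hab
    exact ⟨hab, ⟨trivial, ha⟩, trivial, hb⟩

/-! ### The upper bound -/

/-- An edge with an end in `S` belongs to at most one connector of `S`. -/
theorem Connectors.eq_of_adj {ι : Type*} {S : Set V} {W : ι → Set V} {E : ι → Set (Sym2 V)}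
    (hW : G.Connectors S W E) {i j : ι} {x w : V} (hx : x ∈ S)
    (hi : (G.through S (W i) (E i)).Adj x w) (hj : (G.through S (W j) (E j)).Adj x w) : i = j := by
  by_contra hij
  by_cases hw : w ∈ S
  · exact Set.disjoint_left.1 (hW.disjoint_edge i j hij) (hi.2.2.2 hx hw) (hj.2.2.2 hx hw)
  · exact Set.disjoint_left.1 (hW.disjoint i j hij) (hi.2.2.1.resolve_right hw)
      (hj.2.2.1.resolve_right hw)

/-- If there were `d` connectors, each would use exactly one edge at `x` and one edge at `y`; but
then the one that uses the edge `xy` would not reach `z`. -/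
theorem HasConnectors.lt_degree [Fintype V] [DecidableRel G.Adj] {x y z : V} (hadj : G.Adj x y)
    (hxz : x ≠ z) (hyz : y ≠ z) {d t : ℕ} (hx : G.degree x = d) (hy : G.degree y = d)
    (h : G.HasConnectors {x, y, z} t) : t < d := by
  classical
  obtain ⟨W, E, hW⟩ := h
  have key : ∀ u ∈ ({x, y, z} : Set V), u ≠ z → G.degree u = d → d ≤ t →
      ∀ w, G.Adj u w → ∃ i, (G.through {x, y, z} (W i) (E i)).Adj u w ∧
        ∀ w', (G.through {x, y, z} (W i) (E i)).Adj u w' → w' = w := by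
    intro u hu huz hdeg hdt
    have hn : ∀ i, ∃ n, (G.through {x, y, z} (W i) (E i)).Adj u n := by
      intro i
      by_contra hno
      push Not at hno
      have := (hW.joined i u hu z (by simp)).mem_of_closed (C := {u}) rfl
        (fun a b ha hab => absurd (Set.mem_singleton_iff.1 ha ▸ hab) (hno b))
      exact huz this.symm
    choose n hn using hn
    have hinj : Function.Injective n := fun i j hij => hW.eq_of_adj hu (hn i) (hij ▸ hn j)
    have himg : Finset.univ.image n = G.neighborFinset u := by
      refine Finset.eq_of_subset_of_card_le ?_ ?_
      · intro w hw
        obtain ⟨i, -, rfl⟩ := Finset.mem_image.1 hw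
        exact (G.mem_neighborFinset u _).2 (hn i).1
      · rw [Finset.card_image_of_injective _ hinj, Finset.card_univ, Fintype.card_fin,
          G.card_neighborFinset_eq_degree, hdeg]
        exact hdt
    have hsurj : ∀ w, G.Adj u w → ∃ i, n i = w := by
      intro w hw
      have : w ∈ Finset.univ.image n := himg ▸ (G.mem_neighborFinset u w).2 hw
      simpa using this
    intro w hw
    obtain ⟨i, rfl⟩ := hsurj w hw
    refine ⟨i, hn i, fun w' hw' => ?_⟩
    obtain ⟨j, rfl⟩ := hsurj w' hw'.1
    rw [hW.eq_of_adj hu hw' (hn j)]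
  by_contra hdt
  push Not at hdt
  obtain ⟨i, hi, hix⟩ := key x (by simp) hxz hx hdt y hadj
  obtain ⟨j, hj, hjy⟩ := key y (by simp) hyz hy hdt x hadj.symm
  obtain rfl := hW.eq_of_adj (by simp) hi hj.symm
  have := (hW.joined i x (by simp) z (by simp)).mem_of_closed (C := {x, y}) (by simp) (by
    rintro a b (rfl | rfl) hab
    · exact Or.inr (hix b hab)
    · exact Or.inl (hjy b hab))
  rcases this with h | h
  · exact hxz h.symm
  · exact hyz h.symm

theorem IsRegularOfDegree.genConnectivity_three_le [Fintype V] [DecidableRel G.Adj] {d : ℕ}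
    (hG : G.IsRegularOfDegree d) {x y z : V} (hxy : G.Adj x y) (hxz : x ≠ z) (hyz : y ≠ z) :
    G.genConnectivity 3 ≤ ((d - 1 : ℕ) : ℕ∞) := by
  classical
  refine (iInf₂_le ({x, y, z} : Finset V) (Finset.card_eq_three.2
    ⟨x, y, z, hxy.ne, hxz, hyz, rfl⟩)).trans (iSup₂_le fun t ht => ?_)
  obtain ⟨T, hT⟩ := ht
  have h1 := hT.hasConnectors
  simp only [Finset.coe_insert, Finset.coe_singleton] at h1
  have h2 := h1.lt_degree hxy hxz hyz (hG x) (hG y)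
  exact_mod_cast Nat.le_sub_one_of_lt h2

theorem le_genConnectivity_three [Finite V] {t : ℕ} (h : ∀ x y z : V, x ≠ y → x ≠ z → y ≠ z →
    G.HasConnectors {x, y, z} t) : (t : ℕ∞) ≤ G.genConnectivity 3 := by
  classical
  refine le_iInf₂ fun S hS => ?_
  obtain ⟨x, y, z, hxy, hxz, hyz, rfl⟩ := Finset.card_eq_three.1 hS
  refine HasConnectors.le_setConnectivity (by simp) ?_
  simpa using h x y z hxy hxz hyz

theorem hasConnectors_of_le_genConnectivity {t : ℕ} (h : (t : ℕ∞) ≤ G.genConnectivity 3)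
    {x y z : V} (hxy : x ≠ y) (hxz : x ≠ z) (hyz : y ≠ z) : G.HasConnectors {x, y, z} t := by
  classical
  have := hasConnectors_of_le (h.trans (iInf₂_le ({x, y, z} : Finset V) (Finset.card_eq_three.2
    ⟨x, y, z, hxy, hxz, hyz, rfl⟩)))
  simpa using this

/-- The whole of a connected graph is one connector. -/
theorem KConn.hasConnectors_one {m : ℕ} (hG : G.KConn Set.univ m) (hm : 0 < m) (S : Set V) :
    G.HasConnectors S 1 := by
  refine ⟨fun _ => Sᶜ, fun _ => Set.univ, ⟨fun _ => disjoint_compl_left, fun i j hij => ?_,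
    fun i j hij => ?_, fun _ u _ v _ => ?_⟩⟩
  · exact absurd (Subsingleton.elim i j) hij
  · exact absurd (Subsingleton.elim i j) hij
  · refine (hG.2 ∅ (by simpa) u (by simp) v (by simp)).mono fun a b hab => ?_
    exact ⟨hab.1, by simp, by simp, fun _ _ => trivial⟩

/-! ### Recursive constructions -/

/-- Double counting of the edges that leave copy `i`. -/
theorem card_cross [Fintype V] {copy : V → ℕ} {p c : ℕ} (hmem : ∀ v, copy v ∈ Finset.Icc 1 p)
    (hout : ∀ u, (G.outsideNeighbors copy u).ncard = 2) {i : ℕ} (hi : i ∈ Finset.Icc 1 p)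
    (hcross : ∀ j ∈ Finset.Icc 1 p, i ≠ j → (G.crossEdges copy i j).ncard = c) :
    {v | copy v = i}.ncard * 2 = (p - 1) * c := by
  classical
  set P : Finset (V × V) := Finset.univ.filter
    fun e => G.Adj e.1 e.2 ∧ copy e.1 = i ∧ copy e.2 ≠ i with hP
  have h1 : P.card = ∑ v ∈ Finset.univ.filter (fun v => copy v = i),
      (P.filter fun e => e.1 = v).card :=
    Finset.card_eq_sum_card_fiberwise fun e he => by
      simp only [hP, Finset.coe_filter, Set.mem_ofPred_eq, Finset.mem_univ, true_and] at he ⊢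
      exact he.2.1
  have h2 : P.card = ∑ j ∈ (Finset.Icc 1 p).erase i, (P.filter fun e => copy e.2 = j).card :=
    Finset.card_eq_sum_card_fiberwise fun e he => by
      simp only [hP, Finset.coe_filter, Set.mem_ofPred_eq, Finset.mem_univ, true_and] at he
      exact Finset.mem_erase.2 ⟨he.2.2, hmem _⟩
  have h3 : ∀ v ∈ Finset.univ.filter (fun v => copy v = i),
      (P.filter fun e => e.1 = v).card = 2 := by
    intro v hv
    have hv : copy v = i := by simpa using hv
    rw [← hout v, ← Set.ncard_coe_finset]
    have : (↑(P.filter fun e => e.1 = v) : Set (V × V)) =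
        (fun w => (v, w)) '' G.outsideNeighbors copy v := by
      ext ⟨a, b⟩
      simp only [hP, outsideNeighbors, Finset.coe_filter, Finset.mem_filter, Finset.mem_univ,
        true_and, Set.mem_ofPred_eq, Set.mem_image, Prod.mk.injEq]
      constructor
      · rintro ⟨⟨h1, h2, h3⟩, rfl⟩
        exact ⟨b, ⟨h1, h2 ▸ h3⟩, rfl, rfl⟩
      · rintro ⟨w, ⟨h1, h2⟩, rfl, rfl⟩
        exact ⟨⟨h1, hv, hv ▸ h2⟩, rfl⟩
    rw [this, Set.ncard_image_of_injective _ (Prod.mk_right_injective v)]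
  have h4 : ∀ j ∈ (Finset.Icc 1 p).erase i, (P.filter fun e => copy e.2 = j).card = c := by
    intro j hj
    rw [Finset.mem_erase] at hj
    rw [← hcross j hj.2 hj.1.symm, ← Set.ncard_coe_finset]
    congr 1
    ext ⟨a, b⟩
    simp only [hP, crossEdges, Finset.coe_filter, Finset.mem_filter, Finset.mem_univ, true_and,
      Set.mem_ofPred_eq]
    constructor
    · rintro ⟨⟨h1, h2, -⟩, h3⟩
      exact ⟨h1, h2, h3⟩
    · rintro ⟨h1, h2, h3⟩
      exact ⟨⟨h1, h2, h3 ▸ hj.1⟩, h3⟩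
  rw [Finset.sum_congr rfl h3, Finset.sum_const, smul_eq_mul] at h1
  rw [Finset.sum_congr rfl h4, Finset.sum_const, smul_eq_mul, Finset.card_erase_of_mem hi,
    Nat.card_Icc, Nat.add_sub_cancel] at h2
  rw [← h2, h1, ← Set.ncard_coe_finset]
  simp

/-- Since the outside neighbours of a vertex lie in different copies, the edges between two copies
form a matching. -/
theorem copyGraph_of_crossEdges [Finite V] {copy : V → ℕ} {I : Set ℕ} {h c : ℕ}
    (hmem : ∀ v, copy v ∈ I) (hconn : ∀ i ∈ I, G.KConn {v | copy v = i} h)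
    (hout : ∀ u, (G.outsideNeighbors copy u).ncard = 2)
    (hdiff : ∀ u, Set.InjOn copy (G.outsideNeighbors copy u))
    (hcross : ∀ i ∈ I, ∀ j ∈ I, i ≠ j → (G.crossEdges copy i j).ncard = c) (hc : h + 2 ≤ c) :
    G.CopyGraph copy I h := by
  classical
  refine ⟨hmem, hconn, fun u => ?_, fun i hi j hj hij => ?_⟩
  · obtain ⟨o₁, o₂, hne, ho⟩ := Set.ncard_eq_two.1 (hout u)
    have h1 : o₁ ∈ G.outsideNeighbors copy u := by simp [ho]
    have h2 : o₂ ∈ G.outsideNeighbors copy u := by simp [ho]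
    refine ⟨o₁, o₂, h1.1, h2.1, h1.2, h2.2, fun e => hne (hdiff u h1 h2 e), fun w hw hw' => ?_⟩
    have : w ∈ G.outsideNeighbors copy u := ⟨hw, hw'⟩
    simpa [ho] using this
  · have : Nonempty (Fin (h + 2) ↪ G.crossEdges copy i j) := by
      have := Fintype.ofFinite (G.crossEdges copy i j)
      refine Function.Embedding.nonempty_of_card_le ?_
      rw [Fintype.card_fin, ← Nat.card_eq_fintype_card, Nat.card_coe_set_eq, hcross i hi j hj hij]
      exact hc
    obtain ⟨e⟩ := this
    refine ⟨fun k => (e k).1.1, fun k => (e k).1.2, fun k k' hk => ?_, fun k k' hk => ?_,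
      fun k => (e k).2⟩
    · obtain ⟨h1, h2, h3⟩ := (e k).2
      obtain ⟨h1', h2', h3'⟩ := (e k').2
      dsimp only at hk
      refine e.injective (Subtype.ext (Prod.ext hk ?_))
      refine hdiff (e k).1.1 ⟨h1, ?_⟩ ⟨hk ▸ h1', ?_⟩ (h3.trans h3'.symm)
      · rw [h2, h3]; exact hij.symm
      · rw [h2, h3']; exact hij.symm
    · obtain ⟨h1, h2, h3⟩ := (e k).2
      obtain ⟨h1', h2', h3'⟩ := (e k').2
      dsimp only at hk
      refine e.injective (Subtype.ext (Prod.ext ?_ hk))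
      refine hdiff (e k).1.2 ⟨h1.symm, ?_⟩ ⟨hk ▸ h1'.symm, ?_⟩ (h2.trans h2'.symm)
      · rw [h2, h3]; exact hij
      · rw [h2', h3]; exact hij

section Recursive

variable {n r a : ℕ} {p : ℕ → ℕ} {V : ℕ → Type*} [∀ k, Fintype (V k)] {G : ∀ k, SimpleGraph (V k)}
  [∀ k, DecidableRel (G k).Adj] {copy : ∀ k, V k → ℕ}

theorem IsRecursivelyRegular.kConn (hG : IsRecursivelyRegular n r a p V G copy) {k : ℕ}
    (hk : 1 ≤ k) (hkn : k ≤ n) : (G k).KConn Set.univ (r + 2 * (k - 1)) :=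
  (hG.connected k hk hkn).kConn

/-- The embedding of `G k` onto copy `i` in `G (k + 1)`. -/
theorem IsRecursivelyRegular.exists_embedding (hG : IsRecursivelyRegular n r a p V G copy) {k : ℕ}
    (hk : 1 ≤ k) (hkn : k + 1 ≤ n) {i : ℕ} (hi : i ∈ Finset.Icc 1 (p (k + 1))) :
    ∃ f : V k → V (k + 1), Function.Injective f ∧
      (∀ u v, (G k).Adj u v → (G (k + 1)).Adj (f u) (f v)) ∧
      Set.range f = {v | copy (k + 1) v = i} := by
  obtain ⟨φ⟩ := hG.copy_iso (k + 1) (by omega) hkn i hi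
  change (G (k + 1)).induce _ ≃g G k at φ
  refine ⟨fun v => (φ.symm v).1, fun u v huv => φ.symm.injective (Subtype.ext huv),
    fun u v huv => φ.symm.map_adj_iff.2 huv, ?_⟩
  ext w
  constructor
  · rintro ⟨v, rfl⟩
    exact (φ.symm v).2
  · intro hw
    exact ⟨φ ⟨w, hw⟩, by simp⟩

theorem IsRecursivelyRegular.ncard_copy (hG : IsRecursivelyRegular n r a p V G copy) {k : ℕ}
    (hk : 1 ≤ k) (hkn : k + 1 ≤ n) {i : ℕ} (hi : i ∈ Finset.Icc 1 (p (k + 1))) :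
    {v | copy (k + 1) v = i}.ncard = Fintype.card (V k) := by
  obtain ⟨f, hf, -, hr⟩ := hG.exists_embedding hk hkn hi
  rw [← hr, ← Set.image_univ, Set.ncard_image_of_injective _ hf, Set.ncard_univ,
    Nat.card_eq_fintype_card]

theorem IsRecursivelyRegular.card (hG : IsRecursivelyRegular n r a p V G copy) {k : ℕ}
    (hk : 1 ≤ k) (hkn : k ≤ n) : Fintype.card (V k) = a * ∏ i ∈ Finset.Icc 2 k, p i := by
  classical
  induction k, hk using Nat.le_induction with
  | base => simpa using hG.card_one
  | succ k hk ih =>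
    have h1 : Fintype.card (V (k + 1)) =
        ∑ i ∈ Finset.Icc 1 (p (k + 1)), (Finset.univ.filter fun v => copy (k + 1) v = i).card := by
      rw [← Finset.card_univ]
      exact Finset.card_eq_sum_card_fiberwise
        fun v _ => hG.copy_mem (k + 1) (by omega) hkn v
    have h2 : ∀ i ∈ Finset.Icc 1 (p (k + 1)),
        (Finset.univ.filter fun v => copy (k + 1) v = i).card = Fintype.card (V k) := by
      intro i hi
      rw [← hG.ncard_copy hk hkn hi, ← Set.ncard_coe_finset]
      simp
    rw [h1, Finset.sum_congr rfl h2, Finset.sum_const, smul_eq_mul, Nat.card_Icc,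
      Nat.add_sub_cancel, ih (by omega), Finset.prod_Icc_succ_top (by omega)]
    ring

/-- The graph `G (k + 1)` is composed of copies of `G k` as in `CopyGraph`; the number of edges
between two copies is found by double counting. -/
theorem IsRecursivelyRegular.copyGraph (hG : IsRecursivelyRegular n r a p V G copy) {k : ℕ}
    (hk : 1 ≤ k) (hkn : k + 1 ≤ n) (h4 : 4 ≤ r + 2 * (k - 1)) :
    (G (k + 1)).CopyGraph (copy (k + 1)) (Finset.Icc 1 (p (k + 1)) : Finset ℕ)
      (r + 2 * (k - 1)) := by
  obtain ⟨c, hc⟩ := hG.same_cross (k + 1) (by omega) hkn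
  have hmem := hG.copy_mem (k + 1) (by omega) hkn
  have hout := hG.two_outside (k + 1) (by omega) hkn
  refine copyGraph_of_crossEdges (fun v => hmem v) (fun i hi => ?_) hout
    (hG.outside_different (k + 1) (by omega) hkn) (fun i hi j hj => hc i hi j hj) ?_
  · obtain ⟨f, hf, hadj, hr⟩ := hG.exists_embedding hk hkn (Finset.mem_coe.1 hi)
    rw [← hr]
    exact (hG.kConn hk (by omega)).map hf hadj
  · have hmany := hG.many_cross (k + 1) (by omega) hkn (by
      rw [show k + 1 - 2 = k - 1 by omega]; exact h4)
    obtain ⟨v⟩ : Nonempty (V (k + 1)) := by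
      rw [← Fintype.card_pos_iff, ← Nat.card_eq_fintype_card, ← Set.ncard_univ]
      exact lt_of_le_of_lt (Nat.zero_le _) (hG.kConn (by omega) hkn).1
    have hcount := card_cross hmem hout (hmem v) fun j hj => hc _ (hmem v) j hj
    rw [hG.ncard_copy hk hkn (hmem v), hG.card hk (by omega)] at hcount
    have hp1 : 1 ≤ p (k + 1) := by
      have := Finset.mem_Icc.1 (hmem v)
      omega
    rw [show k + 1 - 1 = k by omega] at hmany
    have hcountQ : (a : ℚ) * (∏ i ∈ Finset.Icc 2 k, (p i : ℚ)) * 2 =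
        ((p (k + 1) : ℚ) - 1) * c := by
      have : ((a * (∏ i ∈ Finset.Icc 2 k, p i) * 2 : ℕ) : ℚ) = ((p (k + 1) - 1) * c : ℕ) := by
        rw [hcount]
      push_cast [hp1] at this
      exact this
    have hk1 : (1 : ℚ) ≤ k := by exact_mod_cast hk
    have hr0 : (0 : ℚ) ≤ r := by positivity
    push_cast at hmany
    -- division by zero would make the bound on the number of edges false
    have hpne : (p (k + 1) : ℚ) - 1 ≠ 0 := by
      intro h0
      rw [h0, div_zero] at hmany
      linarith
    rw [show (2 : ℚ) * a * ∏ i ∈ Finset.Icc 2 k, (p i : ℚ) = ((p (k + 1) : ℚ) - 1) * c by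
      rw [← hcountQ]; ring, mul_div_cancel_left₀ _ hpne] at hmany
    have : ((r + 2 * (k - 1) + 2 : ℕ) : ℚ) ≤ c := by
      push_cast [hk]
      linarith
    exact_mod_cast this

/-- The lower bound: any three vertices of `G k` have one connector fewer than the degree. -/
theorem IsRecursivelyRegular.hasConnectors (hG : IsRecursivelyRegular n r a p V G copy)
    (hr : 2 ≤ r) (hκ : ((r - 1 : ℕ) : ℕ∞) ≤ (G 1).genConnectivity 3) {k : ℕ} (hk : 1 ≤ k)
    (hkn : k ≤ n) : ∀ x y z : V k, x ≠ y → x ≠ z → y ≠ z →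
      (G k).HasConnectors {x, y, z} (r + 2 * k - 3) := by
  induction k, hk using Nat.le_induction with
  | base => exact fun x y z hxy hxz hyz => hasConnectors_of_le_genConnectivity hκ hxy hxz hyz
  | succ k hk ih =>
    intro x y z hxy hxz hyz
    by_cases h4 : 4 ≤ r + 2 * (k - 1)
    · have hc := hG.copyGraph hk hkn h4
      have hmem := hG.copy_mem (k + 1) (by omega) hkn
      rw [show r + 2 * (k + 1) - 3 = r + 2 * (k - 1) + 1 by omega]
      by_cases hcxy : copy (k + 1) x = copy (k + 1) y
      · by_cases hcxz : copy (k + 1) z = copy (k + 1) x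
        · obtain ⟨f, hf, hadj, hrange⟩ := hG.exists_embedding hk hkn (hmem x)
          have hmemf : ∀ u, copy (k + 1) u = copy (k + 1) x → ∃ v, f v = u := fun u hu => by
            have : u ∈ Set.range f := by rw [hrange]; exact hu
            exact this
          obtain ⟨x, rfl⟩ := hmemf x rfl
          obtain ⟨y, rfl⟩ := hmemf y hcxy.symm
          obtain ⟨z, rfl⟩ := hmemf z hcxz
          obtain ⟨W, E, hW⟩ := ih (by omega) x y z (fun e => hxy (e ▸ rfl))
            (fun e => hxz (e ▸ rfl)) (fun e => hyz (e ▸ rfl))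
          have hW' := hW.map hf hadj
          simp only [Set.image_insert_eq, Set.image_singleton] at hW'
          have := hc.hasConnectors_three h4 hxy hcxy.symm hcxz hW' (by
            rintro i _ ⟨w, -, rfl⟩
            have : f w ∈ Set.range f := ⟨w, rfl⟩
            rw [hrange] at this
            exact this)
          rwa [show r + 2 * k - 3 + 2 = r + 2 * (k - 1) + 1 by omega] at this
        · exact hc.hasConnectors_two_one (by omega) hxy hcxy hcxz
      · by_cases hcxz : copy (k + 1) x = copy (k + 1) z
        · have := hc.hasConnectors_two_one (by omega) hxz hcxz (z := y) (Ne.symm hcxy)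
          rwa [Set.pair_comm] at this
        · by_cases hcyz : copy (k + 1) y = copy (k + 1) z
          · have := hc.hasConnectors_two_one (by omega) hyz hcyz (z := x) hcxy
            rwa [Set.pair_comm z x, Set.insert_comm] at this
          · exact hc.hasConnectors_one_one_one (by omega) hcxy hcxz hcyz
    · have hd : r + 2 * (k + 1 - 1) = 4 ∨ r + 2 * (k + 1 - 1) = 5 := by omega
      have := (hG.kConn (by omega) hkn).hasConnectors hd hxy hxz hyz
      rwa [show r + 2 * (k + 1 - 1) - 1 = r + 2 * (k + 1) - 3 by omega] at this

end Recursive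

end SimpleGraph

theorem theorem1 (n r a : ℕ) (hn : 1 ≤ n) (hr : 1 ≤ r) (ha : 1 ≤ a) (p : ℕ → ℕ)
    (V : ℕ → Type*) [∀ k, Fintype (V k)]
    (G : ∀ k, SimpleGraph (V k)) [∀ k, DecidableRel (G k).Adj]
    (copy : ∀ k, V k → ℕ)
    (hG : SimpleGraph.IsRecursivelyRegular n r a p V G copy)
    (hκ : (G 1).genConnectivity 3 = ((r - 1 : ℕ) : ℕ∞))
    (hcommon : 2 ≤ n → ∀ u v : V n, copy n u ≠ copy n v →
      ((G n).outsideNeighbors (copy n) u ∩ (G n).outsideNeighbors (copy n) v).ncard ≤ 1) :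
    (G n).genConnectivity 3 = ((r + 2 * n - 3 : ℕ) : ℕ∞) := by
  classical
  have hr2 : 2 ≤ r := by
    -- a connected graph has `κ₃ ≥ 1`
    by_contra hlt
    have h1 : ((1 : ℕ) : ℕ∞) ≤ (G 1).genConnectivity 3 :=
      SimpleGraph.le_genConnectivity_three fun x y z _ _ _ =>
        (hG.kConn le_rfl hn).hasConnectors_one (by omega) _
    rw [hκ] at h1
    have : 1 ≤ r - 1 := by exact_mod_cast h1
    omega
  refine le_antisymm ?_ (SimpleGraph.le_genConnectivity_three
    (hG.hasConnectors hr2 hκ.ge hn le_rfl))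
  have hK := hG.kConn hn le_rfl
  obtain ⟨x, -, -⟩ := hK.exists_notMem (X := ∅) (by simp)
  obtain ⟨y, -, -, -, hxy⟩ := hK.exists_adj (X := ∅) (by simp; omega) (x := x) trivial (by simp)
  obtain ⟨z, -, hz⟩ := hK.exists_notMem (X := {x, y})
    (Finset.card_le_two.trans (by omega))
  simp only [Finset.mem_insert, Finset.mem_singleton, not_or] at hz
  have := (hG.regular n hn le_rfl).genConnectivity_three_le hxy (Ne.symm hz.1) (Ne.symm hz.2)
  rwa [show r + 2 * (n - 1) - 1 = r + 2 * n - 3 by omega] at this
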